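/- **Lemma 3.6 (decay of the Euler correctors).** Let $L>0$, $\Omega=(0,L)\times(0,\infty)$ with coordinates $(x,Y)$, and fix one of the two families of weights $w_m(Y)=(1+Y)^m$ (polynomial case) or $w_m(Y)=e^{mY}$ (exponential case). Let $u^0_e\in C^\infty([0,\infty))$ satisfy $c_0\le u^0_e\le C_0$ for some constants $0<c_0\le C_0<\infty$, and let every derivative $\partial_Y^ju^0_e$, $j\ge1$, decay faster than any power of $Y$. Let $m_i,l_i>0$, and let the following data be given: - $V_0,V_L\in C^\infty([0,\infty))$ with $|\partial_Y^jV_0|+|\partial_Y^jV_L|\le C_j\,w_{m_i}^{-1}$ for all $j\ge0$; - $F\in C^\infty([0,L]\times[0,\infty))$ with $|\partial_x^a\partial_Y^bF|\le C_{a,b}\,w_{l_i}^{-1}$ for all $a,b\ge0$; - a smooth function $v^{i-1}_p(\cdot,0)$ on $[0,L]$. Consider the Euler corrector problem $$-u^0_e\,\Delta v^i_e+u^0_{eYY}\,v^i_e=F\ \text{ in }\Omega,\qquad v^i_e|_{Y=0}=-v^{i-1}_p(\cdot,0),\quad v^i_e|_{x=0}=V_0,\quad v^i_e|_{x=L}=V_L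 .$$ A solution is a function $v^i_e\in C^2(\Omega)\cap C(\overline\Omega)$ that satisfies these equations pointwise and $\int_\Omega |v^i_e|^2(1+Y)^{-2}\,dx\,dY<\infty$ (this excludes solutions growing as $Y\to\infty$, and holds for every bounded solution and every solution in $L^2(\Omega)$). Assume that the data are well-prepared to every order at the corners $(0,0)$ and $(L,0)$: put $h^{0}_0=V_0$, $h^{L}_0=V_L$ and, for $x_0\in\{0,L\}$ and $j\ge0$, $$h^{x_0}_{j+1}=-\partial_Y^2h^{x_0}_j+\frac{u^0_{eYY}}{u^0_e}\,h^{x_0}_j-\frac{\partial_x^{2j}F(x_0,\cdot)}{u^0_e},$$ the value of $\partial_x^{2j+2}v^i_e$ on the side $x=x_0$ forced by the equation; then $h^{x_0}_j(0)=-\partial_x^{2j}v^{i-1}_p(x_0,0)$ for all $j\ge0$. Let $m'<m_i':=\min\{m_i,l_i\}$; in the exponential case let $L$ also be so small that $m'L<\pi$. Then, for every $k\ge0$, there is a constant $C$, depending on $k$, $m'$ and the data only, such that every solution $v^i_e$ is smooth in $\Omega$ and satisfies $$\|v^i_e\,w_{m'}\|_{W^{k,\infty}(\Omega)}\le C .$$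 -/

import Mathlib

open MeasureTheory Set
open scoped ContDiff ENNReal NNReal

noncomputable section

namespace EulerLayer

/-- The half-strip `Ω = (0, L) × (0, ∞)` with coordinates `(x, Y)`. -/
def strip (L : ℝ) : Set (ℝ × ℝ) := Ioo 0 L ×ˢ Ioi 0

/-- The closed half-strip `[0, L] × [0, ∞)`. -/
def closedStrip (L : ℝ) : Set (ℝ × ℝ) := Icc 0 L ×ˢ Ici 0

/-- The partial derivative `∂_x f`. -/
def dX (f : ℝ → ℝ → ℝ) : ℝ → ℝ → ℝ := fun x Y => deriv (fun s => f s Y) x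

/-- The partial derivative `∂_Y f`. -/
def dY (f : ℝ → ℝ → ℝ) : ℝ → ℝ → ℝ := fun x Y => deriv (fun t => f x t) Y

/-- The mixed partial derivative `∂_x^a ∂_Y^b f`. -/
def partialD (a b : ℕ) (f : ℝ → ℝ → ℝ) : ℝ → ℝ → ℝ := dX^[a] (dY^[b] f)

/-- The Laplacian `Δ f = ∂_x^2 f + ∂_Y^2 f`. -/
def lap (f : ℝ → ℝ → ℝ) : ℝ → ℝ → ℝ := fun x Y => partialD 2 0 f x Y + partialD 0 2 f x Y

/-- The two families of weights. -/
inductive WeightKind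
  | polynomial
  | exponential

/-- `w_m(Y) = (1 + Y)^m` or `w_m(Y) = e^{mY}`. -/
def weight : WeightKind → ℝ → ℝ → ℝ
  | .polynomial, m, Y => (1 + Y) ^ m
  | .exponential, m, Y => Real.exp (m * Y)

/-- The norm of `W^{k,∞}(Ω)`, for functions that have the classical derivatives in question:
the maximum over `a + b ≤ k` of the essential supremum over `Ω` of `|∂_x^a ∂_Y^b f|`. -/
def wkInftyNorm (L : ℝ) (k : ℕ) (f : ℝ → ℝ → ℝ) : ℝ≥0∞ :=
  ⨆ (a : ℕ) (b : ℕ) (_ : a + b ≤ k),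
    eLpNorm (fun p : ℝ × ℝ => partialD a b f p.1 p.2) ∞ (volume.restrict (strip L))

/-- An outer shear flow `u = u^0_e(Y)`: smooth on `[0, ∞)` (as a restriction of a smooth function
on `ℝ`), bounded above and below by positive constants, with rapidly decaying derivatives. -/
structure IsShearFlow (u : ℝ → ℝ) : Prop where
  smooth : ContDiff ℝ ∞ u
  bounds : ∃ c₀ C₀ : ℝ, 0 < c₀ ∧ ∀ Y, 0 ≤ Y → c₀ ≤ u Y ∧ u Y ≤ C₀
  decay : ∀ j : ℕ, 1 ≤ j → ∀ M : ℕ, ∃ C : ℝ, ∀ Y, 0 ≤ Y → (1 + Y) ^ M * |iteratedDeriv j u Y| ≤ C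

/-- Smooth side data `V` on `[0, ∞)` that decay like `w_m^{-1}` together with all derivatives. -/
structure SideDecay (κ : WeightKind) (m : ℝ) (V : ℝ → ℝ) : Prop where
  smooth : ContDiff ℝ ∞ V
  decay : ∀ j : ℕ, ∃ C : ℝ, ∀ Y, 0 ≤ Y → |iteratedDeriv j V Y| * weight κ m Y ≤ C

/-- A smooth forcing `F` on `[0, L] × [0, ∞)` that decays like `w_l^{-1}` as `Y → ∞`, together
with all derivatives and uniformly in `x`. -/
structure ForcingDecay (κ : WeightKind) (L l : ℝ) (F : ℝ → ℝ → ℝ) : Prop where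
  smooth : ContDiff ℝ ∞ (Function.uncurry F)
  decay : ∀ a b : ℕ, ∃ C : ℝ, ∀ x ∈ Icc 0 L, ∀ Y, 0 ≤ Y → |partialD a b F x Y| * weight κ l Y ≤ C

/-- `sideTrace u F x₀ V j Y` is the value of `∂_x^{2j} v(x₀, Y)` which is forced by
`v(x₀, ·) = V` and the equation `-u Δv + u'' v = F`: differentiating
`∂_x^2 v = -∂_Y^2 v + (u''/u) v - F/u` in `x` gives the recursion, as `u` depends on `Y` only. -/
def sideTrace (u : ℝ → ℝ) (F : ℝ → ℝ → ℝ) (x₀ : ℝ) (V : ℝ → ℝ) : ℕ → ℝ → ℝ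
  | 0 => V
  | j + 1 => fun Y =>
      -iteratedDeriv 2 (sideTrace u F x₀ V j) Y
        + iteratedDeriv 2 u Y / u Y * sideTrace u F x₀ V j Y
        - partialD (2 * j) 0 F x₀ Y / u Y

/-- The boundary data `v(x₀, ·) = V` and `v(·, 0) = g` are well-prepared to order `2n` at the
corner `(x₀, 0)`: for every `j ≤ n`, the two values of the `2j`-th derivative of a solution at the
corner, computed from the data on one side and from the data on the other side by means of the
equation, coincide. We compare the values of `∂_x^{2j} v`; as the equation trades `∂_x^2` for
`-∂_Y^2` up to terms of lower order, comparing `∂_Y^{2j} v` for all `j ≤ n` is the same. For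
`j = 1` the condition reads `V''(0) = -g''(x₀) + (u''(0) g(x₀) - F(x₀, 0)) / u(0)`. -/
def WellPreparedAt (u : ℝ → ℝ) (F : ℝ → ℝ → ℝ) (x₀ : ℝ) (V g : ℝ → ℝ) (n : ℕ) : Prop :=
  ∀ j ≤ n, sideTrace u F x₀ V j 0 = iteratedDeriv (2 * j) g x₀

/-- `v` is a (classical) solution of the Euler corrector problem
`-u Δv + u'' v = F` in `Ω`, `v = V₀` at `x = 0`, `v = V_L` at `x = L`, `v = -v_p` at `Y = 0`.
The last condition excludes solutions that grow as `Y → ∞`; it holds for solutions in `L^2(Ω)`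
(in particular in `H^1(Ω)`), for bounded solutions and for solutions that tend to zero. -/
structure IsSolution (L : ℝ) (u : ℝ → ℝ) (F : ℝ → ℝ → ℝ) (V₀ VL vp : ℝ → ℝ)
    (v : ℝ → ℝ → ℝ) : Prop where
  continuousOn : ContinuousOn (Function.uncurry v) (closedStrip L)
  contDiffOn : ContDiffOn ℝ 2 (Function.uncurry v) (strip L)
  equation : ∀ x ∈ Ioo 0 L, ∀ Y, 0 < Y → -u Y * lap v x Y + iteratedDeriv 2 u Y * v x Y = F x Y
  bottom : ∀ x ∈ Icc 0 L, v x 0 = -vp x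
  left : ∀ Y, 0 ≤ Y → v 0 Y = V₀ Y
  right : ∀ Y, 0 ≤ Y → v L Y = VL Y
  growth : MemLp (fun p : ℝ × ℝ => v p.1 p.2 / (1 + p.2)) 2 (volume.restrict (strip L))

end EulerLayer

end

/-! ### Families of functions with weighted bounds on all iterated partial derivatives. -/

namespace EulerLayer

/-! Expand a solution in the Dirichlet sines of `(0, L)`. By `IsSolution.sineCoeff_ode` its
coefficients satisfy `c'' = (freq² + u''/u) c - F_n/u - freq (V₀ - (-1)^(n+1) V_L)`, where `F_n` is
the sine coefficient of `F`. Smoothness up to the edges with weighted bounds would follow from rapid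
decay of `c` in `n`, uniformly against the weight in `Y`. The side values spoil this decay, so a
truncated expansion in powers of `1/freq` is removed first: `coeffLift`, built from the side traces
`h_j`.

The recursion for `h_j` makes the first `N` orders of the forcing telescope
(`IsSolution.remainder_ode`), and the corner conditions do the same for the value at `Y = 0`
(`IsSolution.remainder_zero`). The remainder `r` thus solves `r'' = (freq² + u''/u) r - R` with `R`
and `r(0)` of high negative order in the frequency.

Its size follows from a comparison principle (`le_of_barrier`). The potential `u''/u` has no sign,
but `u` itself solves `y'' = (u''/u) y`, and dividing by `u` gives an operator in divergence form
with the good sign. A positive excess over a barrier would grow linearly, which the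
square-integrability condition forbids (`IsSolution.sublinear_sineCoeff`). A constant barrier gives
boundedness, and the reciprocal weight, a supersolution far out, gives decay
(`exists_decay_estimate`). In the exponential case this needs the rate to lie below the lowest
frequency `π/L`. The equation then converts bounds for `r` into bounds for its derivatives at the
cost of powers of the frequency (`reg_of_ode`).

Finally `freq^(-(2j+1))`, up to signs, are the sine coefficients of explicit smooth functions of `x`
(`exists_lift_left`, `exists_lift_right`). Hence the solution is a finite sum of smooth products
plus a rapidly convergent sine series; completeness of the sines identifies the two sides
(`reg_solution`). Every estimate is stated for the family of all solutions and all modes at once, so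
that the constants depend on the data only. -/

/-- The family `f` has `K` orders of iterated partial derivatives in the open strip, and all of
them are bounded by constant multiples of the weights `W i Y`, uniformly in the index. -/
def Reg {ι : Type*} (L : ℝ) (W : ι → ℝ → ℝ) : ℕ → (ι → ℝ → ℝ → ℝ) → Prop
  | 0, f => ∃ C, ∀ i, ∀ x ∈ Ioo 0 L, ∀ Y, 0 < Y → |f i x Y| ≤ C * W i Y
  | K + 1, f => (∃ C, ∀ i, ∀ x ∈ Ioo 0 L, ∀ Y, 0 < Y → |f i x Y| ≤ C * W i Y) ∧
      (∀ i, ∀ x ∈ Ioo 0 L, ∀ Y, 0 < Y →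
        DifferentiableAt ℝ (fun s => f i s Y) x ∧ DifferentiableAt ℝ (fun t => f i x t) Y) ∧
      Reg L W K (fun i => dX (f i)) ∧ Reg L W K (fun i => dY (f i))

theorem dX_eqOn {L : ℝ} {f g : ℝ → ℝ → ℝ}
    (h : ∀ x ∈ Ioo 0 L, ∀ Y, 0 < Y → f x Y = g x Y) :
    ∀ x ∈ Ioo 0 L, ∀ Y, 0 < Y → dX f x Y = dX g x Y := by
  intro x hx Y hY
  refine Filter.EventuallyEq.deriv_eq ?_
  filter_upwards [Ioo_mem_nhds hx.1 hx.2] with s hs using h s hs Y hY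

theorem dY_eqOn {L : ℝ} {f g : ℝ → ℝ → ℝ}
    (h : ∀ x ∈ Ioo 0 L, ∀ Y, 0 < Y → f x Y = g x Y) :
    ∀ x ∈ Ioo 0 L, ∀ Y, 0 < Y → dY f x Y = dY g x Y := by
  intro x hx Y hY
  refine Filter.EventuallyEq.deriv_eq ?_
  filter_upwards [Ioi_mem_nhds hY] with t ht using h x hx t ht

namespace Reg

variable {ι κ : Type*} {L : ℝ} {W W' : ι → ℝ → ℝ} {K : ℕ} {f g : ι → ℝ → ℝ → ℝ}

theorem bound (h : Reg L W K f) :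
    ∃ C, ∀ i, ∀ x ∈ Ioo 0 L, ∀ Y, 0 < Y → |f i x Y| ≤ C * W i Y := by
  cases K with
  | zero => exact h
  | succ K => exact h.1

theorem of_succ (h : Reg L W (K + 1) f) : Reg L W K f := by
  induction K generalizing f with
  | zero => exact h.1
  | succ K ih => exact ⟨h.1, h.2.1, ih h.2.2.1, ih h.2.2.2⟩

theorem congr (h : Reg L W K f)
    (hfg : ∀ i, ∀ x ∈ Ioo 0 L, ∀ Y, 0 < Y → f i x Y = g i x Y) : Reg L W K g := by
  induction K generalizing f g with
  | zero =>
    obtain ⟨C, hC⟩ := h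
    exact ⟨C, fun i x hx Y hY => hfg i x hx Y hY ▸ hC i x hx Y hY⟩
  | succ K ih =>
    obtain ⟨⟨C, hC⟩, hd, hx, hy⟩ := h
    refine ⟨⟨C, fun i x hx Y hY => hfg i x hx Y hY ▸ hC i x hx Y hY⟩, ?_,
      ih hx fun i => dX_eqOn (hfg i), ih hy fun i => dY_eqOn (hfg i)⟩
    intro i x hx Y hY
    refine ⟨(hd i x hx Y hY).1.congr_of_eventuallyEq ?_,
      (hd i x hx Y hY).2.congr_of_eventuallyEq ?_⟩
    · filter_upwards [Ioo_mem_nhds hx.1 hx.2] with s hs using (hfg i s hs Y hY).symm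
    · filter_upwards [Ioi_mem_nhds hY] with t ht using (hfg i x hx t ht).symm

/-- The derivatives may be supplied in any convenient form; `congr` replaces them by `dX` and `dY`.
-/
theorem mk_succ {fx fy : ι → ℝ → ℝ → ℝ}
    (hb : ∃ C, ∀ i, ∀ x ∈ Ioo 0 L, ∀ Y, 0 < Y → |f i x Y| ≤ C * W i Y)
    (hdx : ∀ i, ∀ x ∈ Ioo 0 L, ∀ Y, 0 < Y → HasDerivAt (fun s => f i s Y) (fx i x Y) x)
    (hdy : ∀ i, ∀ x ∈ Ioo 0 L, ∀ Y, 0 < Y → HasDerivAt (fun t => f i x t) (fy i x Y) Y)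
    (hx : Reg L W K fx) (hy : Reg L W K fy) : Reg L W (K + 1) f :=
  ⟨hb, fun i x hx Y hY =>
      ⟨(hdx i x hx Y hY).differentiableAt, (hdy i x hx Y hY).differentiableAt⟩,
    hx.congr fun i x hx Y hY => (hdx i x hx Y hY).deriv.symm,
    hy.congr fun i x hx Y hY => (hdy i x hx Y hY).deriv.symm⟩

theorem hasDerivAt_x (h : Reg L W (K + 1) f) {i : ι} {x Y : ℝ} (hx : x ∈ Ioo 0 L) (hY : 0 < Y) :
    HasDerivAt (fun s => f i s Y) (dX (f i) x Y) x := (h.2.1 i x hx Y hY).1.hasDerivAt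

theorem hasDerivAt_y (h : Reg L W (K + 1) f) {i : ι} {x Y : ℝ} (hx : x ∈ Ioo 0 L) (hY : 0 < Y) :
    HasDerivAt (fun t => f i x t) (dY (f i) x Y) Y := (h.2.1 i x hx Y hY).2.hasDerivAt

theorem comap (h : Reg L W K f) (φ : κ → ι) :
    Reg L (fun i => W (φ i)) K (fun i => f (φ i)) := by
  induction K generalizing f with
  | zero =>
    obtain ⟨C, hC⟩ := h
    exact ⟨C, fun i => hC (φ i)⟩
  | succ K ih =>
    obtain ⟨⟨C, hC⟩, hd, hx, hy⟩ := h
    exact ⟨⟨C, fun i => hC (φ i)⟩, fun i => hd (φ i), ih hx, ih hy⟩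

theorem mono (h : Reg L W K f) (hW : ∀ i Y, 0 < Y → 0 ≤ W i Y)
    (hWW' : ∃ D, ∀ i Y, 0 < Y → W i Y ≤ D * W' i Y) : Reg L W' K f := by
  have key : ∀ f : ι → ℝ → ℝ → ℝ,
      (∃ C, ∀ i, ∀ x ∈ Ioo 0 L, ∀ Y, 0 < Y → |f i x Y| ≤ C * W i Y) →
      ∃ C, ∀ i, ∀ x ∈ Ioo 0 L, ∀ Y, 0 < Y → |f i x Y| ≤ C * W' i Y := by
    rintro f ⟨C, hC⟩
    obtain ⟨D, hD⟩ := hWW'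
    -- The constants in `Reg` carry no sign, hence the absolute value before the weights are
    -- compared.
    refine ⟨|C| * D, fun i x hx Y hY => (hC i x hx Y hY).trans ?_⟩
    calc C * W i Y ≤ |C| * W i Y := mul_le_mul_of_nonneg_right (le_abs_self C) (hW i Y hY)
      _ ≤ |C| * (D * W' i Y) := mul_le_mul_of_nonneg_left (hD i Y hY) (abs_nonneg C)
      _ = _ := by ring
  induction K generalizing f with
  | zero => exact key f h
  | succ K ih => exact ⟨key f h.1, h.2.1, ih h.2.2.1, ih h.2.2.2⟩

theorem add (hf : Reg L W K f) (hg : Reg L W K g) :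
    Reg L W K (fun i x Y => f i x Y + g i x Y) := by
  have key : ∀ {K : ℕ} {f g : ι → ℝ → ℝ → ℝ}, Reg L W K f → Reg L W K g →
      ∃ C, ∀ i, ∀ x ∈ Ioo 0 L, ∀ Y, 0 < Y → |f i x Y + g i x Y| ≤ C * W i Y := by
    intro K f g hf hg
    obtain ⟨C, hC⟩ := hf.bound
    obtain ⟨D, hD⟩ := hg.bound
    refine ⟨C + D, fun i x hx Y hY => (abs_add_le _ _).trans ?_⟩
    linarith [hC i x hx Y hY, hD i x hx Y hY]
  induction K generalizing f g with
  | zero => exact key hf hg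
  | succ K ih =>
    exact mk_succ (key hf hg)
      (fun i x hx Y hY => (hf.hasDerivAt_x hx hY).add (hg.hasDerivAt_x hx hY))
      (fun i x hx Y hY => (hf.hasDerivAt_y hx hY).add (hg.hasDerivAt_y hx hY))
      (ih hf.2.2.1 hg.2.2.1) (ih hf.2.2.2 hg.2.2.2)

theorem mul (hf : Reg L W K f) (hg : Reg L W' K g) :
    Reg L (fun i Y => W i Y * W' i Y) K (fun i x Y => f i x Y * g i x Y) := by
  have key : ∀ {K : ℕ} {f g : ι → ℝ → ℝ → ℝ}, Reg L W K f → Reg L W' K g →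
      ∃ C, ∀ i, ∀ x ∈ Ioo 0 L, ∀ Y, 0 < Y → |f i x Y * g i x Y| ≤ C * (W i Y * W' i Y) := by
    intro K f g hf hg
    obtain ⟨C, hC⟩ := hf.bound
    obtain ⟨D, hD⟩ := hg.bound
    refine ⟨C * D, fun i x hx Y hY => ?_⟩
    rw [abs_mul]
    calc |f i x Y| * |g i x Y| ≤ (C * W i Y) * (D * W' i Y) :=
          mul_le_mul (hC i x hx Y hY) (hD i x hx Y hY) (abs_nonneg _)
            ((abs_nonneg _).trans (hC i x hx Y hY))
      _ = _ := by ring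
  induction K generalizing f g with
  | zero => exact key hf hg
  | succ K ih =>
    exact mk_succ (key hf hg)
      (fun i x hx Y hY => (hf.hasDerivAt_x hx hY).mul (hg.hasDerivAt_x hx hY))
      (fun i x hx Y hY => (hf.hasDerivAt_y hx hY).mul (hg.hasDerivAt_y hx hY))
      ((ih hf.2.2.1 hg.of_succ).add (ih hf.of_succ hg.2.2.1))
      ((ih hf.2.2.2 hg.of_succ).add (ih hf.of_succ hg.2.2.2))

/-- No sign is required of `a`: the derivatives vanish, and zero is bounded with `D = 0`. The case
`c = 0` supplies the missing derivative of functions of one variable. -/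
theorem index {c : ι → ℝ} {a : ι → ℝ → ℝ}
    (hc : ∃ D, ∀ i Y, 0 < Y → |c i| ≤ D * a i Y) : Reg L a K (fun i _ _ => c i) := by
  induction K generalizing c with
  | zero =>
    obtain ⟨D, hD⟩ := hc
    exact ⟨D, fun i x _ Y hY => hD i Y hY⟩
  | succ K ih =>
    obtain ⟨D, hD⟩ := hc
    refine mk_succ (fx := fun _ _ _ => 0) (fy := fun _ _ _ => 0)
      ⟨D, fun i x _ Y hY => hD i Y hY⟩ (fun i x _ Y _ => hasDerivAt_const _ _)
      (fun i x _ Y _ => hasDerivAt_const _ _) ?_ ?_ <;>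
    exact ih (c := fun _ => 0) ⟨0, fun i Y _ => by simp⟩

theorem const_mul (hf : Reg L W K f) (c : ℝ) : Reg L W K (fun i x Y => c * f i x Y) := by
  have h := (index (L := L) (K := K) (c := fun _ : ι => c) (a := fun _ _ => 1)
    ⟨|c|, fun _ _ _ => by simp⟩).mul hf
  simpa using h

theorem neg (hf : Reg L W K f) : Reg L W K (fun i x Y => -f i x Y) := by
  simpa using hf.const_mul (-1)

theorem sub (hf : Reg L W K f) (hg : Reg L W K g) :
    Reg L W K (fun i x Y => f i x Y - g i x Y) := by
  simpa [sub_eq_add_neg] using hf.add hg.neg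

theorem sum {α : Type*} (s : Finset α) {F : α → ι → ℝ → ℝ → ℝ}
    (hF : ∀ a ∈ s, Reg L W K (F a)) : Reg L W K (fun i x Y => ∑ a ∈ s, F a i x Y) := by
  classical
  induction s using Finset.induction_on with
  | empty => simpa using index (c := fun _ => 0) ⟨0, fun i Y _ => by simp⟩
  | insert a s ha ih =>
    simp only [Finset.sum_insert ha]
    exact (hF a (Finset.mem_insert_self _ _)).add
      (ih fun b hb => hF b (Finset.mem_insert_of_mem hb))

theorem partialD_bound (h : Reg L W K f) {a b : ℕ} (hab : a + b ≤ K) :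
    ∃ C, ∀ i, ∀ x ∈ Ioo 0 L, ∀ Y, 0 < Y → |partialD a b (f i) x Y| ≤ C * W i Y := by
  induction b generalizing K f with
  | zero =>
    induction a generalizing K f with
    | zero => exact h.bound
    | succ a ih =>
      obtain ⟨K, rfl⟩ : ∃ J, K = J + 1 := ⟨K - 1, by omega⟩
      exact ih h.2.2.1 (by omega)
  | succ b ih =>
    obtain ⟨K, rfl⟩ : ∃ J, K = J + 1 := ⟨K - 1, by omega⟩
    exact ih h.2.2.2 (by omega)

/-- A function of `Y` alone, regular to every order. -/
theorem of_iterate {h : ι → ℕ → ℝ → ℝ}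
    (hd : ∀ i j Y, 0 < Y → HasDerivAt (h i j) (h i (j + 1) Y) Y)
    (hb : ∀ j, ∃ C, ∀ i Y, 0 < Y → |h i j Y| ≤ C * W i Y) (j : ℕ) : Reg L W K (fun i _ Y => h i j Y) := by
  induction K generalizing j with
  | zero =>
    obtain ⟨C, hC⟩ := hb j
    exact ⟨C, fun i x _ Y hY => hC i Y hY⟩
  | succ K ih =>
    obtain ⟨C, hC⟩ := hb j
    exact mk_succ (fx := fun _ _ _ => 0) ⟨C, fun i x _ Y hY => hC i Y hY⟩
      (fun i x _ Y _ => hasDerivAt_const _ _) (fun i x _ Y hY => hd i j Y hY)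
      (index (c := fun _ => 0) ⟨0, fun i Y _ => by simp⟩) (ih (j + 1))

/-- The reciprocal of a function of `Y` alone. -/
theorem inv {h : ι → ℝ → ℝ} {c : ℝ} (hc : 0 < c) (hh : ∀ i Y, 0 < Y → c ≤ h i Y)
    (hreg : Reg L (fun _ _ => 1) K (fun i _ Y => h i Y)) :
    Reg L (fun _ _ => 1) K (fun i _ Y => (h i Y)⁻¹) := by
  have hb : ∃ C, ∀ i, ∀ x ∈ Ioo 0 L, ∀ Y, 0 < Y → |(h i Y)⁻¹| ≤ C * 1 := by
    refine ⟨c⁻¹, fun i x _ Y hY => ?_⟩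
    rw [mul_one, abs_inv, abs_of_pos (hc.trans_le (hh i Y hY))]
    exact inv_anti₀ hc (hh i Y hY)
  induction K with
  | zero => exact hb
  | succ K ih =>
    have h1 := ih hreg.of_succ
    have h2 : Reg L (fun _ _ => 1) K
        (fun i x Y => -dY (fun _ Y => h i Y) x Y * ((h i Y)⁻¹ * (h i Y)⁻¹)) := by
      simpa using hreg.2.2.2.neg.mul (h1.mul h1)
    refine mk_succ (fx := fun _ _ _ => 0) hb (fun i x _ Y _ => hasDerivAt_const _ _)
      (fun i x hx Y hY => ?_)
      (index (c := fun _ => 0) ⟨0, fun i Y _ => by simp⟩) h2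
    have h0 : h i Y ≠ 0 := (hc.trans_le (hh i Y hY)).ne'
    exact ((hreg.hasDerivAt_y (i := i) hx hY).inv h0).congr_deriv
      (by rw [div_eq_mul_inv, sq, mul_inv])

end Reg

end EulerLayer

/-! ### Joint smoothness versus iterated partial derivatives. -/

namespace EulerLayer

theorem isOpen_strip (L : ℝ) : IsOpen (strip L) := isOpen_Ioo.prod isOpen_Ioi

section Smooth

variable {f : ℝ → ℝ → ℝ} {U : Set (ℝ × ℝ)} {n m : ℕ∞ω}

theorem hasDerivAt_fst_of_differentiableAt {x Y : ℝ}
    (h : DifferentiableAt ℝ (Function.uncurry f) (x, Y)) :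
    HasDerivAt (fun s => f s Y) (fderiv ℝ (Function.uncurry f) (x, Y) (1, 0)) x := by
  have h1 : HasDerivAt (fun s : ℝ => (s, Y)) ((1 : ℝ), (0 : ℝ)) x :=
    (hasDerivAt_id' x).prodMk (hasDerivAt_const x Y)
  exact HasFDerivAt.comp_hasDerivAt (f := fun s : ℝ => (s, Y)) x h.hasFDerivAt h1

theorem hasDerivAt_snd_of_differentiableAt {x Y : ℝ}
    (h : DifferentiableAt ℝ (Function.uncurry f) (x, Y)) :
    HasDerivAt (fun t => f x t) (fderiv ℝ (Function.uncurry f) (x, Y) (0, 1)) Y :=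
  h.hasFDerivAt.comp_hasDerivAt Y ((hasDerivAt_const Y x).prodMk (hasDerivAt_id' Y))

theorem contDiffOn_dX (hU : IsOpen U) (h : ContDiffOn ℝ n (Function.uncurry f) U)
    (hmn : m + 1 ≤ n) : ContDiffOn ℝ m (Function.uncurry (dX f)) U := by
  have h1 := (h.fderiv_of_isOpen hU hmn).clm_apply (contDiffOn_const (c := ((1 : ℝ), (0 : ℝ))))
  refine h1.congr fun p hp => ?_
  have hd : DifferentiableAt ℝ (Function.uncurry f) p :=
    (h.differentiableOn (by rintro rfl; simp at hmn)).differentiableAt (hU.mem_nhds hp)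
  exact (hasDerivAt_fst_of_differentiableAt (x := p.1) (Y := p.2) hd).deriv

theorem contDiffOn_dY (hU : IsOpen U) (h : ContDiffOn ℝ n (Function.uncurry f) U)
    (hmn : m + 1 ≤ n) : ContDiffOn ℝ m (Function.uncurry (dY f)) U := by
  have h1 := (h.fderiv_of_isOpen hU hmn).clm_apply (contDiffOn_const (c := ((0 : ℝ), (1 : ℝ))))
  refine h1.congr fun p hp => ?_
  have hd : DifferentiableAt ℝ (Function.uncurry f) p :=
    (h.differentiableOn (by rintro rfl; simp at hmn)).differentiableAt (hU.mem_nhds hp)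
  exact (hasDerivAt_snd_of_differentiableAt (x := p.1) (Y := p.2) hd).deriv

theorem hasDerivAt_dX (hU : IsOpen U) (h : ContDiffOn ℝ n (Function.uncurry f) U)
    (hn : n ≠ 0) {x Y : ℝ} (hp : (x, Y) ∈ U) : HasDerivAt (fun s => f s Y) (dX f x Y) x :=
  (hasDerivAt_fst_of_differentiableAt
    ((h.differentiableOn hn).differentiableAt (hU.mem_nhds hp))).differentiableAt.hasDerivAt

theorem hasDerivAt_dY (hU : IsOpen U) (h : ContDiffOn ℝ n (Function.uncurry f) U)
    (hn : n ≠ 0) {x Y : ℝ} (hp : (x, Y) ∈ U) : HasDerivAt (fun t => f x t) (dY f x Y) Y :=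
  (hasDerivAt_snd_of_differentiableAt
    ((h.differentiableOn hn).differentiableAt (hU.mem_nhds hp))).differentiableAt.hasDerivAt

theorem contDiff_dX (h : ContDiff ℝ ∞ (Function.uncurry f)) :
    ContDiff ℝ ∞ (Function.uncurry (dX f)) :=
  contDiffOn_univ.1 (contDiffOn_dX isOpen_univ h.contDiffOn (n := ∞) (by simp))

theorem contDiff_dY (h : ContDiff ℝ ∞ (Function.uncurry f)) :
    ContDiff ℝ ∞ (Function.uncurry (dY f)) :=
  contDiffOn_univ.1 (contDiffOn_dY isOpen_univ h.contDiffOn (n := ∞) (by simp))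

theorem dY_dX (h : ContDiff ℝ ∞ (Function.uncurry f)) : dY (dX f) = dX (dY f) := by
  have hd : Differentiable ℝ (Function.uncurry f) := h.differentiable (by simp)
  have hX : ∀ p : ℝ × ℝ, dX f p.1 p.2 = fderiv ℝ (Function.uncurry f) p (1, 0) := fun p =>
    (hasDerivAt_fst_of_differentiableAt (x := p.1) (Y := p.2) (hd p)).deriv
  have hY : ∀ p : ℝ × ℝ, dY f p.1 p.2 = fderiv ℝ (Function.uncurry f) p (0, 1) := fun p =>
    (hasDerivAt_snd_of_differentiableAt (x := p.1) (Y := p.2) (hd p)).deriv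
  have h2 : Differentiable ℝ (fderiv ℝ (Function.uncurry f)) :=
    (h.fderiv_right (m := ∞) (by simp)).differentiable (by simp)
  funext x Y
  have e1 : dY (dX f) x Y = fderiv ℝ (fderiv ℝ (Function.uncurry f)) (x, Y) (0, 1) (1, 0) := by
    have := (hasDerivAt_snd_of_differentiableAt (f := dX f) (x := x) (Y := Y)
      ((contDiff_dX h).differentiable (by simp) _)).deriv
    refine this.trans ?_
    rw [show Function.uncurry (dX f) = fun p => fderiv ℝ (Function.uncurry f) p (1, 0) from
      funext hX, fderiv_clm_apply (h2 _) (differentiableAt_const _)]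
    simp
  have e2 : dX (dY f) x Y = fderiv ℝ (fderiv ℝ (Function.uncurry f)) (x, Y) (1, 0) (0, 1) := by
    have := (hasDerivAt_fst_of_differentiableAt (f := dY f) (x := x) (Y := Y)
      ((contDiff_dY h).differentiable (by simp) _)).deriv
    refine this.trans ?_
    rw [show Function.uncurry (dY f) = fun p => fderiv ℝ (Function.uncurry f) p (0, 1) from
      funext hY, fderiv_clm_apply (h2 _) (differentiableAt_const _)]
    simp
  rw [e1, e2]
  exact (h.contDiffAt.isSymmSndFDerivAt
    (by rw [minSmoothness_of_isRCLikeNormedField]; exact WithTop.coe_le_coe.2 le_top)) _ _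

theorem contDiff_partialD (h : ContDiff ℝ ∞ (Function.uncurry f)) (a b : ℕ) :
    ContDiff ℝ ∞ (Function.uncurry (partialD a b f)) := by
  induction a with
  | zero =>
    induction b with
    | zero => exact h
    | succ b ih =>
      simp only [partialD, Function.iterate_succ_apply', Function.iterate_zero, id_eq] at ih ⊢
      exact contDiff_dY ih
  | succ a ih =>
    simp only [partialD, Function.iterate_succ_apply'] at ih ⊢
    exact contDiff_dX ih

theorem dX_partialD (f : ℝ → ℝ → ℝ) (a b : ℕ) :
    dX (partialD a b f) = partialD (a + 1) b f := by
  simp only [partialD, Function.iterate_succ_apply']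

theorem dY_partialD (h : ContDiff ℝ ∞ (Function.uncurry f)) (a b : ℕ) :
    dY (partialD a b f) = partialD a (b + 1) f := by
  induction a with
  | zero => simp only [partialD, Function.iterate_succ_apply', Function.iterate_zero, id_eq]
  | succ a ih => rw [← dX_partialD, dY_dX (contDiff_partialD h a b), ih, dX_partialD]

theorem hasDerivAt_partialD_x (h : ContDiff ℝ ∞ (Function.uncurry f)) (a b : ℕ) (x Y : ℝ) :
    HasDerivAt (fun s => partialD a b f s Y) (partialD (a + 1) b f x Y) x := by
  rw [← dX_partialD]
  exact hasDerivAt_dX isOpen_univ (contDiff_partialD h a b).contDiffOn (by simp) (mem_univ _)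

theorem hasDerivAt_partialD_y (h : ContDiff ℝ ∞ (Function.uncurry f)) (a b : ℕ) (x Y : ℝ) :
    HasDerivAt (fun t => partialD a b f x t) (partialD a (b + 1) f x Y) Y := by
  rw [← dY_partialD h]
  exact hasDerivAt_dY isOpen_univ (contDiff_partialD h a b).contDiffOn (by simp) (mem_univ _)

end Smooth

namespace Reg

variable {ι : Type*} {L : ℝ} {K : ℕ} {f : ι → ℝ → ℝ → ℝ}

/-- Bounded partial derivatives give a Lipschitz bound: a product of intervals lets one move first
in `x`, then in `Y`, without leaving the strip. -/
theorem continuousOn (h : Reg L (fun _ _ => 1) 1 f) (i : ι) :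
    ContinuousOn (Function.uncurry (f i)) (strip L) := by
  obtain ⟨C, hC⟩ := h.2.2.1
  obtain ⟨D, hD⟩ := h.2.2.2
  rintro ⟨x, Y⟩ ⟨hx, hY⟩
  have hb : ∀ p ∈ strip L, ‖Function.uncurry (f i) p - Function.uncurry (f i) (x, Y)‖ ≤
      C * ‖p.1 - x‖ + D * ‖p.2 - Y‖ := by
    rintro ⟨s, t⟩ ⟨hs, ht⟩
    have h1 : ‖f i s t - f i x t‖ ≤ C * ‖s - x‖ :=
      (convex_Ioo 0 L).norm_image_sub_le_of_norm_hasDerivWithin_le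
        (f := fun s => f i s t) (f' := fun s => dX (f i) s t)
        (fun z hz => (h.hasDerivAt_x hz ht).hasDerivWithinAt)
        (fun z hz => by simpa using hC i z hz t ht) hx hs
    have h2 : ‖f i x t - f i x Y‖ ≤ D * ‖t - Y‖ :=
      (convex_Ioi 0).norm_image_sub_le_of_norm_hasDerivWithin_le
        (f := fun t => f i x t) (f' := fun t => dY (f i) x t)
        (fun z hz => (h.hasDerivAt_y hx hz).hasDerivWithinAt)
        (fun z hz => by simpa using hD i x hx z hz) hY ht
    calc ‖f i s t - f i x Y‖ = ‖(f i s t - f i x t) + (f i x t - f i x Y)‖ := by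
          congr 1; ring
      _ ≤ _ := (norm_add_le _ _).trans (add_le_add h1 h2)
  refine (tendsto_iff_norm_sub_tendsto_zero.2 ?_ :
    ContinuousWithinAt (Function.uncurry (f i)) (strip L) (x, Y))
  refine squeeze_zero' (Filter.Eventually.of_forall fun _ => norm_nonneg _)
    (Filter.eventually_of_mem self_mem_nhdsWithin hb) ?_
  have hc : Continuous fun p : ℝ × ℝ => C * ‖p.1 - x‖ + D * ‖p.2 - Y‖ := by fun_prop
  simpa using (hc.tendsto (x, Y)).mono_left nhdsWithin_le_nhds

/-- Continuous partial derivatives produce a Fréchet derivative. One order is lost because the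
partial derivatives of top order are only bounded. -/
theorem contDiffOn (h : Reg L (fun _ _ => 1) (K + 1) f) (i : ι) :
    ContDiffOn ℝ K (Function.uncurry (f i)) (strip L) := by
  induction K generalizing f with
  | zero => simpa using h.continuousOn i
  | succ K ih =>
    have hX := ih h.2.2.1
    have hY := ih h.2.2.2
    have key : ∀ p ∈ strip L, HasFDerivAt (Function.uncurry (f i))
        ((ContinuousLinearMap.toSpanSingleton ℝ (dX (f i) p.1 p.2)).coprod
          (ContinuousLinearMap.toSpanSingleton ℝ (dY (f i) p.1 p.2))) p := by
      intro p hp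
      have hn := (isOpen_strip L).mem_nhds hp
      refine (hasStrictFDerivAt_uncurry_coprod (f := f i)
        (f₁ := fun x Y => ContinuousLinearMap.toSpanSingleton ℝ (dX (f i) x Y))
        (f₂ := fun x Y => ContinuousLinearMap.toSpanSingleton ℝ (dY (f i) x Y))
        ?_ ?_ ?_ ?_).hasFDerivAt
      · filter_upwards [hn] with q hq using (h.hasDerivAt_x hq.1 hq.2).hasFDerivAt
      · filter_upwards [hn] with q hq using (h.hasDerivAt_y hq.1 hq.2).hasFDerivAt
      · exact (ContinuousLinearMap.toSpanSingletonCLE (𝕜 := ℝ) (E := ℝ)).continuous.continuousAt.comp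
          (hX.continuousOn.continuousAt hn)
      · exact (ContinuousLinearMap.toSpanSingletonCLE (𝕜 := ℝ) (E := ℝ)).continuous.continuousAt.comp
          (hY.continuousOn.continuousAt hn)
    push_cast
    rw [contDiffOn_succ_iff_fderiv_of_isOpen (isOpen_strip L)]
    refine ⟨fun p hp => (key p hp).differentiableAt.differentiableWithinAt, by simp, ?_⟩
    refine ContDiffOn.congr ?_ fun p hp => (key p hp).fderiv
    have e : ∀ p : ℝ × ℝ, (ContinuousLinearMap.toSpanSingleton ℝ (dX (f i) p.1 p.2)).coprod
          (ContinuousLinearMap.toSpanSingleton ℝ (dY (f i) p.1 p.2)) =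
        dX (f i) p.1 p.2 • ContinuousLinearMap.fst ℝ ℝ ℝ +
          dY (f i) p.1 p.2 • ContinuousLinearMap.snd ℝ ℝ ℝ := by
      intro p; ext <;> simp
    simp only [e]
    exact (hX.smul contDiffOn_const).add (hY.smul contDiffOn_const)

end Reg

end EulerLayer

/-! ### Sine coefficients: integration by parts, lifts of boundary values, completeness. -/

noncomputable section

namespace EulerLayer

/-- The frequencies `(n + 1) π / L` of the Dirichlet sine basis of `(0, L)`. -/
def freq (L : ℝ) (n : ℕ) : ℝ := (n + 1) * Real.pi / L

/-- The sine coefficient `∫_0^L f(x) sin((n + 1) π x / L) dx`. -/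
def sineCoeff (L : ℝ) (n : ℕ) (f : ℝ → ℝ) : ℝ := ∫ x in (0 : ℝ)..L, f x * Real.sin (freq L n * x)

section Freq

variable {L : ℝ} (n : ℕ)

theorem freq_pos (hL : 0 < L) : 0 < freq L n := by unfold freq; positivity

theorem freq_mul_length (hL : 0 < L) : freq L n * L = ((n + 1 : ℕ) : ℝ) * Real.pi := by
  unfold freq; push_cast; field_simp

theorem sin_freq_mul_length (hL : 0 < L) : Real.sin (freq L n * L) = 0 := by
  rw [freq_mul_length n hL]; exact Real.sin_nat_mul_pi _

theorem cos_freq_mul_length (hL : 0 < L) : Real.cos (freq L n * L) = (-1) ^ (n + 1) := by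
  rw [freq_mul_length n hL]; exact Real.cos_nat_mul_pi _

/-- In two integrations by parts the boundary terms with `f'` drop out, as the sine vanishes at both
ends; those with `f` carry the cosine, equal to `1` and `(-1)^(n+1)` there. -/
theorem sineCoeff_deriv_two (hL : 0 < L) {f f' f'' : ℝ → ℝ}
    (h : ∀ x ∈ Icc 0 L, HasDerivAt f (f' x) x) (h' : ∀ x ∈ Icc 0 L, HasDerivAt f' (f'' x) x)
    (hc : ContinuousOn f'' (Icc 0 L)) :
    sineCoeff L n f'' = freq L n * (f 0 - (-1) ^ (n + 1) * f L) -
      freq L n ^ 2 * sineCoeff L n f := by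
  have hu : uIcc 0 L = Icc 0 L := uIcc_of_le hL.le
  set a := freq L n with ha
  have hs : ∀ x ∈ uIcc 0 L, HasDerivAt (fun x => Real.sin (a * x)) (a * Real.cos (a * x)) x := by
    intro x _
    simpa [mul_comm] using ((hasDerivAt_id x).const_mul a).sin
  have hk : ∀ x ∈ uIcc 0 L,
      HasDerivAt (fun x => a * Real.cos (a * x)) (-a ^ 2 * Real.sin (a * x)) x := by
    intro x _
    exact ((((hasDerivAt_id x).const_mul a).cos).const_mul a).congr_deriv (by simp; ring)
  have hc' : ContinuousOn f' (Icc 0 L) := fun x hx => (h' x hx).continuousAt.continuousWithinAt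
  have e1 := intervalIntegral.integral_mul_deriv_eq_deriv_mul (a := 0) (b := L) (u := fun x =>
    Real.sin (a * x)) (v := f') (u' := fun x => a * Real.cos (a * x)) (v' := f'') hs
    (hu ▸ h') (by apply Continuous.intervalIntegrable; fun_prop)
    (ContinuousOn.intervalIntegrable (hu ▸ hc))
  have e2 := intervalIntegral.integral_mul_deriv_eq_deriv_mul (a := 0) (b := L) (u := fun x =>
    a * Real.cos (a * x)) (v := f) (u' := fun x => -a ^ 2 * Real.sin (a * x)) (v' := f') hk
    (hu ▸ h) (by apply Continuous.intervalIntegrable; fun_prop)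
    (ContinuousOn.intervalIntegrable (hu ▸ hc'))
  have e3 : ∫ x in (0 : ℝ)..L, -a ^ 2 * Real.sin (a * x) * f x = -a ^ 2 * sineCoeff L n f := by
    rw [sineCoeff, ← intervalIntegral.integral_const_mul]
    congr 1; ext x; rw [← ha]; ring
  have e4 : sineCoeff L n f'' = ∫ x in (0 : ℝ)..L, Real.sin (a * x) * f'' x := by
    rw [sineCoeff]; congr 1; ext x; rw [mul_comm]
  rw [e4, e1, e2, e3]
  simp only [ha, sin_freq_mul_length n hL, cos_freq_mul_length n hL, mul_zero, Real.sin_zero,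
    Real.cos_zero]
  ring

/-- Repeated integration by parts: the expansion of a sine coefficient in the even derivatives at
the end points. -/
theorem sineCoeff_expansion (hL : 0 < L) {g : ℕ → ℝ → ℝ}
    (hg : ∀ j x, HasDerivAt (g j) (g (j + 1) x) x) (N : ℕ) :
    sineCoeff L n (g 0) = (∑ j ∈ Finset.range N, (-1) ^ j * (freq L n ^ (2 * j + 1))⁻¹ *
        (g (2 * j) 0 - (-1) ^ (n + 1) * g (2 * j) L)) +
      (-1) ^ N * (freq L n ^ (2 * N))⁻¹ * sineCoeff L n (g (2 * N)) := by
  induction N with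
  | zero => simp
  | succ N ih =>
    have hc : Continuous (g (2 * N + 2)) :=
      continuous_iff_continuousAt.2 fun x => (hg _ x).continuousAt
    have h := sineCoeff_deriv_two n hL (fun x _ => hg (2 * N) x) (fun x _ => hg (2 * N + 1) x)
      hc.continuousOn
    have hf := (freq_pos n hL).ne'
    rw [ih, Finset.sum_range_succ, show 2 * (N + 1) = 2 * N + 2 by ring, h]
    field_simp
    ring

end Freq

section Lift

variable {L : ℝ}

theorem exists_smooth_primitive {p : ℝ → ℝ} (hp : ContDiff ℝ ∞ p) :
    ∃ P : ℝ → ℝ, ContDiff ℝ ∞ P ∧ ∀ x, HasDerivAt P (p x) x := by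
  have h : ∀ x, HasDerivAt (fun x => ∫ t in (0 : ℝ)..x, p t) (p x) x := fun x =>
    intervalIntegral.integral_hasDerivAt_right (hp.continuous.intervalIntegrable _ _)
      (hp.continuous.stronglyMeasurableAtFilter _ _) hp.continuous.continuousAt
  refine ⟨_, ?_, h⟩
  rw [contDiff_infty_iff_deriv]
  exact ⟨fun x => (h x).differentiableAt, by rwa [funext fun x => (h x).deriv]⟩

/-- Solves `P'' = p` with `P(0) = P(L) = 0`: a double primitive is corrected by an affine function.
No boundary terms remain, so inverting the second derivative divides the coefficients by `-freq²`.
-/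
theorem exists_smooth_dirichlet (hL : 0 < L) {p : ℝ → ℝ} (hp : ContDiff ℝ ∞ p) :
    ∃ P : ℝ → ℝ, ContDiff ℝ ∞ P ∧ ∀ n, sineCoeff L n P = -(freq L n ^ 2)⁻¹ * sineCoeff L n p := by
  obtain ⟨Q, hQ, hQ'⟩ := exists_smooth_primitive hp
  obtain ⟨R, hR, hR'⟩ := exists_smooth_primitive hQ
  set c := (R L - R 0) / L with hc
  refine ⟨fun x => R x - R 0 - c * x, (hR.sub contDiff_const).sub (contDiff_const.mul contDiff_id),
    fun n => ?_⟩
  have h1 : ∀ x, HasDerivAt (fun x => R x - R 0 - c * x) (Q x - c) x := fun x => by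
    simpa using ((hR' x).sub_const (R 0)).fun_sub ((hasDerivAt_id x).const_mul c)
  have h2 : ∀ x, HasDerivAt (fun x => Q x - c) (p x) x := fun x => (hQ' x).sub_const c
  have h := sineCoeff_deriv_two n hL (fun x _ => h1 x) (fun x _ => h2 x) hp.continuous.continuousOn
  have e : R L - R 0 - c * L = 0 := by rw [hc]; field_simp; ring
  have hf := (freq_pos n hL).ne'
  rw [h, e]
  field_simp
  ring

theorem exists_lift_iterate (hL : 0 < L) {p : ℝ → ℝ} (hp : ContDiff ℝ ∞ p) {a : ℕ → ℝ}
    (ha : ∀ n, sineCoeff L n p = (freq L n)⁻¹ * a n) (j : ℕ) :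
    ∃ P : ℝ → ℝ, ContDiff ℝ ∞ P ∧
      ∀ n, sineCoeff L n P = (-1) ^ j * (freq L n ^ (2 * j + 1))⁻¹ * a n := by
  induction j with
  | zero => exact ⟨p, hp, fun n => by simpa using ha n⟩
  | succ j ih =>
    obtain ⟨P, hP, hP'⟩ := ih
    obtain ⟨Q, hQ, hQ'⟩ := exists_smooth_dirichlet hL hP
    refine ⟨Q, hQ, fun n => ?_⟩
    have hf := (freq_pos n hL).ne'
    rw [hQ', hP', show 2 * (j + 1) + 1 = 2 * j + 1 + 2 by ring, pow_add _ (2 * j + 1) 2, mul_inv]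
    ring

/-- Smooth functions on `[0, L]` whose sine coefficients are those of a unit value of the `2j`-th
derivative at the left end point. -/
theorem exists_lift_left (hL : 0 < L) (j : ℕ) :
    ∃ P : ℝ → ℝ, ContDiff ℝ ∞ P ∧
      ∀ n, sineCoeff L n P = (-1) ^ j * (freq L n ^ (2 * j + 1))⁻¹ := by
  -- The affine function with end values `1` and `0` has zero second derivative, so
  -- `sineCoeff_deriv_two` leaves only its boundary term and the coefficient is `1/freq`.
  have hd : ∀ x : ℝ, HasDerivAt (fun x => 1 - x / L) (-(1 / L)) x := fun x => by
    simpa using ((hasDerivAt_id x).div_const L).const_sub 1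
  have hp : ContDiff ℝ ∞ (fun x : ℝ => 1 - x / L) := contDiff_const.sub (contDiff_id.div_const L)
  obtain ⟨P, hP, h⟩ := exists_lift_iterate hL hp (a := fun _ => 1) (fun n => by
    have h := sineCoeff_deriv_two n hL (fun x _ => hd x) (fun x _ => hasDerivAt_const x _)
      continuousOn_const
    have hf := (freq_pos n hL).ne'
    have h0 : sineCoeff L n (fun _ => 0) = 0 := by simp [sineCoeff]
    rw [h0, div_self hL.ne'] at h
    simp only [zero_div, sub_zero, sub_self, mul_zero, mul_one] at h
    refine mul_left_cancel₀ (pow_ne_zero 2 hf) ?_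
    rw [show freq L n ^ 2 * ((freq L n)⁻¹ * 1) = freq L n by field_simp]
    linarith) j
  exact ⟨P, hP, fun n => by simpa using h n⟩

/-- Smooth functions on `[0, L]` whose sine coefficients are those of a unit value of the `2j`-th
derivative at the right end point. -/
theorem exists_lift_right (hL : 0 < L) (j : ℕ) :
    ∃ P : ℝ → ℝ, ContDiff ℝ ∞ P ∧
      ∀ n, sineCoeff L n P = (-1) ^ j * (freq L n ^ (2 * j + 1))⁻¹ * -(-1) ^ (n + 1) := by
  have hd : ∀ x : ℝ, HasDerivAt (fun x => x / L) (1 / L) x := fun x => by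
    simpa using (hasDerivAt_id x).div_const L
  exact exists_lift_iterate hL (contDiff_id.div_const L) (a := fun n => -(-1) ^ (n + 1))
    (fun n => by
      have h := sineCoeff_deriv_two n hL (fun x _ => hd x) (fun x _ => hasDerivAt_const x _)
        continuousOn_const
      have hf := (freq_pos n hL).ne'
      have h0 : sineCoeff L n (fun _ => 0) = 0 := by simp [sineCoeff]
      rw [h0, div_self hL.ne'] at h
      simp only [zero_div, zero_sub, mul_one] at h
      refine mul_left_cancel₀ (pow_ne_zero 2 hf) ?_
      rw [show freq L n ^ 2 * ((freq L n)⁻¹ * -(-1) ^ (n + 1)) = freq L n * -(-1) ^ (n + 1) by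
        field_simp]
      simp only [id]
      linarith) j

end Lift

section Completeness

variable {L : ℝ}

/-- With `θ = π x / L`, the products `sin θ * (cos θ)^k` are combinations of sines, so `w * sin θ`
is orthogonal to all polynomials in `cos θ`. Weierstrass approximation in the variable `cos θ` then
forces `∫ (w sin θ)² = 0`. -/
theorem eq_zero_of_sineCoeff_eq_zero (hL : 0 < L) {w : ℝ → ℝ} (hw : Continuous w)
    (h : ∀ n, sineCoeff L n w = 0) : ∀ x ∈ Ioo 0 L, w x = 0 := by
  set a := Real.pi / L with ha
  -- The trivial value `n = 0` is included because the product formula takes the frequency `n + 1`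
  -- to `n + 2` and `n`.
  have hzero : ∀ k n : ℕ,
      ∫ x in (0 : ℝ)..L, w x * Real.sin (n * (a * x)) * Real.cos (a * x) ^ k = 0 := by
    intro k
    induction k with
    | zero =>
      rintro (_ | n)
      · simp
      · have := h n
        simp only [sineCoeff, freq] at this
        refine Eq.trans ?_ this
        refine intervalIntegral.integral_congr fun x _ => ?_
        simp only [pow_zero, mul_one, ha]
        congr 2; push_cast; ring
    | succ k ih =>
      rintro (_ | n)
      · simp
      · have e : ∀ x : ℝ, w x * Real.sin ((n + 1 : ℕ) * (a * x)) * Real.cos (a * x) ^ (k + 1) =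
            (1 / 2) * (w x * Real.sin ((n + 2 : ℕ) * (a * x)) * Real.cos (a * x) ^ k) +
            (1 / 2) * (w x * Real.sin (n * (a * x)) * Real.cos (a * x) ^ k) := by
          intro x
          have e1 : ((n + 2 : ℕ) : ℝ) * (a * x) = (n + 1 : ℕ) * (a * x) + a * x := by
            push_cast; ring
          have e2 : (n : ℝ) * (a * x) = (n + 1 : ℕ) * (a * x) - a * x := by push_cast; ring
          rw [e1, e2, Real.sin_add, Real.sin_sub]; ring
        simp only [e]
        rw [intervalIntegral.integral_add (by apply Continuous.intervalIntegrable; fun_prop)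
          (by apply Continuous.intervalIntegrable; fun_prop),
          intervalIntegral.integral_const_mul, intervalIntegral.integral_const_mul, ih, ih]
        simp
  have hpoly : ∀ P : Polynomial ℝ,
      ∫ x in (0 : ℝ)..L, w x * Real.sin (a * x) * P.eval (Real.cos (a * x)) = 0 := by
    intro P
    simp only [Polynomial.eval_eq_sum_range, Finset.mul_sum]
    rw [intervalIntegral.integral_finsetSum
      (fun i _ => by apply Continuous.intervalIntegrable; fun_prop)]
    refine Finset.sum_eq_zero fun i _ => ?_
    have := hzero i 1
    simp only [Nat.cast_one, one_mul] at this
    rw [show (fun x => w x * Real.sin (a * x) * (P.coeff i * Real.cos (a * x) ^ i)) =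
      fun x => P.coeff i * (w x * Real.sin (a * x) * Real.cos (a * x) ^ i) by ext x; ring,
      intervalIntegral.integral_const_mul, this, mul_zero]
  have hL0 := hL.ne'
  have hrange : ∀ x ∈ Icc 0 L, 0 ≤ a * x ∧ a * x ≤ Real.pi := by
    intro x hx
    have : a * L = Real.pi := by rw [ha]; field_simp
    have ha0 : 0 ≤ a := by positivity
    exact ⟨mul_nonneg ha0 hx.1, this ▸ mul_le_mul_of_nonneg_left hx.2 ha0⟩
  -- The cosine is injective on `[0, π]`, so `w x * sin (a x)` is a continuous function `G` of `cos
  -- (a x)`.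
  set G : ℝ → ℝ := fun t => w (Real.arccos t / a) * Real.sin (Real.arccos t) with hG
  have hGc : Continuous G := by
    have := Real.continuous_arccos
    fun_prop
  have hGe : ∀ x ∈ Icc 0 L, G (Real.cos (a * x)) = w x * Real.sin (a * x) := by
    intro x hx
    have hr := hrange x hx
    have ha0 : a ≠ 0 := by positivity
    simp only [hG]
    rw [Real.arccos_cos hr.1 hr.2, mul_div_cancel_left₀ _ ha0]
  set I := ∫ x in (0 : ℝ)..L, |w x * Real.sin (a * x)| with hI
  have hI0 : 0 ≤ I := intervalIntegral.integral_nonneg hL.le fun x _ => abs_nonneg _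
  have hsq : ∫ x in (0 : ℝ)..L, (w x * Real.sin (a * x)) ^ 2 ≤ 0 := by
    refine le_of_forall_pos_le_add fun ε hε => ?_
    obtain ⟨P, hP⟩ := exists_polynomial_near_of_continuousOn (-1) 1 G hGc.continuousOn
      (ε / (I + 1)) (by positivity)
    have e : ∫ x in (0 : ℝ)..L, (w x * Real.sin (a * x)) ^ 2 = ∫ x in (0 : ℝ)..L,
        ((w x * Real.sin (a * x)) ^ 2 - w x * Real.sin (a * x) * P.eval (Real.cos (a * x))) := by
      rw [intervalIntegral.integral_sub (by apply Continuous.intervalIntegrable; fun_prop)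
        (by apply Continuous.intervalIntegrable; fun_prop), hpoly, sub_zero]
    rw [e, zero_add]
    calc _ ≤ ∫ x in (0 : ℝ)..L, (ε / (I + 1)) * |w x * Real.sin (a * x)| := by
          refine intervalIntegral.integral_mono_on hL.le
            (by apply Continuous.intervalIntegrable; fun_prop)
            (by apply Continuous.intervalIntegrable; fun_prop) fun x hx => ?_
          have h1 := hP (Real.cos (a * x)) ⟨Real.neg_one_le_cos _, Real.cos_le_one _⟩
          rw [hGe x hx, abs_sub_comm] at h1
          rw [show (w x * Real.sin (a * x)) ^ 2 - w x * Real.sin (a * x) *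
            P.eval (Real.cos (a * x)) = (w x * Real.sin (a * x) - P.eval (Real.cos (a * x))) *
              (w x * Real.sin (a * x)) by ring]
          refine (le_abs_self _).trans ?_
          rw [abs_mul]
          exact mul_le_mul_of_nonneg_right h1.le (abs_nonneg _)
      _ = (ε / (I + 1)) * I := by rw [intervalIntegral.integral_const_mul]
      _ ≤ ε := by
          rw [div_mul_eq_mul_div, div_le_iff₀ (by positivity)]
          nlinarith
  intro x hx
  by_contra hne
  have hs : 0 < Real.sin (a * x) := by
    have ha0 : 0 < a := by positivity
    refine Real.sin_pos_of_pos_of_lt_pi (mul_pos ha0 hx.1) ?_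
    have : a * L = Real.pi := by rw [ha]; field_simp
    rw [← this]; exact mul_lt_mul_of_pos_left hx.2 ha0
  have := intervalIntegral.integral_pos hL
    (f := fun x => (w x * Real.sin (a * x)) ^ 2) (by fun_prop) (fun x _ => sq_nonneg _)
    ⟨x, Ioo_subset_Icc_self hx, by positivity⟩
  linarith

theorem integral_cos_eq_zero (hL : 0 < L) {m : ℤ} (hm : m ≠ 0) :
    ∫ x in (0 : ℝ)..L, Real.cos (m * (Real.pi / L) * x) = 0 := by
  have hc : (m : ℝ) * (Real.pi / L) ≠ 0 := by
    have : (m : ℝ) ≠ 0 := by exact_mod_cast hm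
    positivity
  rw [intervalIntegral.integral_comp_mul_left (fun x => Real.cos x) hc, integral_cos]
  rw [show (m : ℝ) * (Real.pi / L) * L = m * Real.pi by field_simp]
  simp [Real.sin_int_mul_pi]

theorem sineCoeff_sin (hL : 0 < L) (n k : ℕ) :
    sineCoeff L n (fun x => Real.sin (freq L k * x)) = if n = k then L / 2 else 0 := by
  have e : ∀ x : ℝ, Real.sin (freq L k * x) * Real.sin (freq L n * x) =
      (1 / 2) * Real.cos (((k : ℤ) - n : ℤ) * (Real.pi / L) * x) -
      (1 / 2) * Real.cos (((k : ℤ) + n + 2 : ℤ) * (Real.pi / L) * x) := by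
    intro x
    have e1 : (((k : ℤ) - n : ℤ) : ℝ) * (Real.pi / L) * x = freq L k * x - freq L n * x := by
      unfold freq; push_cast; ring
    have e2 : (((k : ℤ) + n + 2 : ℤ) : ℝ) * (Real.pi / L) * x = freq L k * x + freq L n * x := by
      unfold freq; push_cast; ring
    rw [e1, e2, Real.cos_sub, Real.cos_add]; ring
  simp only [sineCoeff, e]
  rw [intervalIntegral.integral_sub (by apply Continuous.intervalIntegrable; fun_prop)
    (by apply Continuous.intervalIntegrable; fun_prop), intervalIntegral.integral_const_mul,
    intervalIntegral.integral_const_mul, integral_cos_eq_zero hL (m := (k : ℤ) + n + 2) (by omega)]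
  split_ifs with hnk
  · subst hnk; simp; ring
  · rw [integral_cos_eq_zero hL (m := (k : ℤ) - n) (by omega)]; simp

end Completeness

end EulerLayer

end

/-! ### Comparison principle, barriers and decay of single modes. -/

noncomputable section

namespace EulerLayer

section Comparison

/-- A subsolution of `(A z')' = 0` on `{z > 0}` which starts below zero and becomes positive grows
at least linearly. -/
theorem linear_growth_of_pos {a C : ℝ} {A z z' p p' : ℝ → ℝ} (hA : ∀ Y, a < Y → 0 < A Y)
    (hAC : ∀ Y, a < Y → A Y ≤ C) (hzc : ContinuousOn z (Ici a))
    (hz : ∀ Y, a < Y → HasDerivAt z (z' Y) Y) (hpz : ∀ Y, a < Y → p Y = A Y * z' Y)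
    (hp : ∀ Y, a < Y → HasDerivAt p (p' Y) Y) (hpos : ∀ Y, a < Y → 0 < z Y → 0 ≤ p' Y)
    (hza : z a ≤ 0) {b : ℝ} (hab : a < b) (hzb : 0 < z b) :
    ∃ c > 0, ∃ Y₁, a < Y₁ ∧ ∀ Y, Y₁ ≤ Y → c * (Y - Y₁) ≤ z Y := by
  -- After the last point of `[a, b]` where `z ≤ 0`, the mean value theorem gives a point with both
  -- `z` and `z'` positive.
  obtain ⟨ξ, hξa, hξz, hξz'⟩ : ∃ ξ, a < ξ ∧ 0 < z ξ ∧ 0 < z' ξ := by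
    have hcl : IsCompact {t ∈ Icc a b | z t ≤ 0} := by
      have : {t ∈ Icc a b | z t ≤ 0} = Icc a b ∩ z ⁻¹' Iic 0 := rfl
      rw [this]
      exact isCompact_Icc.of_isClosed_subset ((hzc.mono Icc_subset_Ici_self).preimage_isClosed_of_isClosed
        isClosed_Icc isClosed_Iic) inter_subset_left
    obtain ⟨t, ⟨⟨hta, htb⟩, htz⟩, hmax⟩ := hcl.exists_isGreatest ⟨a, ⟨le_rfl, hab.le⟩, hza⟩
    have htb' : t < b := lt_of_le_of_ne htb (by rintro rfl; linarith)
    obtain ⟨ξ, ⟨h1, h2⟩, h3⟩ := exists_hasDerivAt_eq_slope z z' htb'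
      (hzc.mono fun s hs => hta.trans hs.1) (fun s hs => hz s (hta.trans_lt hs.1))
    refine ⟨ξ, hta.trans_lt h1, ?_, ?_⟩
    · by_contra! h
      exact absurd (hmax ⟨⟨hta.trans h1.le, h2.le⟩, h⟩) (not_le.2 h1)
    · rw [h3]; exact div_pos (by linarith) (by linarith)
  have hpc : ∀ s t, ContinuousOn p (Icc ξ t ∩ s) := fun s t x hx =>
    (hp x (hξa.trans_le hx.1.1)).continuousAt.continuousWithinAt
  have hzc' : ∀ t, ContinuousOn z (Icc ξ t) := fun t x hx =>
    (hz x (hξa.trans_le hx.1)).continuousAt.continuousWithinAt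
  have hpξ : 0 < p ξ := by rw [hpz ξ hξa]; exact mul_pos (hA ξ hξa) hξz'
  -- As long as `z` stays positive, the flux `p = A z'` cannot decrease, so `z'` stays above `p ξ /
  -- C`.
  have hmono : ∀ t, (∀ s ∈ Ioo ξ t, 0 < z s) → ∀ s ∈ Icc ξ t, p ξ ≤ p s := by
    intro t ht s hs
    have : MonotoneOn p (Icc ξ t) := by
      refine monotoneOn_of_hasDerivWithinAt_nonneg (f' := p') (convex_Icc _ _)
        (by simpa using hpc univ t) (fun x hx => ?_) fun x hx => ?_
      · rw [interior_Icc] at hx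
        exact (hp x (hξa.trans hx.1)).hasDerivWithinAt
      · rw [interior_Icc] at hx
        exact hpos x (hξa.trans hx.1) (ht x hx)
    exact this ⟨le_rfl, hs.1.trans hs.2⟩ hs hs.1
  have hz'p : ∀ s, ξ ≤ s → p ξ ≤ p s → p ξ / C ≤ z' s := by
    intro s hs hps
    have hAs := hA s (hξa.trans_le hs)
    have h1 : z' s = p s / A s := by rw [hpz s (hξa.trans_le hs)]; field_simp
    rw [h1]
    exact div_le_div₀ (hpξ.le.trans hps) hps hAs (hAC s (hξa.trans_le hs))
  have hC : 0 < C := (hA ξ hξa).trans_le (hAC ξ hξa)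
  have hgrow : ∀ t, ξ ≤ t → (∀ s ∈ Ioo ξ t, 0 < z s) → p ξ / C * (t - ξ) ≤ z t - z ξ := by
    intro t hξt ht
    refine (convex_Icc ξ t).mul_sub_le_image_sub_of_le_deriv (hzc' t) (fun x hx => ?_)
      (fun x hx => ?_) ξ ⟨le_rfl, hξt⟩ t ⟨hξt, le_rfl⟩ hξt
    · rw [interior_Icc] at hx
      exact (hz x (hξa.trans hx.1)).differentiableAt.differentiableWithinAt
    · rw [interior_Icc] at hx
      rw [(hz x (hξa.trans hx.1)).deriv]
      exact hz'p x hx.1.le (hmono t ht x (Ioo_subset_Icc_self hx))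
  -- At a first return to `z ≤ 0` the growth estimate up to that point already gives `z ≥ z ξ > 0`.
  have hallpos : ∀ t, ξ ≤ t → 0 < z t := by
    by_contra! hcon
    obtain ⟨t, hξt, hzt⟩ := hcon
    have hcl : IsCompact {s ∈ Icc ξ t | z s ≤ 0} := by
      have : {s ∈ Icc ξ t | z s ≤ 0} = Icc ξ t ∩ z ⁻¹' Iic 0 := rfl
      rw [this]
      exact isCompact_Icc.of_isClosed_subset ((hzc' t).preimage_isClosed_of_isClosed
        isClosed_Icc isClosed_Iic) inter_subset_left
    obtain ⟨s, ⟨⟨hs1, hs2⟩, hsz⟩, hmin⟩ := hcl.exists_isLeast ⟨t, ⟨hξt, le_rfl⟩, hzt⟩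
    have h1 := hgrow s hs1 fun x hx => by
      by_contra! h
      exact absurd (hmin ⟨⟨hx.1.le, hx.2.le.trans hs2⟩, h⟩) (not_le.2 hx.2)
    have h2 : 0 ≤ p ξ / C * (s - ξ) := mul_nonneg (by positivity) (by linarith)
    linarith
  refine ⟨p ξ / C, by positivity, ξ, hξa, fun Y hY => ?_⟩
  linarith [hgrow Y hY fun s hs => hallpos s hs.1.le]

/-- `f` does not grow linearly. -/
def Sublinear (f : ℝ → ℝ) : Prop := ¬ ∃ c > 0, ∃ Y₁, ∀ Y, Y₁ ≤ Y → c * (Y - Y₁) ≤ |f Y|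

theorem IsShearFlow.hasDerivAt {u : ℝ → ℝ} (hu : IsShearFlow u) (j : ℕ) (Y : ℝ) :
    HasDerivAt (iteratedDeriv j u) (iteratedDeriv (j + 1) u Y) Y := by
  rw [iteratedDeriv_succ]
  exact ((hu.smooth.differentiable_iteratedDeriv j (WithTop.coe_lt_coe.2 (ENat.natCast_lt_top j)))
    Y).hasDerivAt

/-- The comparison principle for `r'' = (lam² + u''/u) r - R`, i.e. for
`(u² (r/u)')' = lam² u² (r/u) - u R`. -/
theorem le_of_barrier {u : ℝ → ℝ} (hu : IsShearFlow u) {a lam K : ℝ} (ha : 0 ≤ a)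
    {r r' R B B₁ B₂ : ℝ → ℝ} (hrc : ContinuousOn r (Ici a))
    (hr : ∀ Y, a < Y → HasDerivAt r (r' Y) Y)
    (hr' : ∀ Y, a < Y →
      HasDerivAt r' ((lam ^ 2 + iteratedDeriv 2 u Y / u Y) * r Y - R Y) Y)
    (hgrowth : Sublinear r) (hK : 0 ≤ K) (hBc : ContinuousOn B (Ici a))
    (hB0 : ∀ Y, a ≤ Y → 0 ≤ B Y)
    (hB : ∀ Y, a < Y → HasDerivAt B (B₁ Y) Y) (hB₁ : ∀ Y, a < Y → HasDerivAt B₁ (B₂ Y) Y)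
    (hbar : ∀ Y, a < Y →
      R Y ≤ K * (u Y * (lam ^ 2 * B Y - B₂ Y) - 2 * iteratedDeriv 1 u Y * B₁ Y))
    (hra : r a ≤ K * u a * B a) : ∀ Y, a ≤ Y → r Y ≤ K * u Y * B Y := by
  obtain ⟨c₀, C₀, hc₀, hb⟩ := hu.bounds
  have hupos : ∀ Y, a ≤ Y → 0 < u Y := fun Y hY => hc₀.trans_le (hb Y (ha.trans hY)).1
  have hu0 : ∀ Y, HasDerivAt u (iteratedDeriv 1 u Y) Y := fun Y => by
    simpa using hu.hasDerivAt 0 Y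
  have hu1 : ∀ Y, HasDerivAt (iteratedDeriv 1 u) (iteratedDeriv 2 u Y) Y := hu.hasDerivAt 1
  -- Division by `u` cancels the potential, and `z` satisfies `(u² z')' ≥ lam² u² z`. Thus `u * B`
  -- plays the role of a supersolution.
  set z : ℝ → ℝ := fun Y => r Y / u Y - K * B Y with hz
  have hzle : ∀ Y, a ≤ Y → z Y ≤ 0 → r Y ≤ K * u Y * B Y := by
    intro Y hY h
    have : r Y / u Y ≤ K * B Y := by simp only [hz] at h; linarith
    rw [div_le_iff₀ (hupos Y hY)] at this
    linarith
  have hza : z a ≤ 0 := by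
    simp only [hz, sub_nonpos]
    rw [div_le_iff₀ (hupos a le_rfl)]
    linarith
  intro Y hY
  rcases hY.eq_or_lt with rfl | hY
  · exact hra
  refine hzle Y hY.le ?_
  by_contra! hpos
  obtain ⟨c, hc, Y₁, hY₁, hlin⟩ := linear_growth_of_pos (a := a) (C := C₀ ^ 2)
    (A := fun Y => u Y ^ 2) (z := z)
    (z' := fun Y => (r' Y * u Y - r Y * iteratedDeriv 1 u Y) / u Y ^ 2 - K * B₁ Y)
    (p := fun Y => r' Y * u Y - r Y * iteratedDeriv 1 u Y - K * (u Y ^ 2 * B₁ Y))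
    (p' := fun Y => ((lam ^ 2 + iteratedDeriv 2 u Y / u Y) * r Y - R Y) * u Y
      - r Y * iteratedDeriv 2 u Y
      - K * (2 * u Y * iteratedDeriv 1 u Y * B₁ Y + u Y ^ 2 * B₂ Y))
    (fun Y hY => pow_pos (hupos Y hY.le) 2)
    (fun Y hY => pow_le_pow_left₀ (hupos Y hY.le).le (hb Y (ha.trans hY.le)).2 2)
    ((hrc.div hu.smooth.continuous.continuousOn fun Y hY => (hupos Y hY).ne').sub
      (hBc.const_mul K))
    (fun Y hY => ((hr Y hY).fun_div (hu0 Y) (hupos Y hY.le).ne').fun_sub ((hB Y hY).const_mul K))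
    (fun Y hY => by have := (hupos Y hY.le).ne'; field_simp)
    (fun Y hY => by
      refine ((((hr' Y hY).fun_mul (hu0 Y)).fun_sub ((hr Y hY).fun_mul (hu1 Y))).fun_sub
        ((((hu0 Y).fun_pow 2).fun_mul (hB₁ Y hY)).const_mul K)).congr_deriv ?_
      push_cast
      ring)
    (fun Y hY hzY => by
      have h1 := hbar Y hY
      have h2 := hupos Y hY.le
      have e : ((lam ^ 2 + iteratedDeriv 2 u Y / u Y) * r Y - R Y) * u Y
          - r Y * iteratedDeriv 2 u Y
          - K * (2 * u Y * iteratedDeriv 1 u Y * B₁ Y + u Y ^ 2 * B₂ Y) =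
          lam ^ 2 * u Y ^ 2 * z Y +
          u Y * (K * (u Y * (lam ^ 2 * B Y - B₂ Y) - 2 * iteratedDeriv 1 u Y * B₁ Y) - R Y) := by
        simp only [hz]; field_simp; ring
      rw [e]
      have h3 : 0 ≤ u Y *
        (K * (u Y * (lam ^ 2 * B Y - B₂ Y) - 2 * iteratedDeriv 1 u Y * B₁ Y) - R Y) :=
        mul_nonneg h2.le (by linarith)
      positivity)
    hza hY hpos
  -- Since `K * B ≥ 0`, linear growth of `z` passes to `r / u`, hence to `r` with the factor `c₀`.
  refine hgrowth ⟨c₀ * c, by positivity, Y₁, fun Y hY => ?_⟩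
  have h1 := hlin Y hY
  have h2 : a ≤ Y := hY₁.le.trans hY
  have h3 : z Y ≤ r Y / u Y := by
    simp only [hz]
    linarith [mul_nonneg hK (hB0 Y h2)]
  have h4 : c * (Y - Y₁) ≤ r Y / u Y := h1.trans h3
  rw [le_div_iff₀ (hupos Y h2)] at h4
  refine le_trans ?_ (h4.trans (le_abs_self _))
  have h5 := (hb Y (ha.trans h2)).1
  have h6 : 0 ≤ c * (Y - Y₁) := mul_nonneg hc.le (by linarith)
  calc c₀ * c * (Y - Y₁) = c * (Y - Y₁) * c₀ := by ring
    _ ≤ _ := mul_le_mul_of_nonneg_left h5 h6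

theorem abs_le_of_barrier {u : ℝ → ℝ} (hu : IsShearFlow u) {a lam K : ℝ} (ha : 0 ≤ a)
    {r r' R B B₁ B₂ : ℝ → ℝ} (hrc : ContinuousOn r (Ici a))
    (hr : ∀ Y, a < Y → HasDerivAt r (r' Y) Y)
    (hr' : ∀ Y, a < Y →
      HasDerivAt r' ((lam ^ 2 + iteratedDeriv 2 u Y / u Y) * r Y - R Y) Y)
    (hgrowth : Sublinear r) (hK : 0 ≤ K) (hBc : ContinuousOn B (Ici a))
    (hB0 : ∀ Y, a ≤ Y → 0 ≤ B Y)
    (hB : ∀ Y, a < Y → HasDerivAt B (B₁ Y) Y) (hB₁ : ∀ Y, a < Y → HasDerivAt B₁ (B₂ Y) Y)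
    (hbar : ∀ Y, a < Y →
      |R Y| ≤ K * (u Y * (lam ^ 2 * B Y - B₂ Y) - 2 * iteratedDeriv 1 u Y * B₁ Y))
    (hra : |r a| ≤ K * u a * B a) : ∀ Y, a ≤ Y → |r Y| ≤ K * u Y * B Y := by
  intro Y hY
  refine abs_le'.2 ⟨le_of_barrier hu ha hrc hr hr' hgrowth hK hBc hB0 hB hB₁
    (fun Y hY => (le_abs_self _).trans (hbar Y hY)) ((le_abs_self _).trans hra) Y hY, ?_⟩
  refine le_of_barrier (r := fun Y => -r Y) (r' := fun Y => -r' Y) (R := fun Y => -R Y) hu ha hrc.neg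
    (fun Y hY => (hr Y hY).fun_neg) (fun Y hY => ((hr' Y hY).fun_neg).congr_deriv (by ring))
    (by simpa [Sublinear] using hgrowth) hK hBc hB0 hB hB₁
    (fun Y hY => (neg_le_abs _).trans (hbar Y hY)) ((neg_le_abs _).trans hra) Y hY

end Comparison

section Weight

variable {κ : WeightKind} {m : ℝ}

theorem weight_pos {Y : ℝ} (hY : 0 ≤ Y) : 0 < weight κ m Y := by
  cases κ
  · exact Real.rpow_pos_of_pos (by linarith) _
  · exact Real.exp_pos _

theorem weight_mono (hm : 0 ≤ m) {Y Z : ℝ} (hY : 0 ≤ Y) (hYZ : Y ≤ Z) :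
    weight κ m Y ≤ weight κ m Z := by
  cases κ
  · exact Real.rpow_le_rpow (by linarith) (by linarith) hm
  · exact Real.exp_le_exp.2 (mul_le_mul_of_nonneg_left hYZ hm)

theorem weight_zero_right : weight κ m 0 = 1 := by cases κ <;> simp [weight]

theorem one_le_weight (hm : 0 ≤ m) {Y : ℝ} (hY : 0 ≤ Y) : 1 ≤ weight κ m Y := by
  simpa [weight_zero_right] using weight_mono (κ := κ) hm le_rfl hY

theorem weight_le_weight {m' : ℝ} (h : m ≤ m') {Y : ℝ} (hY : 0 ≤ Y) :
    weight κ m Y ≤ weight κ m' Y := by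
  cases κ
  · exact Real.rpow_le_rpow_of_exponent_le (by linarith) h
  · exact Real.exp_le_exp.2 (mul_le_mul_of_nonneg_right h hY)

/-- The reciprocal weight. -/
def decayRate (κ : WeightKind) (m Y : ℝ) : ℝ := (weight κ m Y)⁻¹

theorem decayRate_pos {Y : ℝ} (hY : 0 ≤ Y) : 0 < decayRate κ m Y := inv_pos.2 (weight_pos hY)

theorem decayRate_anti (hm : 0 ≤ m) {Y Z : ℝ} (hY : 0 ≤ Y) (hYZ : Y ≤ Z) :
    decayRate κ m Z ≤ decayRate κ m Y := inv_anti₀ (weight_pos hY) (weight_mono hm hY hYZ)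

theorem decayRate_le_one (hm : 0 ≤ m) {Y : ℝ} (hY : 0 ≤ Y) : decayRate κ m Y ≤ 1 :=
  inv_le_one_of_one_le₀ (one_le_weight hm hY)

/-- Far out, the reciprocal weight is a strict supersolution for all modes. -/
theorem exists_barrier {u : ℝ → ℝ} (hu : IsShearFlow u) {L : ℝ} (hL : 0 < L) (hm : 0 ≤ m)
    (hsmall : κ = WeightKind.exponential → m * L < Real.pi) :
    ∃ B₁ B₂ : ℝ → ℝ, (∀ Y, 0 ≤ Y → HasDerivAt (decayRate κ m) (B₁ Y) Y) ∧
      (∀ Y, 0 ≤ Y → HasDerivAt B₁ (B₂ Y) Y) ∧ ∃ Y₀, 0 ≤ Y₀ ∧ ∃ δ, 0 < δ ∧ ∀ Y, Y₀ ≤ Y →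
        δ * decayRate κ m Y ≤ u Y * ((Real.pi / L) ^ 2 * decayRate κ m Y - B₂ Y) -
          2 * iteratedDeriv 1 u Y * B₁ Y := by
  obtain ⟨c₀, C₀, hc₀, hb⟩ := hu.bounds
  obtain ⟨C, hC⟩ := hu.decay 1 le_rfl 1
  have hC0 : 0 ≤ C := le_trans (by positivity) (hC 0 le_rfl)
  have hu1 : ∀ Y, 0 ≤ Y → |iteratedDeriv 1 u Y| ≤ C / (1 + Y) := fun Y hY => by
    rw [le_div_iff₀ (by linarith)]; simpa [mul_comm] using hC Y hY
  have hlam : 0 < Real.pi / L := by positivity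
  cases κ with
  | exponential =>
    have e : decayRate WeightKind.exponential m = fun Y => Real.exp (-m * Y) := by
      funext Y; simp [decayRate, weight, Real.exp_neg]
    have hd : ∀ Y, HasDerivAt (fun Y => Real.exp (-m * Y)) (-m * Real.exp (-m * Y)) Y := fun Y => by
      simpa [mul_comm] using ((hasDerivAt_id Y).const_mul (-m)).exp
    -- For `B = e^{-mY}` one has `(π/L)² B - B'' = ((π/L)² - m²) B`, which is where smallness of `L`
    -- enters. Half of the coercivity is kept as `δ`; the other half absorbs the term with `u'`, at
    -- most `C/(1+Y)`, once `Y ≥ 2mC/δ`.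
    have hm' : m < Real.pi / L := by rw [lt_div_iff₀ hL]; exact hsmall rfl
    have hδ : 0 < c₀ * ((Real.pi / L) ^ 2 - m ^ 2) / 2 := by
      have : 0 < (Real.pi / L) ^ 2 - m ^ 2 := by nlinarith
      positivity
    set δ := c₀ * ((Real.pi / L) ^ 2 - m ^ 2) / 2 with hδe
    refine ⟨fun Y => -m * Real.exp (-m * Y), fun Y => -m * (-m * Real.exp (-m * Y)),
      fun Y _ => e ▸ hd Y, fun Y _ => (hd Y).const_mul _, 2 * m * C / δ, by positivity, δ, hδ,
      fun Y hY => ?_⟩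
    have hY0 : 0 ≤ Y := le_trans (by positivity) hY
    rw [div_le_iff₀ hδ] at hY
    have h1 : 2 * m * |iteratedDeriv 1 u Y| ≤ δ := by
      refine (mul_le_mul_of_nonneg_left (hu1 Y hY0) (by positivity)).trans ?_
      rw [mul_div_assoc', div_le_iff₀ (by linarith)]
      nlinarith
    have h2 : 2 * δ ≤ u Y * ((Real.pi / L) ^ 2 - m ^ 2) := by
      rw [hδe]
      nlinarith [(hb Y hY0).1]
    have h3 := neg_abs_le (iteratedDeriv 1 u Y)
    have h4 : δ ≤ u Y * ((Real.pi / L) ^ 2 - m ^ 2) + 2 * m * iteratedDeriv 1 u Y := by nlinarith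
    rw [e]
    have := mul_le_mul_of_nonneg_right h4 (Real.exp_pos (-m * Y)).le
    simp only
    linarith
  | polynomial =>
    have e : ∀ Y, 0 ≤ Y → decayRate WeightKind.polynomial m Y = (1 + Y) ^ (-m) := fun Y hY => by
      simp only [decayRate, weight]; rw [Real.rpow_neg (by linarith)]
    -- The formula is needed on a neighbourhood of `Y = 0` for the two-sided derivative there.
    have e' : ∀ Y, -1 < Y → decayRate WeightKind.polynomial m Y = (1 + Y) ^ (-m) := fun Y hY => by
      simp only [decayRate, weight]; rw [Real.rpow_neg (by linarith)]
    have hd : ∀ (q Y : ℝ), 0 ≤ Y →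
        HasDerivAt (fun Y : ℝ => (1 + Y) ^ q) (q * (1 + Y) ^ (q - 1)) Y := fun q Y hY => by
      simpa using ((hasDerivAt_id Y).const_add 1).rpow_const (p := q)
        (Or.inl (by simp; linarith))
    -- Derivatives of a power gain factors `1/(1+Y)`, so far out both `B''` and the `u'` term are
    -- absorbed without restricting `L`.
    set δ := c₀ * (Real.pi / L) ^ 2 / 2 with hδe
    have hδ : 0 < δ := by positivity
    have hC₀ : 0 ≤ C₀ := hc₀.le.trans ((hb 0 le_rfl).1.trans (hb 0 le_rfl).2)
    refine ⟨fun Y => -m * (1 + Y) ^ (-m - 1), fun Y => -m * ((-m - 1) * (1 + Y) ^ (-m - 1 - 1)),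
      fun Y hY => (hd (-m) Y hY).congr_of_eventuallyEq ?_,
      fun Y hY => (hd (-m - 1) Y hY).const_mul _,
      (C₀ * (m * (m + 1)) + 2 * m * C) / δ, by positivity, δ, hδ, fun Y hY => ?_⟩
    · filter_upwards [Ioi_mem_nhds (show -1 < Y by linarith)] with t ht using e' t ht
    have hY0 : 0 ≤ Y := le_trans (by positivity) hY
    have h1Y : 0 < 1 + Y := by linarith
    rw [div_le_iff₀ hδ] at hY
    rw [e Y hY0]
    set P := (1 + Y) ^ (-m) with hP
    have hP0 : 0 < P := Real.rpow_pos_of_pos h1Y _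
    have e1 : (1 + Y) ^ (-m - 1) = P / (1 + Y) := by rw [Real.rpow_sub_one h1Y.ne']
    have e2 : (1 + Y) ^ (-m - 1 - 1) = P / (1 + Y) / (1 + Y) := by
      rw [Real.rpow_sub_one h1Y.ne', e1]
    simp only [e1, e2]
    have h1 : |iteratedDeriv 1 u Y| ≤ C := (hu1 Y hY0).trans (div_le_self hC0 (by linarith))
    have h3 := neg_abs_le (iteratedDeriv 1 u Y)
    have hkey : u Y * (m * (m + 1) / (1 + Y) / (1 + Y)) - 2 * m * iteratedDeriv 1 u Y / (1 + Y)
        ≤ δ := by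
      have a1 : u Y * (m * (m + 1) / (1 + Y) / (1 + Y)) ≤ C₀ * (m * (m + 1)) / (1 + Y) := by
        rw [mul_div_assoc C₀]
        refine mul_le_mul (hb Y hY0).2 (div_le_self (by positivity) (by linarith)) (by positivity) hC₀
      have a2 : -(2 * m * iteratedDeriv 1 u Y / (1 + Y)) ≤ 2 * m * C / (1 + Y) := by
        rw [← neg_div]
        refine div_le_div_of_nonneg_right ?_ h1Y.le
        nlinarith
      have a3 : C₀ * (m * (m + 1)) / (1 + Y) + 2 * m * C / (1 + Y) ≤ δ := by
        rw [← add_div, div_le_iff₀ h1Y]; nlinarith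
      linarith
    have h2 : 2 * δ ≤ u Y * (Real.pi / L) ^ 2 := by
      rw [hδe]
      nlinarith [(hb Y hY0).1, sq_nonneg (Real.pi / L)]
    have h4 : δ ≤ u Y * (Real.pi / L) ^ 2 - (u Y * (m * (m + 1) / (1 + Y) / (1 + Y)) -
      2 * m * iteratedDeriv 1 u Y / (1 + Y)) := by linarith
    have := mul_le_mul_of_nonneg_right h4 hP0.le
    refine this.trans (le_of_eq ?_)
    field_simp
    ring

/-- Solutions of `r'' = (freq² + u''/u) r - R` inherit the decay of `R`, uniformly in the mode. -/
theorem exists_decay_estimate {u : ℝ → ℝ} (hu : IsShearFlow u) {L : ℝ} (hL : 0 < L) (hm : 0 ≤ m)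
    (hsmall : κ = WeightKind.exponential → m * L < Real.pi) :
    ∃ C, 0 ≤ C ∧ ∀ (n : ℕ) (K : ℝ) (r r' R : ℝ → ℝ), 0 ≤ K → ContinuousOn r (Ici 0) →
      (∀ Y, 0 < Y → HasDerivAt r (r' Y) Y) →
      (∀ Y, 0 < Y →
        HasDerivAt r' ((freq L n ^ 2 + iteratedDeriv 2 u Y / u Y) * r Y - R Y) Y) →
      Sublinear r → (∀ Y, 0 < Y → |R Y| ≤ K * decayRate κ m Y) → |r 0| ≤ K →
      ∀ Y, 0 ≤ Y → |r Y| ≤ C * K * decayRate κ m Y := by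
  obtain ⟨c₀, C₀, hc₀, hb⟩ := hu.bounds
  obtain ⟨B₁, B₂, hB, hB₁, Y₀, hY₀, δ, hδ, hbar⟩ := exists_barrier (κ := κ) hu hL hm hsmall
  set lam := Real.pi / L with hlam
  have hlam0 : 0 < lam := by positivity
  have hC₀ : 0 < C₀ := hc₀.trans_le ((hb 0 le_rfl).1.trans (hb 0 le_rfl).2)
  -- `a₁` serves the constant barrier: its summands dominate the forcing and the value at `0`. `a₂`
  -- serves the decaying barrier beyond `Y₀`: its summands dominate the forcing and the value at
  -- `Y₀` known from the first bound. Only the lowest frequency `lam` enters, hence uniformity in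
  -- `n`.
  set a₁ := 1 / (c₀ * lam ^ 2) + 1 / c₀ with ha₁
  set a₂ := 1 / δ + a₁ * C₀ / (c₀ * decayRate κ m Y₀) with ha₂
  have hD := decayRate_pos (κ := κ) (m := m) hY₀
  have ha₁0 : 0 ≤ a₁ := by positivity
  have ha₂0 : 0 ≤ a₂ := by positivity
  refine ⟨a₂ * C₀ + a₁ * C₀ / decayRate κ m Y₀, by positivity,
    fun n K r r' R hK hrc hr hr' hg hR hr0 => ?_⟩
  have hlam_le : lam ^ 2 ≤ freq L n ^ 2 := by
    refine pow_le_pow_left₀ hlam0.le ?_ 2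
    rw [hlam, freq]
    refine div_le_div_of_nonneg_right ?_ hL.le
    nlinarith [Real.pi_pos, (Nat.cast_nonneg n : (0 : ℝ) ≤ n)]
  have h1 : ∀ Y, 0 ≤ Y → |r Y| ≤ K * a₁ * C₀ := by
    have h := abs_le_of_barrier (B := fun _ => 1) (B₁ := fun _ => 0) (B₂ := fun _ => 0)
      (K := K * a₁) hu le_rfl hrc hr hr' hg (by positivity) continuousOn_const
      (fun _ _ => zero_le_one) (fun Y _ => hasDerivAt_const _ _) (fun Y _ => hasDerivAt_const _ _)
      (fun Y hY => by
        refine (hR Y hY).trans ?_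
        have e1 : K * decayRate κ m Y ≤ K * 1 :=
          mul_le_mul_of_nonneg_left (decayRate_le_one hm hY.le) hK
        have e2 : 1 ≤ a₁ * (c₀ * lam ^ 2) := by
          have : (1 : ℝ) = 1 / (c₀ * lam ^ 2) * (c₀ * lam ^ 2) := by field_simp
          rw [this]
          refine mul_le_mul_of_nonneg_right ?_ (by positivity)
          rw [ha₁]; linarith [show 0 < 1 / c₀ by positivity]
        have e3 : c₀ * lam ^ 2 ≤ u Y * freq L n ^ 2 :=
          mul_le_mul (hb Y hY.le).1 hlam_le (by positivity) (hc₀.le.trans (hb Y hY.le).1)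
        have e4 : K * 1 ≤ K * (a₁ * (u Y * freq L n ^ 2)) :=
          mul_le_mul_of_nonneg_left (e2.trans (mul_le_mul_of_nonneg_left e3 ha₁0)) hK
        linarith)
      (by
        refine hr0.trans ?_
        have e2 : 1 ≤ a₁ * u 0 := by
          have : (1 : ℝ) = 1 / c₀ * c₀ := by field_simp
          rw [this]
          refine mul_le_mul ?_ (hb 0 le_rfl).1 hc₀.le ha₁0
          rw [ha₁]; linarith [show 0 < 1 / (c₀ * lam ^ 2) by positivity]
        nlinarith)
    intro Y hY
    refine (h Y hY).trans ?_
    rw [mul_one]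
    exact mul_le_mul_of_nonneg_left (hb Y hY).2 (by positivity)
  have h2 : ∀ Y, Y₀ ≤ Y → |r Y| ≤ K * a₂ * u Y * decayRate κ m Y := by
    refine abs_le_of_barrier (B := decayRate κ m) (B₁ := B₁) (B₂ := B₂) (K := K * a₂) hu hY₀
      (hrc.mono fun Y hY => hY₀.trans hY) (fun Y hY => hr Y (hY₀.trans_lt hY))
      (fun Y hY => hr' Y (hY₀.trans_lt hY)) hg (by positivity)
      (fun Y hY => (hB Y (hY₀.trans hY)).continuousAt.continuousWithinAt)
      (fun Y hY => (decayRate_pos (hY₀.trans hY)).le) (fun Y hY => hB Y (hY₀.trans hY.le))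
      (fun Y hY => hB₁ Y (hY₀.trans hY.le)) (fun Y hY => ?_) ?_
    · have hY' := hY₀.trans_lt hY
      have hW := decayRate_pos (κ := κ) (m := m) hY'.le
      refine (hR Y hY').trans ?_
      have e1 := hbar Y hY.le
      have e2 : u Y * (lam ^ 2 * decayRate κ m Y) ≤ u Y * (freq L n ^ 2 * decayRate κ m Y) :=
        mul_le_mul_of_nonneg_left (mul_le_mul_of_nonneg_right hlam_le hW.le)
          (hc₀.le.trans (hb Y hY'.le).1)
      have e3 : 1 ≤ a₂ * δ := by
        rw [ha₂, add_mul]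
        have : 1 / δ * δ = 1 := by field_simp
        rw [this]
        have : 0 ≤ a₁ * C₀ / (c₀ * decayRate κ m Y₀) * δ := by positivity
        linarith
      calc K * decayRate κ m Y ≤ K * (a₂ * δ * decayRate κ m Y) := by
            refine mul_le_mul_of_nonneg_left ?_ hK
            nlinarith
        _ = K * a₂ * (δ * decayRate κ m Y) := by ring
        _ ≤ _ := mul_le_mul_of_nonneg_left (by linarith) (by positivity)
    · refine (h1 Y₀ hY₀).trans ?_
      have e1 : a₁ * C₀ ≤ a₂ * (c₀ * decayRate κ m Y₀) := by
        rw [ha₂, add_mul (1 / δ),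
          div_mul_cancel₀ (a₁ * C₀) (by positivity : c₀ * decayRate κ m Y₀ ≠ 0)]
        have : 0 ≤ 1 / δ * (c₀ * decayRate κ m Y₀) := by positivity
        linarith
      have e2 : c₀ * decayRate κ m Y₀ ≤ u Y₀ * decayRate κ m Y₀ :=
        mul_le_mul_of_nonneg_right (hb Y₀ hY₀).1 hD.le
      calc K * a₁ * C₀ = K * (a₁ * C₀) := by ring
        _ ≤ K * (a₂ * (u Y₀ * decayRate κ m Y₀)) :=
          mul_le_mul_of_nonneg_left (e1.trans (mul_le_mul_of_nonneg_left e2 ha₂0)) hK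
        _ = _ := by ring
  intro Y hY
  have hW := decayRate_pos (κ := κ) (m := m) hY
  rcases le_total Y₀ Y with h | h
  · refine (h2 Y h).trans ?_
    refine mul_le_mul_of_nonneg_right ?_ hW.le
    have e1 : K * a₂ * u Y ≤ K * a₂ * C₀ := mul_le_mul_of_nonneg_left (hb Y hY).2 (by positivity)
    have e2 : 0 ≤ a₁ * C₀ / decayRate κ m Y₀ * K := by positivity
    linarith
  -- Up to `Y₀` the reciprocal weight is bounded below by its value at `Y₀`, so boundedness
  -- suffices.
  · refine (h1 Y hY).trans ?_
    have e1 : decayRate κ m Y₀ ≤ decayRate κ m Y := decayRate_anti hm hY h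
    have e2 : K * a₁ * C₀ ≤ a₁ * C₀ / decayRate κ m Y₀ * K * decayRate κ m Y := by
      rw [show a₁ * C₀ / decayRate κ m Y₀ * K * decayRate κ m Y =
        K * a₁ * C₀ * (decayRate κ m Y / decayRate κ m Y₀) by ring]
      refine le_mul_of_one_le_right (by positivity) ?_
      rwa [one_le_div hD]
    have e3 : 0 ≤ a₂ * C₀ * K * decayRate κ m Y := by positivity
    linarith

end Weight

end EulerLayer

end

/-! ### The equation and the growth of the sine coefficients of a solution. -/

noncomputable section

namespace EulerLayer

section Parametric

theorem hasDerivAt_integral_of_continuousOn {a b : ℝ} (hab : a ≤ b) {f f' : ℝ → ℝ → ℝ}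
    (hf : ∀ Y, 0 < Y → ContinuousOn (fun s => f s Y) (Icc a b))
    (hd : ∀ s ∈ Icc a b, ∀ Y, 0 < Y → HasDerivAt (f s) (f' s Y) Y)
    (hc : ContinuousOn (Function.uncurry f') (Icc a b ×ˢ Ioi 0)) {Y : ℝ} (hY : 0 < Y) :
    HasDerivAt (fun Y => ∫ s in a..b, f s Y) (∫ s in a..b, f' s Y) Y := by
  have hu : uIcc a b = Icc a b := uIcc_of_le hab
  have hI : ∀ s, s ∈ uIoc a b → s ∈ Icc a b := fun s hs => hu ▸ uIoc_subset_uIcc hs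
  have hK : IsCompact (Icc a b ×ˢ Icc (Y / 2) (2 * Y)) := isCompact_Icc.prod isCompact_Icc
  have hsub : Icc a b ×ˢ Icc (Y / 2) (2 * Y) ⊆ Icc a b ×ˢ Ioi 0 :=
    prod_mono subset_rfl fun t ht => lt_of_lt_of_le (half_pos hY) ht.1
  obtain ⟨C, hC⟩ := hK.exists_bound_of_continuousOn (hc.mono hsub)
  have hslice : ContinuousOn (fun s => f' s Y) (Icc a b) :=
    hc.comp (f := fun s => (s, Y)) (by fun_prop) fun s hs => ⟨hs, hY⟩
  have hint : ∀ Z, 0 < Z → IntervalIntegrable (fun s => f s Z) volume a b := fun Z hZ =>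
    ContinuousOn.intervalIntegrable (hu ▸ hf Z hZ)
  refine (intervalIntegral.hasDerivAt_integral_of_dominated_loc_of_deriv_le
    (F := fun Y s => f s Y) (F' := fun Y s => f' s Y) (bound := fun _ => C)
    (s := Icc (Y / 2) (2 * Y)) (Icc_mem_nhds (by linarith) (by linarith)) ?_ (hint Y hY) ?_ ?_
    intervalIntegrable_const ?_).2
  · filter_upwards [Ioi_mem_nhds hY] with Z hZ using (intervalIntegrable_iff.1 (hint Z hZ)).aestronglyMeasurable
  · exact (intervalIntegrable_iff.1
      (ContinuousOn.intervalIntegrable (hu ▸ hslice))).aestronglyMeasurable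
  · exact Filter.Eventually.of_forall fun s hs Z hZ => hC (s, Z) ⟨hI s hs, hZ⟩
  · exact Filter.Eventually.of_forall fun s hs Z hZ =>
      hd s (hI s hs) Z (lt_of_lt_of_le (half_pos hY) hZ.1)

/-- A second order equation which holds for all nonzero values of a parameter also holds in the
limit, if both sides are jointly continuous. -/
theorem exists_hasDerivAt_of_limit {Φ A : ℝ → ℝ → ℝ} (hΦ : Continuous (Function.uncurry Φ))
    (hA : Continuous (Function.uncurry A))
    (h : ∀ η, η ≠ 0 → ∃ Φ' : ℝ → ℝ, (∀ Y, 0 < Y → HasDerivAt (Φ η) (Φ' Y) Y) ∧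
      ∀ Y, 0 < Y → HasDerivAt Φ' (A η Y) Y) :
    ∃ Φ' : ℝ → ℝ, (∀ Y, 0 < Y → HasDerivAt (Φ 0) (Φ' Y) Y) ∧
      ∀ Y, 0 < Y → HasDerivAt Φ' (A 0 Y) Y := by
  -- `Z` is a double primitive of `A` in `Y`, so for `η ≠ 0` the difference `Φ - Z` is affine in
  -- `Y`.
  set P : ℝ → ℝ → ℝ := fun η t => ∫ τ in (1 : ℝ)..t, A η τ with hP
  have hPc : Continuous (Function.uncurry P) :=
    intervalIntegral.continuous_parametric_intervalIntegral_of_continuous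
      (f := fun (p : ℝ × ℝ) τ => A p.1 τ) (μ := volume)
      (hA.comp (f := fun q : (ℝ × ℝ) × ℝ => (q.1.1, q.2)) (by fun_prop)) continuous_snd
  set Z : ℝ → ℝ → ℝ := fun η Y => ∫ t in (1 : ℝ)..Y, P η t with hZ
  have hZc : Continuous (Function.uncurry Z) :=
    intervalIntegral.continuous_parametric_intervalIntegral_of_continuous
      (f := fun (p : ℝ × ℝ) τ => P p.1 τ) (μ := volume)
      (hPc.comp (f := fun q : (ℝ × ℝ) × ℝ => (q.1.1, q.2)) (by fun_prop)) continuous_snd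
  have hslice : ∀ {G : ℝ → ℝ → ℝ}, Continuous (Function.uncurry G) → ∀ η, Continuous (G η) :=
    fun hG η => hG.comp (f := fun t => (η, t)) (by fun_prop)
  have hslice' : ∀ {G : ℝ → ℝ → ℝ}, Continuous (Function.uncurry G) →
      ∀ Y, Continuous fun η => G η Y :=
    fun hG Y => hG.comp (f := fun t => (t, Y)) (by fun_prop)
  have hPd : ∀ η t, HasDerivAt (P η) (A η t) t := fun η t =>
    intervalIntegral.integral_hasDerivAt_right ((hslice hA η).intervalIntegrable _ _)
      ((hslice hA η).stronglyMeasurableAtFilter _ _) (hslice hA η).continuousAt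
  have hZd : ∀ η t, HasDerivAt (Z η) (P η t) t := fun η t =>
    intervalIntegral.integral_hasDerivAt_right ((hslice hPc η).intervalIntegrable _ _)
      ((hslice hPc η).stronglyMeasurableAtFilter _ _) (hslice hPc η).continuousAt
  have hconst : ∀ {g : ℝ → ℝ}, (∀ Y, 0 < Y → HasDerivAt g 0 Y) → ∀ Y, 0 < Y → g Y = g 1 := by
    intro g hg Y hY
    have := (convex_Ioi (0 : ℝ)).norm_image_sub_le_of_norm_hasDerivWithin_le (C := 0) (f := g)
      (f' := fun _ => 0) (fun z hz => (hg z hz).hasDerivWithinAt) (by simp)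
      (mem_Ioi.2 one_pos) (mem_Ioi.2 hY)
    simpa [sub_eq_zero] using this
  -- Affinity is recorded by interpolation from `Y = 1` and `Y = 2`: an identity free of
  -- derivatives, which survives the limit `η → 0` by continuity.
  have haff : ∀ η, η ≠ 0 → ∀ Y, 0 < Y →
      Φ η Y - Z η Y = (2 - Y) * (Φ η 1 - Z η 1) + (Y - 1) * (Φ η 2 - Z η 2) := by
    intro η hη
    obtain ⟨Φ', h1, h2⟩ := h η hη
    have e1 := hconst (g := fun Y => Φ' Y - P η Y) fun Y hY =>
      ((h2 Y hY).fun_sub (hPd η Y)).congr_deriv (sub_self _)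
    set d := Φ' 1 - P η 1
    have e2 := hconst (g := fun Y => Φ η Y - Z η Y - d * Y) fun Y hY =>
      (((h1 Y hY).fun_sub (hZd η Y)).fun_sub ((hasDerivAt_id' Y).const_mul d)).congr_deriv
        (by rw [e1 Y hY]; ring)
    intro Y hY
    have e3 := e2 Y hY
    have e4 := e2 2 two_pos
    linear_combination e3 - (Y - 1) * e4
  have haff0 : ∀ Y, 0 < Y →
      Φ 0 Y - Z 0 Y = (2 - Y) * (Φ 0 1 - Z 0 1) + (Y - 1) * (Φ 0 2 - Z 0 2) := by
    intro Y hY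
    have c1 := hslice' hΦ
    have c2 := hslice' hZc
    have := Continuous.ext_on (dense_compl_singleton (0 : ℝ))
      (f := fun η => Φ η Y - Z η Y)
      (g := fun η => (2 - Y) * (Φ η 1 - Z η 1) + (Y - 1) * (Φ η 2 - Z η 2))
      ((c1 Y).sub (c2 Y))
      ((continuous_const.mul ((c1 1).sub (c2 1))).add (continuous_const.mul ((c1 2).sub (c2 2))))
      fun η hη => haff η hη Y hY
    exact congrFun this 0
  set D := (Φ 0 2 - Z 0 2) - (Φ 0 1 - Z 0 1) with hD
  refine ⟨fun Y => P 0 Y + D, fun Y hY => ?_, fun Y _ => (hPd 0 Y).add_const D⟩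
  have : HasDerivAt (fun Y => Z 0 Y + ((2 - Y) * (Φ 0 1 - Z 0 1) + (Y - 1) * (Φ 0 2 - Z 0 2)))
      (P 0 Y + D) Y := by
    refine ((hZd 0 Y).fun_add ((((hasDerivAt_id' Y).const_sub 2).mul_const _).fun_add
      (((hasDerivAt_id' Y).sub_const 1).mul_const _))).congr_deriv ?_
    rw [hD]; ring
  refine this.congr_of_eventuallyEq ?_
  filter_upwards [Ioi_mem_nhds hY] with t ht
  linarith [haff0 t ht]

end Parametric

section Coefficient

variable {L : ℝ} {u : ℝ → ℝ} {F : ℝ → ℝ → ℝ} {V₀ VL vp : ℝ → ℝ} {v : ℝ → ℝ → ℝ}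

/-- Extension of a function on the closed strip, constant beyond the edges. -/
def extend (L : ℝ) (v : ℝ → ℝ → ℝ) (x Y : ℝ) : ℝ := v (max 0 (min x L)) (max Y 0)

theorem continuous_extend (hL : 0 < L) (hv : ContinuousOn (Function.uncurry v) (closedStrip L)) :
    Continuous (Function.uncurry (extend L v)) := by
  refine hv.comp_continuous (f := fun p : ℝ × ℝ => (max 0 (min p.1 L), max p.2 0)) (by fun_prop)
    fun p => ⟨⟨le_max_left _ _, max_le hL.le (min_le_right _ _)⟩,
      show 0 ≤ max p.2 0 from le_max_right _ _⟩

theorem extend_eq {x Y : ℝ} (hx : x ∈ Icc 0 L) (hY : 0 ≤ Y) : extend L v x Y = v x Y := by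
  rw [extend, min_eq_left hx.2, max_eq_right hx.1, max_eq_left hY]

theorem sineCoeff_congr {n : ℕ} (hL : 0 < L) {f g : ℝ → ℝ} (h : ∀ x ∈ Icc 0 L, f x = g x) :
    sineCoeff L n f = sineCoeff L n g := by
  refine intervalIntegral.integral_congr fun x hx => ?_
  rw [uIcc_of_le hL.le] at hx
  simp only [h x hx]

theorem continuous_sineCoeff {X : Type*} [TopologicalSpace X] [FirstCountableTopology X] {n : ℕ}
    {f : X → ℝ → ℝ} (hf : Continuous (Function.uncurry f)) :
    Continuous fun p => sineCoeff L n (f p) :=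
  intervalIntegral.continuous_parametric_intervalIntegral_of_continuous'
    (f := fun p x => f p x * Real.sin (freq L n * x)) (hf.mul (by fun_prop)) 0 L

theorem sineCoeff_one_rescale (hL : 0 < L) (n : ℕ) (f : ℝ → ℝ) :
    L * sineCoeff 1 n (fun s => f (L * s)) = sineCoeff L n f := by
  have h := intervalIntegral.mul_integral_comp_mul_left (a := 0) (b := 1)
    (f := fun x => f x * Real.sin (freq L n * x)) L
  rw [mul_zero, mul_one] at h
  rw [sineCoeff, sineCoeff, ← h]
  congr 2
  ext s
  congr 2
  simp only [freq]; field_simp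

/-- The sine coefficients of a solution satisfy the Fourier transformed equation. -/
theorem IsSolution.sineCoeff_ode (hL : 0 < L) (hu : IsShearFlow u)
    (hF : ContDiff ℝ ∞ (Function.uncurry F)) (hv : IsSolution L u F V₀ VL vp v) (n : ℕ) :
    ∃ c' : ℝ → ℝ, (∀ Y, 0 < Y → HasDerivAt (fun Y => sineCoeff L n fun x => v x Y) (c' Y) Y) ∧
      ∀ Y, 0 < Y → HasDerivAt c' ((freq L n ^ 2 + iteratedDeriv 2 u Y / u Y) *
        sineCoeff L n (fun x => v x Y) - sineCoeff L n (fun x => F x Y) / u Y -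
        freq L n * (V₀ Y - (-1) ^ (n + 1) * VL Y)) Y := by
  obtain ⟨c₀, C₀, hc₀, hb⟩ := hu.bounds
  have hupos : ∀ Y, 0 ≤ Y → u Y ≠ 0 := fun Y hY => (hc₀.trans_le (hb Y hY).1).ne'
  set w := extend L v with hw
  have hwc : Continuous (Function.uncurry w) := continuous_extend hL hv.continuousOn
  -- A solution need not be differentiable up to the sides, so integration by parts is done on a
  -- centred window of length `δ η`. The window is compactly inside `(0, L)` for `η ≠ 0` and is the
  -- full interval for `η = 0`; `c η` parametrises it by `[0, 1]`.
  set δ : ℝ → ℝ := fun η => L / (1 + η ^ 2) with hδ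
  have h1η : ∀ η : ℝ, 1 + η ^ 2 ≠ 0 := fun η => by positivity
  have hδc : Continuous δ := by
    simp only [hδ]; exact continuous_const.div (by fun_prop) h1η
  have hδpos : ∀ η, 0 < δ η := fun η => by simp only [hδ]; positivity
  set c : ℝ → ℝ → ℝ := fun η s => (L - δ η) / 2 + δ η * s with hc
  have hcc : Continuous (Function.uncurry c) := by
    have : Continuous fun p : ℝ × ℝ => δ p.1 := hδc.comp continuous_fst
    simp only [hc, Function.uncurry_def]; fun_prop
  set Φ : ℝ → ℝ → ℝ := fun η Y => δ η * sineCoeff 1 n fun s => w (c η s) Y with hΦ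
  set G : ℝ → ℝ → ℝ := fun η Y => δ η * sineCoeff 1 n fun s => F (c η s) Y with hG
  have hcoef : ∀ {g : ℝ → ℝ → ℝ}, Continuous (Function.uncurry g) →
      Continuous (Function.uncurry fun η Y => δ η * sineCoeff 1 n fun s => g (c η s) Y) := by
    intro g hg
    refine (hδc.comp continuous_fst).mul (continuous_sineCoeff
      (f := fun (p : ℝ × ℝ) s => g (c p.1 s) p.2) ?_)
    exact hg.comp (f := fun q : (ℝ × ℝ) × ℝ => (c q.1.1 q.2, q.1.2))
      ((hcc.comp (f := fun q : (ℝ × ℝ) × ℝ => (q.1.1, q.2)) (by fun_prop)).prodMk (by fun_prop))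
  -- `u` is known to be nonzero only for `Y ≥ 0`; clamping the denominator makes `A` continuous on
  -- the whole plane.
  set q : ℝ → ℝ := fun Y => iteratedDeriv 2 u Y / u (max Y 0) with hq
  set A : ℝ → ℝ → ℝ := fun η Y => ((freq 1 n / δ η) ^ 2 + q Y) * Φ η Y - G η Y / u (max Y 0) -
    (freq 1 n / δ η) * (w (c η 0) Y - (-1) ^ (n + 1) * w (c η 1) Y) with hA
  have hAc : Continuous (Function.uncurry A) := by
    have hum : Continuous fun p : ℝ × ℝ => u (max p.2 0) :=
      hu.smooth.continuous.comp (by fun_prop)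
    have hu2 : Continuous fun p : ℝ × ℝ => iteratedDeriv 2 u p.2 :=
      (continuous_iff_continuousAt.2 fun Y => (hu.hasDerivAt 2 Y).continuousAt).comp continuous_snd
    have hfr : Continuous fun p : ℝ × ℝ => freq 1 n / δ p.1 :=
      continuous_const.div (hδc.comp continuous_fst) fun p => (hδpos _).ne'
    have hwe : ∀ s : ℝ, Continuous fun p : ℝ × ℝ => w (c p.1 s) p.2 := fun s =>
      hwc.comp (f := fun p : ℝ × ℝ => (c p.1 s, p.2))
        ((hcc.comp (f := fun p : ℝ × ℝ => (p.1, s)) (by fun_prop)).prodMk continuous_snd)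
    have hne : ∀ p : ℝ × ℝ, u (max p.2 0) ≠ 0 := fun p => hupos _ (le_max_right _ _)
    exact ((((hfr.pow 2).add (hu2.div hum hne)).mul (hcoef hwc)).sub
      ((hcoef hF.continuous).div hum hne)).sub
      (hfr.mul ((hwe 0).sub (continuous_const.mul (hwe 1))))
  have hlim := exists_hasDerivAt_of_limit (Φ := Φ) (A := A) (hcoef hwc) hAc ?_
  · obtain ⟨Φ', h1, h2⟩ := hlim
    have hδ0 : δ 0 = L := by simp [hδ]
    have hc0 : ∀ s, c 0 s = L * s := fun s => by simp [hc, hδ0]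
    have eΦ : ∀ Y, 0 ≤ Y → Φ 0 Y = sineCoeff L n fun x => v x Y := by
      intro Y hY
      simp only [hΦ, hδ0, hc0]
      rw [sineCoeff_one_rescale hL n (fun x => w x Y)]
      exact sineCoeff_congr hL fun x hx => extend_eq hx hY
    refine ⟨Φ', fun Y hY => (h1 Y hY).congr_of_eventuallyEq ?_, fun Y hY =>
      (h2 Y hY).congr_deriv ?_⟩
    · filter_upwards [Ioi_mem_nhds hY] with t ht using (eΦ t (le_of_lt ht)).symm
    · have e1 : freq 1 n / L = freq L n := by simp [freq]
      have e2 : G 0 Y = sineCoeff L n fun x => F x Y := by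
        simp only [hG, hδ0, hc0]
        exact sineCoeff_one_rescale hL n (fun x => F x Y)
      simp only [hA, eΦ Y hY.le, hδ0, e1, e2, hq, max_eq_left hY.le, hc0, mul_zero, mul_one]
      rw [hw, extend_eq ⟨le_rfl, hL.le⟩ hY.le, extend_eq ⟨hL.le, le_rfl⟩ hY.le, hv.left Y hY.le,
        hv.right Y hY.le]
  · intro η hη
    have hδL : δ η < L := by
      simp only [hδ]
      rw [div_lt_iff₀ (by positivity)]
      have : 0 < η ^ 2 := by positivity
      nlinarith
    have hd := hδpos η
    have hmem : ∀ s ∈ Icc (0 : ℝ) 1, c η s ∈ Ioo 0 L := by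
      intro s hs
      simp only [hc]
      constructor <;> nlinarith [hs.1, hs.2]
    have hO := isOpen_strip L
    have hvX := contDiffOn_dX (m := 1) hO hv.contDiffOn (by norm_num)
    have hvY := contDiffOn_dY (m := 1) hO hv.contDiffOn (by norm_num)
    have hvXX := contDiffOn_dX (m := 0) hO hvX (by norm_num)
    have hvYY := contDiffOn_dY (m := 0) hO hvY (by norm_num)
    have hcη : Continuous (c η) := by simp only [hc]; fun_prop
    have hpar : ∀ {g : ℝ → ℝ → ℝ}, ContinuousOn (Function.uncurry g) (strip L) →
        ContinuousOn (Function.uncurry fun s Y => g (c η s) Y * Real.sin (freq 1 n * s))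
          (Icc 0 1 ×ˢ Ioi 0) := by
      intro g hg
      refine ContinuousOn.mul (hg.comp (f := fun p : ℝ × ℝ => (c η p.1, p.2)) ?_
        fun p hp => ⟨hmem _ hp.1, hp.2⟩) (by fun_prop)
      exact ((hcη.comp continuous_fst).prodMk continuous_snd).continuousOn
    have hparY : ∀ {g : ℝ → ℝ → ℝ}, ContinuousOn (Function.uncurry g) (strip L) → ∀ Y, 0 < Y →
        ContinuousOn (fun s => g (c η s) Y * Real.sin (freq 1 n * s)) (Icc 0 1) := fun hg Y hY =>
      (hpar hg).comp (f := fun s => (s, Y)) (by fun_prop) fun s hs => ⟨hs, hY⟩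
    have hIntg : ∀ {g : ℝ → ℝ → ℝ}, ContinuousOn (Function.uncurry g) (strip L) → ∀ Y, 0 < Y →
        IntervalIntegrable (fun s => g (c η s) Y * Real.sin (freq 1 n * s)) volume 0 1 :=
      fun hg Y hY => ContinuousOn.intervalIntegrable
        (by rw [uIcc_of_le zero_le_one]; exact hparY hg Y hY)
    have hwv : ∀ s ∈ Icc (0 : ℝ) 1, ∀ Y, 0 < Y → w (c η s) Y = v (c η s) Y := fun s hs Y hY =>
      extend_eq (Ioo_subset_Icc_self (hmem s hs)) hY.le
    have hΦv : ∀ Y, 0 < Y → Φ η Y = δ η * sineCoeff 1 n fun s => v (c η s) Y := fun Y hY => by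
      simp only [hΦ]
      rw [sineCoeff_congr one_pos fun s hs => hwv s hs Y hY]
    refine ⟨fun Y => δ η * sineCoeff 1 n fun s => dY v (c η s) Y, fun Y hY => ?_, fun Y hY => ?_⟩
    · have h := (hasDerivAt_integral_of_continuousOn zero_le_one
        (fun Y hY => hparY hv.contDiffOn.continuousOn Y hY)
        (fun s hs Y hY => (hasDerivAt_dY hO hv.contDiffOn (by norm_num)
          ⟨hmem s hs, hY⟩).mul_const (Real.sin (freq 1 n * s)))
        (hpar hvY.continuousOn) hY).const_mul (δ η)
      refine h.congr_of_eventuallyEq ?_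
      filter_upwards [Ioi_mem_nhds hY] with t ht using hΦv t ht
    · have h := (hasDerivAt_integral_of_continuousOn zero_le_one
        (fun Y hY => hparY hvY.continuousOn Y hY)
        (fun s hs Y hY => (hasDerivAt_dY hO hvY (by norm_num)
          ⟨hmem s hs, hY⟩).mul_const (Real.sin (freq 1 n * s)))
        (hpar hvYY.continuousOn) hY).const_mul (δ η)
      refine h.congr_deriv ?_
      have hcd : ∀ s, HasDerivAt (c η) (δ η) s := fun s => by
        simpa [hc] using ((hasDerivAt_id s).const_mul (δ η)).const_add ((L - δ η) / 2)
      have hibp := sineCoeff_deriv_two n one_pos (f := fun s => v (c η s) Y)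
        (f' := fun s => dX v (c η s) Y * δ η) (f'' := fun s => dX (dX v) (c η s) Y * δ η * δ η)
        (fun s hs => HasDerivAt.comp (h₂ := fun x => v x Y) s
          (hasDerivAt_dX hO hv.contDiffOn (by norm_num) ⟨hmem s hs, hY⟩) (hcd s))
        (fun s hs => (HasDerivAt.comp (h₂ := fun x => dX v x Y) s
          (hasDerivAt_dX hO hvX (by norm_num) ⟨hmem s hs, hY⟩) (hcd s)).mul_const (δ η))
        (((hvXX.continuousOn.comp (f := fun s => (c η s, Y)) (by fun_prop)
          fun s hs => ⟨hmem s hs, hY⟩).mul continuousOn_const).mul continuousOn_const)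
      have hXX : sineCoeff 1 n (fun s => dX (dX v) (c η s) Y * δ η * δ η) =
          δ η ^ 2 * sineCoeff 1 n (fun s => dX (dX v) (c η s) Y) := by
        simp only [sineCoeff]
        rw [← intervalIntegral.integral_const_mul]
        congr 1; ext s; ring
      have hpde : sineCoeff 1 n (fun s => dY (dY v) (c η s) Y) =
          -sineCoeff 1 n (fun s => dX (dX v) (c η s) Y) +
            iteratedDeriv 2 u Y / u Y * sineCoeff 1 n (fun s => v (c η s) Y) -
            sineCoeff 1 n (fun s => F (c η s) Y) / u Y := by
        have i1 : IntervalIntegrable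
            (fun s => -(dX (dX v) (c η s) Y * Real.sin (freq 1 n * s))) volume 0 1 :=
          (hIntg hvXX.continuousOn Y hY).neg
        have i2 := (hIntg hv.contDiffOn.continuousOn Y hY).const_mul (iteratedDeriv 2 u Y / u Y)
        simp only [sineCoeff]
        rw [← intervalIntegral.integral_neg, ← intervalIntegral.integral_const_mul,
          ← intervalIntegral.integral_div, ← intervalIntegral.integral_add i1 i2,
          ← intervalIntegral.integral_sub (i1.add i2) ((hIntg hF.continuous.continuousOn Y hY).div_const _)]
        refine intervalIntegral.integral_congr fun s hs => ?_
        rw [uIcc_of_le zero_le_one] at hs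
        have e := hv.equation (c η s) (hmem s hs) Y hY
        have hl : lap v (c η s) Y = dX (dX v) (c η s) Y + dY (dY v) (c η s) Y := rfl
        rw [hl] at e
        have := hupos Y hY.le
        rw [← e]
        field_simp
        ring
      have hw0 := hwv 0 ⟨le_rfl, zero_le_one⟩ Y hY
      have hw1 := hwv 1 ⟨zero_le_one, le_rfl⟩ Y hY
      rw [hXX] at hibp
      have hXX' : sineCoeff 1 n (fun s => dX (dX v) (c η s) Y) =
          (freq 1 n * (v (c η 0) Y - (-1) ^ (n + 1) * v (c η 1) Y) -
            freq 1 n ^ 2 * sineCoeff 1 n fun s => v (c η s) Y) / δ η ^ 2 := by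
        rw [← hibp]; field_simp
      change δ η * sineCoeff 1 n (fun s => dY (dY v) (c η s) Y) = A η Y
      simp only [hA, hq, hG, max_eq_left hY.le, hΦv Y hY, hw0, hw1]
      rw [hpde, hXX']
      have := hupos Y hY.le
      field_simp
      ring

/-- A bounded perturbation only shifts the base point of the line, by `M / c`. -/
theorem Sublinear.sub_bounded {f g : ℝ → ℝ} (hf : Sublinear f) {M : ℝ}
    (hg : ∀ Y, 0 ≤ Y → |g Y| ≤ M) : Sublinear fun Y => f Y - g Y := by
  rintro ⟨c, hc, Y₁, h⟩
  have hM : 0 ≤ M := (abs_nonneg _).trans (hg 0 le_rfl)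
  refine hf ⟨c, hc, max Y₁ 0 + M / c, fun Y hY => ?_⟩
  have h0 : 0 ≤ M / c := by positivity
  have h1 : Y₁ ≤ Y := by linarith [le_max_left Y₁ 0]
  have h2 : 0 ≤ Y := by linarith [le_max_right Y₁ 0]
  have h3 : |f Y - g Y| ≤ |f Y| + |g Y| := abs_sub _ _
  have h4 : c * (Y - (max Y₁ 0 + M / c)) ≤ c * (Y - Y₁) - M := by
    have : c * (M / c) = M := by field_simp
    nlinarith [le_max_left Y₁ 0]
  linarith [h Y h1, hg Y h2]

/-- Linear growth of the coefficient would keep `∫ (v/(1+Y))² dx` above a positive constant for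
large `Y`, contradicting integrability over the half-line. -/
theorem IsSolution.sublinear_sineCoeff (hL : 0 < L) (hv : IsSolution L u F V₀ VL vp v) (n : ℕ) :
    Sublinear fun Y => sineCoeff L n fun x => v x Y := by
  rintro ⟨c, hc, Y₁, h⟩
  have hint := hv.growth.integrable_sq
  have hvol : (volume : Measure (ℝ × ℝ)).restrict (strip L) =
      (volume.restrict (Ioo 0 L)).prod (volume.restrict (Ioi 0)) := by
    rw [strip, Measure.prod_restrict]; rfl
  rw [hvol] at hint
  have hI := hint.integral_prod_right
  -- Beyond `2 Y₁ + 1` one has `Y - Y₁ ≥ (1 + Y)/2`.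
  set Y₂ := max 1 (2 * Y₁ + 1) with hY₂
  have hlow : ∀ Y, Y₂ ≤ Y → c ^ 2 / (4 * L) ≤ ∫ x in Ioo 0 L, (v x Y / (1 + Y)) ^ 2 := by
    intro Y hY
    have hY1 : 1 ≤ Y := (le_max_left _ _).trans hY
    have hY2 : 2 * Y₁ + 1 ≤ Y := (le_max_right _ _).trans hY
    have hcont : ContinuousOn (fun x => v x Y) (Icc 0 L) :=
      hv.continuousOn.comp (f := fun x => (x, Y)) (by fun_prop) fun x hx =>
        ⟨hx, show 0 ≤ Y by linarith⟩
    have hII : ∀ {g : ℝ → ℝ}, ContinuousOn g (Icc 0 L) → IntervalIntegrable g volume 0 L :=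
      fun hg => ContinuousOn.intervalIntegrable (by rwa [uIcc_of_le hL.le])
    have hg1 : ContinuousOn (fun x => v x Y / (1 + Y)) (Icc 0 L) := hcont.div_const _
    have h1 : c / 2 * (1 + Y) ≤ |sineCoeff L n fun x => v x Y| := by
      refine le_trans ?_ (h Y (by linarith))
      nlinarith
    -- Young's inequality `|g| ≤ c/(4L) + (L/c) g²`: the constant integrates to `c/4`, half of the
    -- lower bound `c/2`, and the rest bounds the square integral below by `c²/(4L)`.
    have h2 : |sineCoeff L n fun x => v x Y| ≤
        ∫ x in (0 : ℝ)..L, (1 + Y) * (c / (4 * L) + L / c * (v x Y / (1 + Y)) ^ 2) := by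
      refine (intervalIntegral.abs_integral_le_integral_abs hL.le).trans
        (intervalIntegral.integral_mono_on hL.le
          (hII ((hcont.mul (by fun_prop)).abs))
          (hII (continuousOn_const.mul (continuousOn_const.add
            (continuousOn_const.mul (hg1.pow 2))))) fun x _ => ?_)
      rw [abs_mul]
      have e1 : |v x Y| = (1 + Y) * |v x Y / (1 + Y)| := by
        rw [abs_div, abs_of_pos (show 0 < 1 + Y by linarith)]; field_simp
      calc |v x Y| * |Real.sin (freq L n * x)| ≤ |v x Y| * 1 :=
            mul_le_mul_of_nonneg_left (Real.abs_sin_le_one _) (abs_nonneg _)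
        _ = (1 + Y) * |v x Y / (1 + Y)| := by rw [mul_one, e1]
        _ ≤ _ := by
          refine mul_le_mul_of_nonneg_left ?_ (by linarith)
          set g := v x Y / (1 + Y)
          rw [← sq_abs g]
          have : c / (4 * L) + L / c * |g| ^ 2 - |g| = (c - 2 * L * |g|) ^ 2 / (4 * L * c) := by
            field_simp; ring
          have h0 : 0 ≤ (c - 2 * L * |g|) ^ 2 / (4 * L * c) := by positivity
          linarith
    have i1 : IntervalIntegrable (fun x => L / c * (v x Y / (1 + Y)) ^ 2) volume 0 L :=
      hII (continuousOn_const.mul (hg1.pow 2))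
    rw [intervalIntegral.integral_const_mul, intervalIntegral.integral_add
      intervalIntegrable_const i1,
      intervalIntegral.integral_const_mul, intervalIntegral.integral_const, smul_eq_mul,
      sub_zero] at h2
    rw [← integral_Ioc_eq_integral_Ioo, ← intervalIntegral.integral_of_le hL.le]
    set I := ∫ x in (0 : ℝ)..L, (v x Y / (1 + Y)) ^ 2
    have h3 := h1.trans h2
    rw [mul_comm (c / 2)] at h3
    have h4 := le_of_mul_le_mul_left h3 (by linarith)
    have e : L * (c / (4 * L)) = c / 4 := by field_simp
    rw [e] at h4
    have h5 : c / 4 ≤ L / c * I := by linarith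
    rw [div_mul_eq_mul_div, le_div_iff₀ hc] at h5
    rw [div_le_iff₀ (by positivity)]
    linarith
  have hpos : 0 < c ^ 2 / (4 * L) := by positivity
  have hconst : IntegrableOn (fun _ : ℝ => c ^ 2 / (4 * L)) (Ioi Y₂) := by
    have hI' : IntegrableOn (fun Y => ∫ x in Ioo 0 L, (v x Y / (1 + Y)) ^ 2) (Ioi Y₂) :=
      IntegrableOn.mono_set (t := Ioi 0) hI
        (Ioi_subset_Ioi (zero_le_one.trans (le_max_left _ _)))
    refine Integrable.mono' hI' aestronglyMeasurable_const ?_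
    filter_upwards [ae_restrict_mem measurableSet_Ioi] with Y hY
    rw [Real.norm_of_nonneg hpos.le]
    exact hlow Y (le_of_lt hY)
  rw [integrableOn_const_iff] at hconst
  simp [hpos.ne'] at hconst

end Coefficient

end EulerLayer

end

/-! ### Weighted regularity of the data, and sine series. -/

noncomputable section

namespace EulerLayer

section Data

variable {ι : Type*} {κ : WeightKind} {L m : ℝ} {u : ℝ → ℝ} {F : ℝ → ℝ → ℝ} {K : ℕ}

theorem le_mul_decayRate {a C Y : ℝ} (hY : 0 ≤ Y) (h : a * weight κ m Y ≤ C) :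
    a ≤ C * decayRate κ m Y := by
  rw [decayRate, ← div_eq_mul_inv, le_div_iff₀ (weight_pos hY)]
  exact h

theorem IsShearFlow.reg (hu : IsShearFlow u) (j : ℕ) :
    Reg L (fun _ _ => 1) K (fun (_ : ι) _ Y => iteratedDeriv j u Y) := by
  refine Reg.of_iterate (h := fun _ j Y => iteratedDeriv j u Y)
    (fun _ j Y _ => hu.hasDerivAt j Y) (fun j => ?_) j
  rcases Nat.eq_zero_or_pos j with rfl | hj
  · obtain ⟨c₀, C₀, hc₀, hb⟩ := hu.bounds
    refine ⟨C₀, fun _ Y hY => ?_⟩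
    have h := hb Y hY.le
    rw [iteratedDeriv_zero, abs_of_pos (hc₀.trans_le h.1), mul_one]
    exact h.2
  · obtain ⟨C, hC⟩ := hu.decay j hj 0
    exact ⟨C, fun _ Y hY => by simpa using hC Y hY.le⟩

theorem IsShearFlow.reg_inv (hu : IsShearFlow u) :
    Reg L (fun _ _ => 1) K (fun (_ : ι) _ Y => (u Y)⁻¹) := by
  obtain ⟨c₀, C₀, hc₀, hb⟩ := hu.bounds
  exact Reg.inv hc₀ (fun _ Y hY => (hb Y hY.le).1) (by simpa using hu.reg (ι := ι) (L := L) (K := K) 0)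

theorem IsShearFlow.reg_potential (hu : IsShearFlow u) :
    Reg L (fun _ _ => 1) K (fun (_ : ι) _ Y => iteratedDeriv 2 u Y / u Y) := by
  simpa [div_eq_mul_inv] using (hu.reg (ι := ι) (L := L) (K := K) 2).mul hu.reg_inv

theorem SideDecay.reg {V : ℝ → ℝ} {m₀ : ℝ} (hV : SideDecay κ m₀ V) (hm : m ≤ m₀) :
    Reg L (fun _ => decayRate κ m) K (fun (_ : ι) _ Y => V Y) := by
  have h := Reg.of_iterate (ι := ι) (L := L) (K := K) (W := fun _ => decayRate κ m)
    (h := fun _ j Y => iteratedDeriv j V Y) (fun _ j Y _ => by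
      rw [iteratedDeriv_succ]
      exact ((hV.smooth.differentiable_iteratedDeriv j
        (WithTop.coe_lt_coe.2 (ENat.natCast_lt_top j))) Y).hasDerivAt) (fun j => ?_) 0
  · simpa using h
  · obtain ⟨C, hC⟩ := hV.decay j
    exact ⟨C, fun _ Y hY => le_mul_decayRate hY.le ((mul_le_mul_of_nonneg_left
      (weight_le_weight hm hY.le) (abs_nonneg _)).trans (hC Y hY.le))⟩

theorem ForcingDecay.bound {l : ℝ} (hF : ForcingDecay κ L l F) (hm : m ≤ l) (a b : ℕ) :
    ∃ C, ∀ x ∈ Icc 0 L, ∀ Y, 0 ≤ Y → |partialD a b F x Y| ≤ C * decayRate κ m Y := by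
  obtain ⟨C, hC⟩ := hF.decay a b
  exact ⟨C, fun x hx Y hY => le_mul_decayRate hY ((mul_le_mul_of_nonneg_left
    (weight_le_weight hm hY) (abs_nonneg _)).trans (hC x hx Y hY))⟩

theorem ForcingDecay.reg_trace {l : ℝ} (hF : ForcingDecay κ L l F) (hm : m ≤ l) {x₀ : ℝ}
    (hx₀ : x₀ ∈ Icc 0 L) (a : ℕ) :
    Reg L (fun _ => decayRate κ m) K (fun (_ : ι) _ Y => partialD a 0 F x₀ Y) := by
  refine Reg.of_iterate (h := fun _ j Y => partialD a j F x₀ Y)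
    (fun _ j Y _ => hasDerivAt_partialD_y hF.smooth a j x₀ Y) (fun j => ?_) 0
  obtain ⟨C, hC⟩ := hF.bound hm a j
  exact ⟨C, fun _ Y hY => hC x₀ hx₀ Y hY.le⟩

theorem abs_sineCoeff_le (hL : 0 < L) (n : ℕ) {f : ℝ → ℝ} {C : ℝ}
    (hf : ∀ x ∈ Icc 0 L, |f x| ≤ C) : |sineCoeff L n f| ≤ L * C := by
  have h := intervalIntegral.norm_integral_le_of_norm_le_const (a := 0) (b := L) (C := C)
    (f := fun x => f x * Real.sin (freq L n * x)) fun x hx => by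
      rw [uIoc_of_le hL.le] at hx
      rw [norm_mul]
      have h1 := hf x (Ioc_subset_Icc_self hx)
      calc ‖f x‖ * ‖Real.sin (freq L n * x)‖ ≤ ‖f x‖ * 1 :=
            mul_le_mul_of_nonneg_left (Real.abs_sin_le_one _) (norm_nonneg _)
        _ ≤ C := by simpa using h1
  rw [sub_zero, abs_of_pos hL, mul_comm] at h
  exact h

theorem ForcingDecay.reg_sineCoeff {l : ℝ} (hL : 0 < L) (hF : ForcingDecay κ L l F) (hm : m ≤ l)
    (a : ℕ) : Reg L (fun _ => decayRate κ m) K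
      (fun (n : ℕ) _ Y => sineCoeff L n fun x => partialD a 0 F x Y) := by
  refine Reg.of_iterate (h := fun n j Y => sineCoeff L n fun x => partialD a j F x Y)
    (fun n j Y hY => ?_) (fun j => ?_) 0
  · have hc : ∀ j, Continuous (Function.uncurry (partialD a j F)) := fun j =>
      (contDiff_partialD hF.smooth a j).continuous
    refine hasDerivAt_integral_of_continuousOn hL.le (fun Y _ => ?_)
      (fun x _ Y _ => (hasDerivAt_partialD_y hF.smooth a j x Y).mul_const _) ?_ hY
    · exact (((hc j).comp (f := fun x => (x, Y)) (by fun_prop)).mul (by fun_prop)).continuousOn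
    · exact ((hc (j + 1)).mul (by fun_prop)).continuousOn
  · obtain ⟨C, hC⟩ := hF.bound hm a j
    refine ⟨L * C, fun n Y hY => ?_⟩
    rw [mul_assoc]
    exact abs_sineCoeff_le hL n fun x hx => hC x hx Y hY.le

theorem sideTrace_reg {V : ℝ → ℝ} {m₀ l x₀ : ℝ} (hu : IsShearFlow u) (hF : ForcingDecay κ L l F)
    (hV : SideDecay κ m₀ V) (hm : m ≤ m₀) (hl : m ≤ l) (hx₀ : x₀ ∈ Icc 0 L) (j : ℕ) :
    Reg L (fun _ => decayRate κ m) K (fun (_ : ι) _ Y => sideTrace u F x₀ V j Y) := by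
  induction j generalizing K with
  | zero => exact hV.reg hm
  | succ j ih =>
    have h2 : Reg L (fun _ => decayRate κ m) K
        (fun (_ : ι) _ Y => iteratedDeriv 2 (sideTrace u F x₀ V j) Y) := by
      -- The projections select `dY` twice; the induction hypothesis is available to every order, so
      -- two can be spent.
      have h := (ih (K := K + 2)).2.2.2.2.2.2
      simp only [iteratedDeriv_succ, iteratedDeriv_zero]
      exact h
    have hq : Reg L (fun _ => decayRate κ m) K
        (fun (_ : ι) _ Y => iteratedDeriv 2 u Y / u Y * sideTrace u F x₀ V j Y) := by
      simpa using hu.reg_potential.mul (ih (K := K))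
    have hF' : Reg L (fun _ => decayRate κ m) K
        (fun (_ : ι) _ Y => partialD (2 * j) 0 F x₀ Y / u Y) := by
      simpa [div_eq_mul_inv] using (hF.reg_trace hl hx₀ (2 * j)).mul (hu.reg_inv (ι := ι))
    exact (h2.neg.add hq).sub hF'

/-- For a shear flow the set is an open neighbourhood of `[0, ∞)`, so the two-sided derivatives in
the recursion are genuine also at `Y = 0`, where the corner conditions are read. -/
theorem contDiffOn_sideTrace {V : ℝ → ℝ} {x₀ : ℝ} (hu : ContDiff ℝ ∞ u)
    (hF : ContDiff ℝ ∞ (Function.uncurry F)) (hV : ContDiff ℝ ∞ V) (j : ℕ) :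
    ContDiffOn ℝ ∞ (sideTrace u F x₀ V j) {Y | u Y ≠ 0} := by
  have hO : IsOpen {Y | u Y ≠ 0} := isOpen_ne_fun hu.continuous continuous_const
  have hd : ∀ {f : ℝ → ℝ}, ContDiffOn ℝ ∞ f {Y | u Y ≠ 0} →
      ContDiffOn ℝ ∞ (iteratedDeriv 2 f) {Y | u Y ≠ 0} := fun hf => by
    simp only [iteratedDeriv_succ, iteratedDeriv_zero]
    exact (hf.deriv_of_isOpen (m := ∞) hO (by simp)).deriv_of_isOpen hO (by simp)
  induction j with
  | zero => exact hV.contDiffOn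
  | succ j ih =>
    have hF' : ContDiff ℝ ∞ fun Y => partialD (2 * j) 0 F x₀ Y :=
      (contDiff_partialD hF (2 * j) 0).comp (f := fun Y => (x₀, Y)) (by fun_prop)
    exact ((hd ih).neg.add (((hd hu.contDiffOn).div hu.contDiffOn fun Y hY => hY).mul ih)).sub
      (hF'.contDiffOn.div hu.contDiffOn fun Y hY => hY)

theorem IsShearFlow.continuousOn_sideTrace {V : ℝ → ℝ} {x₀ : ℝ} (hu : IsShearFlow u)
    (hF : ContDiff ℝ ∞ (Function.uncurry F)) (hV : ContDiff ℝ ∞ V) (j : ℕ) :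
    ContinuousOn (sideTrace u F x₀ V j) (Ici 0) := by
  obtain ⟨c₀, C₀, hc₀, hb⟩ := hu.bounds
  exact (contDiffOn_sideTrace hu.smooth hF hV j).continuousOn.mono fun Y hY =>
    (hc₀.trans_le (hb Y hY).1).ne'

theorem reg_of_contDiff_fst {p : ℝ → ℝ} (hp : ContDiff ℝ ∞ p) :
    Reg L (fun _ _ => 1) K (fun (_ : ι) x _ => p x) := by
  induction K generalizing p with
  | zero =>
    obtain ⟨C, hC⟩ := (isCompact_Icc (a := (0 : ℝ)) (b := L)).exists_bound_of_continuousOn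
      hp.continuous.continuousOn
    exact ⟨C, fun _ x hx Y _ => by simpa using hC x (Ioo_subset_Icc_self hx)⟩
  | succ K ih =>
    have hp' := (contDiff_infty_iff_deriv.1 hp)
    obtain ⟨C, hC⟩ := (isCompact_Icc (a := (0 : ℝ)) (b := L)).exists_bound_of_continuousOn
      hp.continuous.continuousOn
    exact Reg.mk_succ (fx := fun _ x _ => deriv p x) (fy := fun _ _ _ => 0)
      ⟨C, fun _ x hx Y _ => by simpa using hC x (Ioo_subset_Icc_self hx)⟩
      (fun _ x _ Y _ => (hp'.1 x).hasDerivAt) (fun _ x _ Y _ => hasDerivAt_const _ _)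
      (ih hp'.2) (Reg.index (c := fun _ => 0) ⟨0, fun _ _ _ => by simp⟩)

/-- Derivatives of the weight are bounded by multiples of the weight itself: powers of `m` appear in
the exponential case, falling factorials and lower powers of `1 + Y` in the polynomial case. -/
theorem reg_weight (m : ℝ) :
    Reg L (fun _ => weight κ m) K (fun (_ : ι) _ Y => weight κ m Y) := by
  cases κ with
  | exponential =>
    have h := Reg.of_iterate (ι := ι) (L := L) (K := K) (W := fun _ => weight .exponential m)
      (h := fun _ j Y => m ^ j * Real.exp (m * Y)) (fun _ j Y _ => by
        have h1 : HasDerivAt (fun Y => Real.exp (m * Y)) (Real.exp (m * Y) * m) Y := by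
          simpa using ((hasDerivAt_id Y).const_mul m).exp
        exact (h1.const_mul (m ^ j)).congr_deriv (by ring))
      (fun j => ⟨|m ^ j|, fun _ Y _ => by simp [weight, abs_mul]⟩) 0
    simpa [weight] using h
  | polynomial =>
    have h := Reg.of_iterate (ι := ι) (L := L) (K := K) (W := fun _ => weight .polynomial m)
      (h := fun _ j Y => (∏ i ∈ Finset.range j, (m - i)) * (1 + Y) ^ (m - j)) (fun _ j Y hY => by
        have h1 : HasDerivAt (fun Y => (1 + Y) ^ (m - j)) ((m - j) * (1 + Y) ^ (m - j - 1)) Y := by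
          simpa using ((hasDerivAt_id Y).const_add 1).rpow_const (p := m - j)
            (Or.inl (by simp; linarith))
        refine (h1.const_mul _).congr_deriv ?_
        rw [Finset.prod_range_succ, Nat.cast_succ, sub_sub]; ring)
      (fun j => ⟨|∏ i ∈ Finset.range j, (m - i)|, fun _ Y hY => by
        rw [abs_mul]
        refine mul_le_mul_of_nonneg_left ?_ (abs_nonneg _)
        rw [abs_of_pos (Real.rpow_pos_of_pos (by linarith) _)]
        exact Real.rpow_le_rpow_of_exponent_le (by linarith) (by simp)⟩) 0
    simpa [weight] using h

end Data

section Series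

variable {σ : Type*} {L : ℝ} {ρ : ℝ → ℝ} {K : ℕ}

/-- The weight `(n + 1)^{-M} ρ(Y)` for the `n`-th mode. -/
def modeRate (ρ : ℝ → ℝ) (M n : ℕ) (Y : ℝ) : ℝ := (((n : ℝ) + 1) ^ M)⁻¹ * ρ Y

theorem modeRate_nonneg (hρ : ∀ Y, 0 < Y → 0 ≤ ρ Y) (M n : ℕ) {Y : ℝ} (hY : 0 < Y) :
    0 ≤ modeRate ρ M n Y := mul_nonneg (by positivity) (hρ Y hY)

theorem inv_pow_le_inv_pow {M p : ℕ} (h : M ≤ p) (n : ℕ) :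
    (((n : ℝ) + 1) ^ p)⁻¹ ≤ (((n : ℝ) + 1) ^ M)⁻¹ :=
  inv_anti₀ (by positivity) (pow_le_pow_right₀ (by linarith [(Nat.cast_nonneg n : (0 : ℝ) ≤ n)]) h)

theorem modeRate_anti (hρ : ∀ Y, 0 < Y → 0 ≤ ρ Y) {M p : ℕ} (h : M ≤ p) (n : ℕ) {Y : ℝ}
    (hY : 0 < Y) : modeRate ρ p n Y ≤ modeRate ρ M n Y :=
  mul_le_mul_of_nonneg_right (inv_pow_le_inv_pow h n) (hρ Y hY)

theorem freq_eq (L : ℝ) (n : ℕ) : freq L n = Real.pi / L * ((n : ℝ) + 1) := by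
  unfold freq; ring

theorem freq_pow_inv_le (hL : 0 < L) {M p : ℕ} (h : M ≤ p) (n : ℕ) :
    (freq L n ^ p)⁻¹ ≤ ((Real.pi / L) ^ p)⁻¹ * (((n : ℝ) + 1) ^ M)⁻¹ := by
  rw [freq_eq, mul_pow, mul_inv]
  exact mul_le_mul_of_nonneg_left (inv_pow_le_inv_pow h n) (by positivity)

theorem freq_pow_mul_inv_le (hL : 0 < L) {a M p : ℕ} (h : M + a ≤ p) (n : ℕ) :
    freq L n ^ a * (((n : ℝ) + 1) ^ p)⁻¹ ≤ (Real.pi / L) ^ a * (((n : ℝ) + 1) ^ M)⁻¹ := by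
  rw [freq_eq, mul_pow, mul_assoc]
  refine mul_le_mul_of_nonneg_left ?_ (by positivity)
  calc ((n : ℝ) + 1) ^ a * (((n : ℝ) + 1) ^ p)⁻¹
      ≤ ((n : ℝ) + 1) ^ a * (((n : ℝ) + 1) ^ (M + a))⁻¹ :=
        mul_le_mul_of_nonneg_left (inv_pow_le_inv_pow h n) (by positivity)
    _ = (((n : ℝ) + 1) ^ M)⁻¹ := by rw [pow_add]; field_simp

theorem summable_inv_sq : Summable fun n : ℕ => (((n : ℝ) + 1) ^ 2)⁻¹ := by
  have h := (summable_nat_add_iff 1).2 (Real.summable_nat_pow_inv.2 one_lt_two)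
  simpa using h

/-- Termwise differentiation of a rapidly convergent sine series. -/
theorem reg_sine_series (hL : 0 < L) (hρ : ∀ Y, 0 < Y → 0 ≤ ρ Y) (hρ1 : ∀ Y, 0 < Y → ρ Y ≤ 1)
    {r : σ × ℕ → ℝ → ℝ} {M a : ℕ} (hM : a + K + 2 ≤ M)
    (hr : Reg L (fun i => modeRate ρ M i.2) K (fun i _ Y => r i Y)) :
    Reg L (fun _ => ρ) K (fun s x Y => ∑' n,
      r (s, n) Y * (freq L n ^ a * Real.sin (freq L n * x + a * (Real.pi / 2)))) := by
  -- An `x`-derivative contributes a factor `freq` and a phase shift by `π/2`, so `a` counts the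
  -- `x`-derivatives already taken and the form of the series is preserved. The condition on `M`
  -- leaves two powers for summability.
  have hterm : ∀ {K : ℕ} {r : σ × ℕ → ℝ → ℝ} {a : ℕ}, a + 2 ≤ M →
      Reg L (fun i => modeRate ρ M i.2) K (fun i _ Y => r i Y) →
      ∃ C, 0 ≤ C ∧ ∀ s n x Y, 0 < Y →
        ‖r (s, n) Y * (freq L n ^ a * Real.sin (freq L n * x + a * (Real.pi / 2)))‖ ≤
          (((n : ℝ) + 1) ^ 2)⁻¹ * (C * ρ Y) := by
    intro K r a haM hr
    obtain ⟨C, hC⟩ := hr.bound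
    refine ⟨|C| * (Real.pi / L) ^ a, by positivity, fun s n x Y hY => ?_⟩
    have h1 := hC (s, n) (L / 2) ⟨by linarith, by linarith⟩ Y hY
    have hρY := hρ Y hY
    have hf := freq_pos n hL
    rw [norm_mul, norm_mul, norm_pow, Real.norm_of_nonneg hf.le]
    have h2 : freq L n ^ a * ‖Real.sin (freq L n * x + a * (Real.pi / 2))‖ ≤ freq L n ^ a :=
      mul_le_of_le_one_right (by positivity) (Real.abs_sin_le_one _)
    have h3 : ‖r (s, n) Y‖ ≤ |C| * modeRate ρ M n Y :=
      h1.trans (mul_le_mul_of_nonneg_right (le_abs_self C) (modeRate_nonneg hρ M n hY))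
    calc _ ≤ (|C| * modeRate ρ M n Y) * freq L n ^ a :=
          mul_le_mul h3 h2 (by positivity)
            (mul_nonneg (abs_nonneg C) (modeRate_nonneg hρ M n hY))
      _ = |C| * ρ Y * (freq L n ^ a * (((n : ℝ) + 1) ^ M)⁻¹) := by rw [modeRate]; ring
      _ ≤ |C| * ρ Y * ((Real.pi / L) ^ a * (((n : ℝ) + 1) ^ 2)⁻¹) :=
          mul_le_mul_of_nonneg_left (freq_pow_mul_inv_le hL (by omega) n) (by positivity)
      _ = _ := by ring
  have hbound : ∀ {K : ℕ} {r : σ × ℕ → ℝ → ℝ} {a : ℕ}, a + 2 ≤ M →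
      Reg L (fun i => modeRate ρ M i.2) K (fun i _ Y => r i Y) →
      ∃ C, ∀ s, ∀ x ∈ Ioo 0 L, ∀ Y, 0 < Y → |∑' n,
        r (s, n) Y * (freq L n ^ a * Real.sin (freq L n * x + a * (Real.pi / 2)))| ≤ C * ρ Y := by
    intro K r a haM hr
    obtain ⟨C, hC0, hC⟩ := hterm haM hr
    refine ⟨(∑' n : ℕ, (((n : ℝ) + 1) ^ 2)⁻¹) * C, fun s x _ Y hY => ?_⟩
    refine (tsum_of_norm_bounded (summable_inv_sq.mul_right (C * ρ Y)).hasSum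
      fun n => hC s n x Y hY).trans ?_
    rw [tsum_mul_right, mul_assoc]
  induction K generalizing r a with
  | zero => exact hbound (by omega) hr
  | succ K ih =>
    refine Reg.mk_succ
      (fx := fun s x Y => ∑' n, r (s, n) Y * (freq L n ^ (a + 1) *
        Real.sin (freq L n * x + (a + 1 : ℕ) * (Real.pi / 2))))
      (fy := fun s x Y => ∑' n, deriv (r (s, n)) Y * (freq L n ^ a *
        Real.sin (freq L n * x + a * (Real.pi / 2))))
      (hbound (by omega) hr) (fun s x hx Y hY => ?_) (fun s x hx Y hY => ?_)
      (ih (a := a + 1) (by omega) hr.of_succ)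
      (ih (r := fun i Y => deriv (r i) Y) (a := a) (by omega) hr.2.2.2)
    · obtain ⟨C, hC0, hC⟩ := hterm (a := a + 1) (by omega) hr
      obtain ⟨D, hD0, hD⟩ := hterm (a := a) (by omega) hr
      refine hasDerivAt_tsum (summable_inv_sq.mul_right (C * ρ Y)) (fun n y => ?_)
        (fun n y => hC s n y Y hY) (y₀ := x) ?_ x
      · have e : Real.sin (freq L n * y + (a + 1 : ℕ) * (Real.pi / 2)) =
            Real.cos (freq L n * y + a * (Real.pi / 2)) := by
          rw [← Real.sin_add_pi_div_two]; congr 1; push_cast; ring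
        rw [e]
        have h1 : HasDerivAt (fun y => freq L n * y + a * (Real.pi / 2)) (freq L n) y := by
          simpa using ((hasDerivAt_id y).const_mul (freq L n)).add_const (a * (Real.pi / 2))
        exact ((h1.sin.const_mul (freq L n ^ a)).const_mul (r (s, n) Y)).congr_deriv (by ring)
      · exact Summable.of_norm_bounded (summable_inv_sq.mul_right (D * ρ Y))
          fun n => hD s n x Y hY
    · obtain ⟨C, hC0, hC⟩ := hterm (r := fun i Y => deriv (r i) Y) (a := a) (by omega) hr.2.2.2
      obtain ⟨D, hD0, hD⟩ := hterm (a := a) (by omega) hr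
      refine hasDerivAt_tsum_of_isPreconnected (summable_inv_sq.mul_right C) isOpen_Ioi
        isPreconnected_Ioi (fun n y hy => ((hr.hasDerivAt_y (i := (s, n)) hx hy).mul_const _))
        (fun n y hy => (hC s n x y hy).trans ?_) (mem_Ioi.2 hY) ?_ (mem_Ioi.2 hY)
      · exact mul_le_mul_of_nonneg_left (mul_le_of_le_one_right hC0 (hρ1 y hy)) (by positivity)
      · exact Summable.of_norm_bounded (summable_inv_sq.mul_right (D * ρ Y))
          fun n => hD s n x Y hY

/-- Absolute convergence permits termwise integration, and orthogonality keeps one term. -/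
theorem sineCoeff_tsum (hL : 0 < L) {b : ℕ → ℝ} (hb : Summable fun n => ‖b n‖) (k : ℕ) :
    sineCoeff L k (fun x => ∑' n, b n * Real.sin (freq L n * x)) = b k * (L / 2) := by
  have h := intervalIntegral.hasSum_intervalIntegral_of_summable_norm (a := 0) (b := L)
    (ι := ℕ) (E := ℝ) (f := fun n => ⟨fun x => b n * Real.sin (freq L n * x) *
      Real.sin (freq L k * x), by fun_prop⟩) (by
      refine Summable.of_nonneg_of_le (fun n => norm_nonneg _) (fun n => ?_) hb
      refine (ContinuousMap.norm_le _ (norm_nonneg _)).2 fun x => ?_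
      simp only [ContinuousMap.restrict_apply, ContinuousMap.coe_mk, norm_mul, mul_assoc]
      refine mul_le_of_le_one_right (norm_nonneg _) ?_
      exact mul_le_one₀ (Real.abs_sin_le_one _) (norm_nonneg _) (Real.abs_sin_le_one _))
  simp only [ContinuousMap.coe_mk] at h
  have e1 : sineCoeff L k (fun x => ∑' n, b n * Real.sin (freq L n * x)) =
      ∫ x in (0 : ℝ)..L, ∑' n, b n * Real.sin (freq L n * x) * Real.sin (freq L k * x) := by
    simp only [sineCoeff, tsum_mul_right]
  have e2 : ∀ n, ∫ x in (0 : ℝ)..L, b n * Real.sin (freq L n * x) * Real.sin (freq L k * x) =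
      if n = k then b k * (L / 2) else 0 := by
    intro n
    have := sineCoeff_sin hL k n
    simp only [sineCoeff] at this
    simp only [mul_assoc]
    rw [intervalIntegral.integral_const_mul, this]
    by_cases hnk : n = k
    · subst hnk; simp
    · simp [hnk, Ne.symm hnk]
  rw [e1, ← h.tsum_eq]
  simp only [e2, tsum_ite_eq]

end Series

end EulerLayer

end

/-! ### The remainder after subtraction of the lift, and the synthesis of the solution. -/

noncomputable section

namespace EulerLayer

section Remainder

variable {κ : WeightKind} {L m m₀ l : ℝ} {u : ℝ → ℝ} {F : ℝ → ℝ → ℝ} {V₀ VL vp : ℝ → ℝ}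
  {v : ℝ → ℝ → ℝ}

/-- The combination of the side traces which enters the `n`-th sine coefficient. -/
def traceJump (L : ℝ) (u : ℝ → ℝ) (F : ℝ → ℝ → ℝ) (V₀ VL : ℝ → ℝ) (n j : ℕ) (Y : ℝ) : ℝ :=
  sideTrace u F 0 V₀ j Y - (-1) ^ (n + 1) * sideTrace u F L VL j Y

/-- The leading part of the `n`-th sine coefficient of a solution. -/
def coeffLift (L : ℝ) (u : ℝ → ℝ) (F : ℝ → ℝ → ℝ) (V₀ VL : ℝ → ℝ) (N n : ℕ) (Y : ℝ) : ℝ :=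
  ∑ j ∈ Finset.range N, (-1) ^ j * (freq L n ^ (2 * j + 1))⁻¹ * traceJump L u F V₀ VL n j Y

/-- The forcing of the `n`-th sine coefficient after subtraction of its leading part. -/
def remainderForcing (L : ℝ) (u : ℝ → ℝ) (F : ℝ → ℝ → ℝ) (V₀ VL : ℝ → ℝ) (N n : ℕ) (Y : ℝ) : ℝ :=
  (-1) ^ N * (freq L n ^ (2 * N))⁻¹ *
    (sineCoeff L n (fun x => partialD (2 * N) 0 F x Y) / u Y +
      freq L n * traceJump L u F V₀ VL n N Y)

/-- Shifting `j` by one multiplies the coefficient by `-f²`. This rewrites the `h_{j+1}` produced by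
the second derivative of `coeffLift` as the lift itself plus two end terms. -/
theorem sum_telescope {f : ℝ} (hf : f ≠ 0) (H : ℕ → ℝ) (N : ℕ) :
    ∑ j ∈ Finset.range N, (-1) ^ j * (f ^ (2 * j + 1))⁻¹ * H (j + 1) =
      f * H 0 - f ^ 2 * (∑ j ∈ Finset.range N, (-1) ^ j * (f ^ (2 * j + 1))⁻¹ * H j) -
        (-1) ^ N * (f ^ (2 * N))⁻¹ * (f * H N) := by
  induction N with
  | zero => simp
  | succ N ih =>
    rw [Finset.sum_range_succ, Finset.sum_range_succ, ih, show 2 * (N + 1) = 2 * N + 1 + 1 by ring,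
      pow_succ f (2 * N + 1), pow_succ f (2 * N), pow_succ (-1 : ℝ)]
    field_simp
    ring

theorem hasDerivAt_sideTrace {V : ℝ → ℝ} {x₀ : ℝ} (hu : IsShearFlow u)
    (hF : ContDiff ℝ ∞ (Function.uncurry F)) (hV : ContDiff ℝ ∞ V) (j : ℕ) {Y : ℝ} (hY : 0 < Y) :
    HasDerivAt (sideTrace u F x₀ V j) (deriv (sideTrace u F x₀ V j) Y) Y ∧
      HasDerivAt (deriv (sideTrace u F x₀ V j)) (iteratedDeriv 2 (sideTrace u F x₀ V j) Y) Y := by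
  obtain ⟨c₀, C₀, hc₀, hb⟩ := hu.bounds
  have hO : IsOpen {Y | u Y ≠ 0} := isOpen_ne_fun hu.smooth.continuous continuous_const
  have hn := hO.mem_nhds (show u Y ≠ 0 from (hc₀.trans_le (hb Y hY.le).1).ne')
  have h := contDiffOn_sideTrace (x₀ := x₀) hu.smooth hF hV j
  refine ⟨((h.differentiableOn (by simp)).differentiableAt hn).hasDerivAt, ?_⟩
  rw [iteratedDeriv_succ, iteratedDeriv_one]
  exact (((h.deriv_of_isOpen (m := ∞) hO (by simp)).differentiableOn
    (by simp)).differentiableAt hn).hasDerivAt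

/-- In the second derivative of the lift, the recursion for the traces yields the boundary forcing
`freq * H_0` and the end point values in the expansion of the coefficient of `F`. Both cancel,
leaving the terms of order `N`. -/
theorem IsSolution.remainder_ode (hL : 0 < L) (hu : IsShearFlow u)
    (hF : ContDiff ℝ ∞ (Function.uncurry F)) (hV₀ : ContDiff ℝ ∞ V₀) (hVL : ContDiff ℝ ∞ VL)
    (hv : IsSolution L u F V₀ VL vp v) (N n : ℕ) :
    ∃ r' : ℝ → ℝ,
      (∀ Y, 0 < Y → HasDerivAt (fun Y => sineCoeff L n (fun x => v x Y) -
        coeffLift L u F V₀ VL N n Y) (r' Y) Y) ∧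
      ∀ Y, 0 < Y → HasDerivAt r' ((freq L n ^ 2 + iteratedDeriv 2 u Y / u Y) *
        (sineCoeff L n (fun x => v x Y) - coeffLift L u F V₀ VL N n Y) -
        remainderForcing L u F V₀ VL N n Y) Y := by
  obtain ⟨c', hc, hc'⟩ := hv.sineCoeff_ode hL hu hF n
  set f := freq L n with hf
  have hf0 : f ≠ 0 := (freq_pos n hL).ne'
  set ε : ℝ := (-1) ^ (n + 1)
  set S' : ℝ → ℝ := fun Y => ∑ j ∈ Finset.range N, (-1) ^ j * (f ^ (2 * j + 1))⁻¹ *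
    (deriv (sideTrace u F 0 V₀ j) Y - ε * deriv (sideTrace u F L VL j) Y) with hS'
  have h1 : ∀ Y, 0 < Y → HasDerivAt (coeffLift L u F V₀ VL N n) (S' Y) Y := fun Y hY =>
    HasDerivAt.fun_sum fun j _ => ((hasDerivAt_sideTrace hu hF hV₀ j hY).1.fun_sub
      ((hasDerivAt_sideTrace hu hF hVL j hY).1.const_mul ε)).const_mul _
  have h2 : ∀ Y, 0 < Y → HasDerivAt S' (∑ j ∈ Finset.range N, (-1) ^ j * (f ^ (2 * j + 1))⁻¹ *
      (iteratedDeriv 2 (sideTrace u F 0 V₀ j) Y -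
        ε * iteratedDeriv 2 (sideTrace u F L VL j) Y)) Y := fun Y hY =>
    HasDerivAt.fun_sum fun j _ => ((hasDerivAt_sideTrace hu hF hV₀ j hY).2.fun_sub
      ((hasDerivAt_sideTrace hu hF hVL j hY).2.const_mul ε)).const_mul _
  refine ⟨fun Y => c' Y - S' Y, fun Y hY => (hc Y hY).fun_sub (h1 Y hY), fun Y hY =>
    ((hc' Y hY).fun_sub (h2 Y hY)).congr_deriv ?_⟩
  have hexp := sineCoeff_expansion n hL (g := fun j x => partialD j 0 F x Y)
    (fun j x => hasDerivAt_partialD_x hF j 0 x Y) N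
  have hF0 : (fun x => partialD 0 0 F x Y) = fun x => F x Y := rfl
  simp only [hF0, ← hf] at hexp
  have htel := sum_telescope hf0 (fun j => traceJump L u F V₀ VL n j Y) N
  have hj : ∀ j, iteratedDeriv 2 (sideTrace u F 0 V₀ j) Y -
      ε * iteratedDeriv 2 (sideTrace u F L VL j) Y =
      -traceJump L u F V₀ VL n (j + 1) Y +
      iteratedDeriv 2 u Y / u Y * traceJump L u F V₀ VL n j Y -
      (partialD (2 * j) 0 F 0 Y - ε * partialD (2 * j) 0 F L Y) / u Y := by
    intro j
    simp only [traceJump, sideTrace]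
    ring
  have hsum : ∑ j ∈ Finset.range N, (-1) ^ j * (f ^ (2 * j + 1))⁻¹ *
      (iteratedDeriv 2 (sideTrace u F 0 V₀ j) Y -
        ε * iteratedDeriv 2 (sideTrace u F L VL j) Y) =
      -(∑ j ∈ Finset.range N, (-1) ^ j * (f ^ (2 * j + 1))⁻¹ *
        traceJump L u F V₀ VL n (j + 1) Y) +
      iteratedDeriv 2 u Y / u Y * coeffLift L u F V₀ VL N n Y -
      (∑ j ∈ Finset.range N, (-1) ^ j * (f ^ (2 * j + 1))⁻¹ *
        (partialD (2 * j) 0 F 0 Y - ε * partialD (2 * j) 0 F L Y)) / u Y := by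
    rw [coeffLift, Finset.mul_sum, Finset.sum_div, ← Finset.sum_neg_distrib,
      ← Finset.sum_add_distrib, ← Finset.sum_sub_distrib]
    refine Finset.sum_congr rfl fun j _ => ?_
    rw [hj]
    ring
  rw [hsum, htel, hexp, remainderForcing, ← hf]
  have h0 : traceJump L u F V₀ VL n 0 Y = V₀ Y - ε * VL Y := rfl
  have hS : ∑ j ∈ Finset.range N, (-1) ^ j * (f ^ (2 * j + 1))⁻¹ *
    traceJump L u F V₀ VL n j Y = coeffLift L u F V₀ VL N n Y := rfl
  rw [hS, h0]
  ring

/-- The corner conditions enter here: they identify the lift at `Y = 0` with the boundary terms in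
the expansion of the bottom datum. -/
theorem IsSolution.remainder_zero (hL : 0 < L) (hvp : ContDiff ℝ ∞ vp)
    (hcorner₀ : ∀ n : ℕ, WellPreparedAt u F 0 V₀ (fun x => -vp x) n)
    (hcornerL : ∀ n : ℕ, WellPreparedAt u F L VL (fun x => -vp x) n)
    (hv : IsSolution L u F V₀ VL vp v) (N n : ℕ) :
    sineCoeff L n (fun x => v x 0) - coeffLift L u F V₀ VL N n 0 =
      (-1) ^ N * (freq L n ^ (2 * N))⁻¹ *
        sineCoeff L n (iteratedDeriv (2 * N) fun x => -vp x) := by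
  have hg : ContDiff ℝ ∞ fun x => -vp x := hvp.neg
  have hexp := sineCoeff_expansion n hL (g := fun j => iteratedDeriv j fun x => -vp x)
    (fun j x => by
      rw [iteratedDeriv_succ]
      exact ((hg.differentiable_iteratedDeriv j
        (WithTop.coe_lt_coe.2 (ENat.natCast_lt_top j))) x).hasDerivAt) N
  have e : sineCoeff L n (fun x => v x 0) = sineCoeff L n (iteratedDeriv 0 fun x => -vp x) :=
    sineCoeff_congr hL fun x hx => by rw [iteratedDeriv_zero, hv.bottom x hx]
  rw [e, hexp, coeffLift, add_comm, add_sub_assoc, add_eq_left, sub_eq_zero]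
  refine Finset.sum_congr rfl fun j _ => ?_
  rw [traceJump, hcorner₀ j j le_rfl, hcornerL j j le_rfl]

theorem reg_index_mul {ι : Type*} {K : ℕ} {W W' : ι → ℝ → ℝ} {c d : ι → ℝ} {f : ι → ℝ → ℝ → ℝ}
    (hf : Reg L W K f) (hcd : ∀ i, |c i| ≤ d i) (hW : ∀ i Y, 0 < Y → 0 ≤ W i Y)
    (hWW' : ∃ D, ∀ i Y, 0 < Y → d i * W i Y ≤ D * W' i Y) :
    Reg L W' K (fun i x Y => c i * f i x Y) :=
  ((Reg.index (a := fun i _ => d i) ⟨1, fun i _ _ => by simpa using hcd i⟩).mul hf).mono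
    (fun i Y hY => mul_nonneg ((abs_nonneg _).trans (hcd i)) (hW i Y hY)) hWW'

theorem reg_traceJump (hL : 0 < L) (hu : IsShearFlow u) (hF : ForcingDecay κ L l F)
    (hV₀ : SideDecay κ m₀ V₀) (hVL : SideDecay κ m₀ VL) (hm : m ≤ m₀) (hl : m ≤ l) (j K : ℕ) :
    Reg L (fun _ => decayRate κ m) K (fun (n : ℕ) _ Y => traceJump L u F V₀ VL n j Y) := by
  refine (sideTrace_reg hu hF hV₀ hm hl ⟨le_rfl, hL.le⟩ j).sub ?_
  refine reg_index_mul (d := fun _ => 1) (W := fun _ => decayRate κ m)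
    (sideTrace_reg hu hF hVL hm hl ⟨hL.le, le_rfl⟩ j) (fun n => by simp)
    (fun _ Y hY => (decayRate_pos hY.le).le) ⟨1, fun _ _ _ => le_rfl⟩

/-- With `N + 1` terms removed, the two contributions have orders `2N + 2` and `2N + 1` in `1/freq`;
the weaker one fixes the rate. -/
theorem reg_remainderForcing (hL : 0 < L) (hu : IsShearFlow u) (hF : ForcingDecay κ L l F)
    (hV₀ : SideDecay κ m₀ V₀) (hVL : SideDecay κ m₀ VL) (hm : m ≤ m₀) (hl : m ≤ l) (N K : ℕ) :
    Reg L (modeRate (decayRate κ m) (2 * N + 1)) K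
      (fun (n : ℕ) _ Y => remainderForcing L u F V₀ VL (N + 1) n Y) := by
  have hW : ∀ (_ : ℕ) Y, 0 < Y → 0 ≤ decayRate κ m Y := fun _ Y hY => (decayRate_pos hY.le).le
  have h1 : Reg L (fun _ => decayRate κ m) K (fun (n : ℕ) _ Y =>
      sineCoeff L n (fun x => partialD (2 * (N + 1)) 0 F x Y) / u Y) := by
    simpa [div_eq_mul_inv] using (hF.reg_sineCoeff hL hl (2 * (N + 1))).mul (hu.reg_inv (ι := ℕ))
  have key : ∀ {p : ℕ} {f : ℕ → ℝ → ℝ → ℝ}, 2 * N + 1 ≤ p → Reg L (fun _ => decayRate κ m) K f →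
      Reg L (modeRate (decayRate κ m) (2 * N + 1)) K
        (fun n x Y => (-1) ^ (N + 1) * (freq L n ^ p)⁻¹ * f n x Y) := by
    intro p f hp hf
    refine reg_index_mul (ι := ℕ)
      (d := fun n => ((Real.pi / L) ^ p)⁻¹ * (((n : ℝ) + 1) ^ (2 * N + 1))⁻¹) hf
      (fun n => ?_) hW ⟨((Real.pi / L) ^ p)⁻¹, fun n Y _ => by rw [modeRate, mul_assoc]⟩
    have := freq_pos n hL
    rw [abs_mul, abs_pow, abs_neg, abs_one, one_pow, one_mul, abs_of_pos (by positivity)]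
    exact freq_pow_inv_le hL hp n
  refine ((key (p := 2 * (N + 1)) (by omega) h1).add (key (p := 2 * N + 1) le_rfl
    (reg_traceJump hL hu hF hV₀ hVL hm hl (N + 1) K))).congr fun n x _ Y _ => ?_
  have hf := (freq_pos n hL).ne'
  have e : (freq L n ^ (2 * N + 1))⁻¹ = (freq L n ^ (2 * (N + 1)))⁻¹ * freq L n := by
    rw [show 2 * (N + 1) = 2 * N + 1 + 1 by ring, pow_succ _ (2 * N + 1)]; field_simp
  rw [remainderForcing, e]
  ring

/-- A bound for the first derivative in terms of the function and its second derivative. -/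
theorem abs_deriv_le_of_second {f f' f'' : ℝ → ℝ} {Y A B : ℝ}
    (h : ∀ t ∈ Icc Y (Y + 1), HasDerivAt f (f' t) t)
    (h' : ∀ t ∈ Icc Y (Y + 1), HasDerivAt f' (f'' t) t)
    (hA : ∀ t ∈ Icc Y (Y + 1), |f t| ≤ A) (hB : ∀ t ∈ Icc Y (Y + 1), |f'' t| ≤ B) :
    |f' Y| ≤ 2 * A + B := by
  have h01 : Y < Y + 1 := by linarith
  obtain ⟨ξ, hξ, e⟩ := exists_hasDerivAt_eq_slope f f' h01
    (fun t ht => (h t ht).continuousAt.continuousWithinAt)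
    fun t ht => h t (Ioo_subset_Icc_self ht)
  have h2 := (convex_Icc Y (Y + 1)).norm_image_sub_le_of_norm_hasDerivWithin_le (f := f')
    (fun t ht => (h' t ht).hasDerivWithinAt) (fun t ht => hB t ht) ⟨le_rfl, h01.le⟩
    (Ioo_subset_Icc_self hξ)
  have hB0 : 0 ≤ B := (abs_nonneg _).trans (hB Y ⟨le_rfl, h01.le⟩)
  have h3 : ‖ξ - Y‖ ≤ 1 := by
    rw [Real.norm_of_nonneg (by linarith [hξ.1])]; linarith [hξ.2]
  have h4 : |f' ξ - f' Y| ≤ B := h2.trans (mul_le_of_le_one_right hB0 h3)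
  have h5 : |f' ξ| ≤ 2 * A := by
    rw [e, add_sub_cancel_left, div_one]
    have := abs_sub (f (Y + 1)) (f Y)
    linarith [hA Y ⟨le_rfl, h01.le⟩, hA (Y + 1) ⟨h01.le, le_rfl⟩]
  have h6 := abs_sub (f' ξ) (f' ξ - f' Y)
  rw [sub_sub_cancel] at h6
  linarith

/-- Regularity of a family of solutions of `r'' = (freq² + u''/u) r - R`; each derivative costs
two powers of the frequency. -/
theorem reg_of_ode {σ : Type*} (hL : 0 < L) (hm : 0 ≤ m) (hu : IsShearFlow u)
    {r r' R : σ × ℕ → ℝ → ℝ} {M₀ : ℕ}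
    (hr : ∀ i Y, 0 < Y → HasDerivAt (r i) (r' i Y) Y)
    (hr' : ∀ i Y, 0 < Y →
      HasDerivAt (r' i) ((freq L i.2 ^ 2 + iteratedDeriv 2 u Y / u Y) * r i Y - R i Y) Y)
    (hb : ∃ C, ∀ i Y, 0 < Y → |r i Y| ≤ C * modeRate (decayRate κ m) M₀ i.2 Y)
    (hR : ∀ K, Reg L (fun i => modeRate (decayRate κ m) M₀ i.2) K (fun i _ Y => R i Y)) (K : ℕ) :
    ∀ M, M + 2 * K + 2 ≤ M₀ →
      Reg L (fun i => modeRate (decayRate κ m) M i.2) K (fun i _ Y => r i Y) ∧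
      Reg L (fun i => modeRate (decayRate κ m) M i.2) K (fun i _ Y => r' i Y) := by
  have hρ : ∀ Y, 0 < Y → 0 ≤ decayRate κ m Y := fun Y hY => (decayRate_pos hY.le).le
  have hρ' : ∀ M (i : σ × ℕ) Y, 0 < Y → 0 ≤ modeRate (decayRate κ m) M i.2 Y :=
    fun M i Y hY => modeRate_nonneg hρ M i.2 hY
  have hmono : ∀ {J M p : ℕ} {f : σ × ℕ → ℝ → ℝ → ℝ}, M ≤ p →
      Reg L (fun i => modeRate (decayRate κ m) p i.2) J f →
      Reg L (fun i => modeRate (decayRate κ m) M i.2) J f := fun hMp hf =>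
    hf.mono (hρ' _) ⟨1, fun i Y hY => by simpa using modeRate_anti hρ hMp i.2 hY⟩
  have hrhs : ∀ {J M : ℕ}, M + 2 ≤ M₀ →
      Reg L (fun i => modeRate (decayRate κ m) (M + 2) i.2) J (fun i _ Y => r i Y) →
      Reg L (fun i => modeRate (decayRate κ m) M i.2) J (fun i _ Y =>
        (freq L i.2 ^ 2 + iteratedDeriv 2 u Y / u Y) * r i Y - R i Y) := by
    intro J M hM h
    have h1 : Reg L (fun i => modeRate (decayRate κ m) M i.2) J
        (fun i _ Y => freq L i.2 ^ 2 * r i Y) := by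
      refine reg_index_mul (d := fun i => freq L i.2 ^ 2) h
        (fun i => by rw [abs_of_nonneg (sq_nonneg _)]) (hρ' _) ⟨(Real.pi / L) ^ 2, fun i Y hY => ?_⟩
      rw [modeRate, modeRate, ← mul_assoc, ← mul_assoc]
      exact mul_le_mul_of_nonneg_right (freq_pow_mul_inv_le hL le_rfl i.2) (hρ Y hY)
    have h2 : Reg L (fun i => modeRate (decayRate κ m) M i.2) J
        (fun i _ Y => iteratedDeriv 2 u Y / u Y * r i Y) := by
      simpa using hu.reg_potential.mul (hmono (show M ≤ M + 2 by omega) h)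
    exact ((h1.add h2).sub (hmono (show M ≤ M₀ by omega) (hR J))).congr
      fun i x _ Y _ => by ring
  obtain ⟨C, hC⟩ := hb
  have h0 : Reg L (fun i => modeRate (decayRate κ m) M₀ i.2) 0 (fun i _ Y => r i Y) :=
    ⟨C, fun i _ _ Y hY => hC i Y hY⟩
  have hx2 : L / 2 ∈ Ioo 0 L := ⟨by linarith, by linarith⟩
  have hr0 : ∀ {M}, M + 2 ≤ M₀ →
      Reg L (fun i => modeRate (decayRate κ m) M i.2) 0 (fun i _ Y => r' i Y) := by
    intro M hM
    obtain ⟨A, hA⟩ := hmono (show M ≤ M₀ by omega) h0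
    obtain ⟨B, hB⟩ := hrhs hM (hmono hM h0)
    refine ⟨2 * |A| + |B|, fun i x _ Y hY => ?_⟩
    -- The interpolation looks only towards larger `t`, where the rate is no larger; this also stays
    -- away from `Y = 0`.
    have hdec : ∀ t ∈ Icc Y (Y + 1),
        modeRate (decayRate κ m) M i.2 t ≤ modeRate (decayRate κ m) M i.2 Y := fun t ht =>
      mul_le_mul_of_nonneg_left (decayRate_anti hm hY.le ht.1) (by positivity)
    have hpos : ∀ t ∈ Icc Y (Y + 1), 0 < t := fun t ht => hY.trans_le ht.1
    have hle : ∀ {D a t : ℝ}, t ∈ Icc Y (Y + 1) → a ≤ D * modeRate (decayRate κ m) M i.2 t →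
        a ≤ |D| * modeRate (decayRate κ m) M i.2 Y := fun ht h =>
      h.trans ((mul_le_mul_of_nonneg_right (le_abs_self _) (hρ' M i _ (hpos _ ht))).trans
        (mul_le_mul_of_nonneg_left (hdec _ ht) (abs_nonneg _)))
    refine (abs_deriv_le_of_second (fun t ht => hr i t (hpos t ht))
      (fun t ht => hr' i t (hpos t ht))
      (fun t ht => hle ht (hA i (L / 2) hx2 t (hpos t ht)))
      (fun t ht => hle ht (hB i (L / 2) hx2 t (hpos t ht)))).trans (le_of_eq (by ring))
  -- `r` and `r'` are treated together: differentiating `r'` gives back `r` with a factor `freq²`,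
  -- so each step asks for `M + 2`.
  induction K with
  | zero => exact fun M hM => ⟨hmono (by omega) h0, hr0 (by omega)⟩
  | succ K ih =>
    intro M hM
    have hz : Reg L (fun i : σ × ℕ => modeRate (decayRate κ m) M i.2) K (fun _ _ _ => 0) :=
      Reg.index (c := fun _ => 0) ⟨0, fun _ _ _ => by simp⟩
    refine ⟨Reg.mk_succ (hmono (by omega) h0) (fun i x _ Y _ => hasDerivAt_const _ _)
      (fun i x _ Y hY => hr i Y hY) hz (ih M (by omega)).2,
      Reg.mk_succ (hr0 (by omega)) (fun i x _ Y _ => hasDerivAt_const _ _)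
      (fun i x _ Y hY => hr' i Y hY) hz (hrhs (by omega) (ih (M + 2) (by omega)).1)⟩

end Remainder

section Solution

variable {κ : WeightKind} {L m m₀ l : ℝ} {u : ℝ → ℝ} {F : ℝ → ℝ → ℝ} {V₀ VL vp : ℝ → ℝ}

/-- The remainders of the sine coefficients of all solutions, after subtraction of their leading
parts, decay rapidly in the frequency together with their derivatives. -/
theorem reg_remainder (hL : 0 < L) (hm : 0 ≤ m)
    (hsmall : κ = WeightKind.exponential → m * L < Real.pi)
    (hu : IsShearFlow u) (hF : ForcingDecay κ L l F) (hV₀ : SideDecay κ m₀ V₀)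
    (hVL : SideDecay κ m₀ VL) (hm₀ : m ≤ m₀) (hl : m ≤ l) (hvp : ContDiff ℝ ∞ vp)
    (hcorner₀ : ∀ n : ℕ, WellPreparedAt u F 0 V₀ (fun x => -vp x) n)
    (hcornerL : ∀ n : ℕ, WellPreparedAt u F L VL (fun x => -vp x) n) {N K M : ℕ}
    (hM : M + 2 * K + 2 ≤ 2 * N + 1) :
    Reg L (fun i => modeRate (decayRate κ m) M i.2) K
      (fun (i : {v // IsSolution L u F V₀ VL vp v} × ℕ) _ Y =>
        sineCoeff L i.2 (fun x => i.1.1 x Y) - coeffLift L u F V₀ VL (N + 1) i.2 Y) := by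
  choose r' hr hr' using fun i : {v // IsSolution L u F V₀ VL vp v} × ℕ =>
    i.1.2.remainder_ode hL hu hF.smooth hV₀.smooth hVL.smooth (N + 1) i.2
  have hRreg : ∀ K, Reg L (modeRate (decayRate κ m) (2 * N + 1)) K
      (fun (n : ℕ) _ Y => remainderForcing L u F V₀ VL (N + 1) n Y) :=
    reg_remainderForcing hL hu hF hV₀ hVL hm₀ hl N
  refine (reg_of_ode hL hm hu (R := fun i => remainderForcing L u F V₀ VL (N + 1) i.2) hr hr' ?_
    (fun K => (hRreg K).comap Prod.snd) K M hM).1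
  obtain ⟨C, hC0, hest⟩ := exists_decay_estimate (κ := κ) hu hL hm hsmall
  obtain ⟨A, hA⟩ := (hRreg 0).bound
  obtain ⟨D, hD⟩ := (isCompact_Icc (a := (0 : ℝ)) (b := L)).exists_bound_of_continuousOn
    (hvp.neg.continuous_iteratedDeriv (2 * (N + 1)) (WithTop.coe_le_coe.2 le_top)).continuousOn
  -- The two summands bound the forcing and the value at `Y = 0`; each comes with the factor
  -- `(n+1)^(-(2N+1))`.
  set E := |A| + ((Real.pi / L) ^ (2 * (N + 1)))⁻¹ * (L * |D|) with hE
  have hE0 : 0 ≤ E := by positivity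
  refine ⟨C * E, fun i Y hY => ?_⟩
  have h := hest i.2 (E * (((i.2 : ℝ) + 1) ^ (2 * N + 1))⁻¹)
    (fun Y => sineCoeff L i.2 (fun x => i.1.1 x Y) - coeffLift L u F V₀ VL (N + 1) i.2 Y) (r' i)
    (remainderForcing L u F V₀ VL (N + 1) i.2) (by positivity) ?_ (hr i) (hr' i) ?_ ?_ ?_ Y hY.le
  · refine h.trans (le_of_eq ?_)
    rw [modeRate]; ring
  · refine ContinuousOn.sub ?_ ?_
    · have hc := continuous_sineCoeff (n := i.2) (L := L) (f := fun Y x => extend L i.1.1 x Y)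
        ((continuous_extend hL i.1.2.continuousOn).comp continuous_swap)
      exact hc.continuousOn.congr fun Y hY =>
        sineCoeff_congr hL fun x hx => (extend_eq hx hY).symm
    · exact continuousOn_finsetSum _ fun j _ => continuousOn_const.mul
        ((hu.continuousOn_sideTrace hF.smooth hV₀.smooth j).sub
          (continuousOn_const.mul (hu.continuousOn_sideTrace hF.smooth hVL.smooth j)))
  · have hS : ∃ B, ∀ Y, 0 ≤ Y → |coeffLift L u F V₀ VL (N + 1) i.2 Y| ≤ B := by
      have hreg : Reg L (fun _ => decayRate κ m) 0
          (fun (n : ℕ) _ Y => coeffLift L u F V₀ VL (N + 1) i.2 Y) :=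
        Reg.sum _ fun j _ => ((reg_traceJump hL hu hF hV₀ hVL hm₀ hl j 0).comap
          fun _ : ℕ => i.2).const_mul _
      obtain ⟨B, hB⟩ := hreg
      refine ⟨|B| + |coeffLift L u F V₀ VL (N + 1) i.2 0|, fun Y hY => ?_⟩
      rcases hY.eq_or_lt with rfl | hY
      · linarith [abs_nonneg B]
      · have h1 := hB 0 (L / 2) ⟨by linarith, by linarith⟩ Y hY
        have h2 : B * decayRate κ m Y ≤ |B| * 1 :=
          mul_le_mul (le_abs_self B) (decayRate_le_one hm hY.le) (decayRate_pos hY.le).le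
            (abs_nonneg B)
        linarith [abs_nonneg (coeffLift L u F V₀ VL (N + 1) i.2 0)]
    obtain ⟨B, hB⟩ := hS
    exact (i.1.2.sublinear_sineCoeff hL i.2).sub_bounded hB
  · intro Y hY
    refine (hA i.2 (L / 2) ⟨by linarith, by linarith⟩ Y hY).trans ?_
    have hp := modeRate_nonneg (ρ := decayRate κ m) (fun Y hY => (decayRate_pos hY.le).le)
      (2 * N + 1) i.2 hY
    calc A * modeRate (decayRate κ m) (2 * N + 1) i.2 Y
        ≤ E * modeRate (decayRate κ m) (2 * N + 1) i.2 Y := by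
          refine mul_le_mul_of_nonneg_right ((le_abs_self A).trans ?_) hp
          rw [hE]; exact le_add_of_nonneg_right (by positivity)
      _ = _ := by rw [modeRate]; ring
  · rw [i.1.2.remainder_zero hL hvp hcorner₀ hcornerL (N + 1) i.2, abs_mul, abs_mul, abs_pow,
      abs_neg, abs_one, one_pow, one_mul]
    have hf := freq_pos i.2 hL
    rw [abs_of_pos (by positivity : 0 < (freq L i.2 ^ (2 * (N + 1)))⁻¹)]
    have h1 : |sineCoeff L i.2 (iteratedDeriv (2 * (N + 1)) fun x => -vp x)| ≤ L * |D| :=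
      abs_sineCoeff_le hL i.2 fun x hx => (hD x hx).trans (le_abs_self D)
    have h2 := freq_pow_inv_le hL (show 2 * N + 1 ≤ 2 * (N + 1) by omega) i.2
    calc _ ≤ (((Real.pi / L) ^ (2 * (N + 1)))⁻¹ * (((i.2 : ℝ) + 1) ^ (2 * N + 1))⁻¹) * (L * |D|) :=
          mul_le_mul h2 h1 (abs_nonneg _) (by positivity)
      _ = ((Real.pi / L) ^ (2 * (N + 1)))⁻¹ * (L * |D|) * (((i.2 : ℝ) + 1) ^ (2 * N + 1))⁻¹ := by
          ring
      _ ≤ _ := by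
          refine mul_le_mul_of_nonneg_right ?_ (by positivity)
          rw [hE]; exact le_add_of_nonneg_left (abs_nonneg A)

/-- All solutions are regular to every order in the strip, with uniform bounds. -/
theorem reg_solution (hL : 0 < L) (hm : 0 ≤ m)
    (hsmall : κ = WeightKind.exponential → m * L < Real.pi)
    (hu : IsShearFlow u) (hF : ForcingDecay κ L l F) (hV₀ : SideDecay κ m₀ V₀)
    (hVL : SideDecay κ m₀ VL) (hm₀ : m ≤ m₀) (hl : m ≤ l) (hvp : ContDiff ℝ ∞ vp)
    (hcorner₀ : ∀ n : ℕ, WellPreparedAt u F 0 V₀ (fun x => -vp x) n)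
    (hcornerL : ∀ n : ℕ, WellPreparedAt u F L VL (fun x => -vp x) n) (K : ℕ) :
    Reg L (fun _ => decayRate κ m) K
      (fun (v : {v // IsSolution L u F V₀ VL vp v}) x Y => v.1 x Y) := by
  have hρ : ∀ Y, 0 < Y → 0 ≤ decayRate κ m Y := fun Y hY => (decayRate_pos hY.le).le
  -- `M = K + 2` is what `reg_sine_series` requires with `a = 0`; `N = 2K + 2` suffices because `3K
  -- + 4 ≤ 4K + 5`.
  have hrem := reg_remainder (M := K + 2) (K := K) (N := 2 * K + 2) hL hm hsmall hu hF hV₀ hVL hm₀ hl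
    hvp hcorner₀ hcornerL (by omega)
  set N := 2 * K + 2
  set r : {v // IsSolution L u F V₀ VL vp v} × ℕ → ℝ → ℝ := fun i Y =>
    sineCoeff L i.2 (fun x => i.1.1 x Y) - coeffLift L u F V₀ VL (N + 1) i.2 Y with hr
  choose p hp hp' using exists_lift_left hL
  choose p₂ hp₂ hp₂' using exists_lift_right hL
  have hS : Reg L (fun _ => decayRate κ m) K
      (fun (_ : {v // IsSolution L u F V₀ VL vp v}) x Y => ∑ j ∈ Finset.range (N + 1),
        (p j x * sideTrace u F 0 V₀ j Y + p₂ j x * sideTrace u F L VL j Y)) := by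
    refine Reg.sum _ fun j _ => Reg.add ?_ ?_
    · simpa using (reg_of_contDiff_fst (hp j)).mul
        (sideTrace_reg hu hF hV₀ hm₀ hl ⟨le_rfl, hL.le⟩ j)
    · simpa using (reg_of_contDiff_fst (hp₂ j)).mul
        (sideTrace_reg hu hF hVL hm₀ hl ⟨hL.le, le_rfl⟩ j)
  have hE := reg_sine_series (a := 0) hL hρ (fun Y hY => decayRate_le_one hm hY.le)
    (show 0 + K + 2 ≤ K + 2 by omega) hrem
  -- The right representation is already regular; it remains to identify it with the solution. For
  -- fixed `Y` both are continuous in `x`, so equal sine coefficients suffice; `2 / L` normalises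
  -- the sines.
  refine (hS.add (hE.const_mul (2 / L))).congr fun s x hx Y hY => ?_
  simp only [pow_zero, one_mul, Nat.cast_zero, zero_mul, add_zero]
  obtain ⟨C, hC⟩ := hrem.bound
  have hsum : Summable fun n => ‖r (s, n) Y‖ := by
    refine Summable.of_nonneg_of_le (fun n => norm_nonneg _) (fun n => ?_)
      (summable_inv_sq.mul_left |C|)
    refine (hC (s, n) x hx Y hY).trans ?_
    have h1 : modeRate (decayRate κ m) (K + 2) n Y ≤ (((n : ℝ) + 1) ^ 2)⁻¹ :=
      (mul_le_of_le_one_right (by positivity) (decayRate_le_one hm hY.le)).trans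
        (inv_pow_le_inv_pow (by omega) n)
    exact (mul_le_mul_of_nonneg_right (le_abs_self C) (modeRate_nonneg hρ _ n hY)).trans
      (mul_le_mul_of_nonneg_left h1 (abs_nonneg C))
  have hg1 : Continuous fun x => extend L s.1 x Y :=
    (continuous_extend hL s.2.continuousOn).comp (f := fun x => (x, Y)) (by fun_prop)
  have hg2 : Continuous fun x => ∑ j ∈ Finset.range (N + 1),
      (p j x * sideTrace u F 0 V₀ j Y + p₂ j x * sideTrace u F L VL j Y) := by
    have h1 := fun j => (hp j).continuous
    have h2 := fun j => (hp₂ j).continuous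
    fun_prop
  have hg3 : Continuous fun x => ∑' n, r (s, n) Y * Real.sin (freq L n * x) := by
    refine continuous_tsum (fun n => by fun_prop) hsum fun n x => ?_
    rw [norm_mul]
    exact mul_le_of_le_one_right (norm_nonneg _) (Real.abs_sin_le_one _)
  have hzero := eq_zero_of_sineCoeff_eq_zero hL ((hg1.sub hg2).sub (hg3.const_mul (2 / L)))
    fun n => ?_
  · have h := hzero x hx
    simp only [Pi.sub_apply, extend_eq (Ioo_subset_Icc_self hx) hY.le] at h
    linarith
  · have hint : ∀ {g : ℝ → ℝ}, Continuous g → IntervalIntegrable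
        (fun x => g x * Real.sin (freq L n * x)) volume 0 L := fun hg =>
      (hg.mul (by fun_prop)).intervalIntegrable _ _
    have hsub : ∀ {g₁ g₂ : ℝ → ℝ}, Continuous g₁ → Continuous g₂ →
        sineCoeff L n (g₁ - g₂) = sineCoeff L n g₁ - sineCoeff L n g₂ := fun h1 h2 => by
      simp only [sineCoeff, Pi.sub_apply, sub_mul]
      exact intervalIntegral.integral_sub (hint h1) (hint h2)
    have hmul : ∀ (c : ℝ) (g : ℝ → ℝ),
        sineCoeff L n (fun x => c * g x) = c * sineCoeff L n g := fun c g => by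
      simp only [sineCoeff, mul_assoc]
      exact intervalIntegral.integral_const_mul _ _
    have e1 : sineCoeff L n (fun x => extend L s.1 x Y) = sineCoeff L n fun x => s.1 x Y :=
      sineCoeff_congr hL fun x hx => extend_eq hx hY.le
    have e2 : sineCoeff L n (fun x => ∑ j ∈ Finset.range (N + 1),
        (p j x * sideTrace u F 0 V₀ j Y + p₂ j x * sideTrace u F L VL j Y)) =
        coeffLift L u F V₀ VL (N + 1) n Y := by
      have i0 : ∀ j ∈ Finset.range (N + 1), IntervalIntegrable (fun x =>
          (p j x * sideTrace u F 0 V₀ j Y + p₂ j x * sideTrace u F L VL j Y) *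
            Real.sin (freq L n * x)) volume 0 L := fun j _ => hint
        (((hp j).continuous.mul continuous_const).add ((hp₂ j).continuous.mul continuous_const))
      simp only [sineCoeff, Finset.sum_mul]
      rw [intervalIntegral.integral_finsetSum i0, coeffLift]
      refine Finset.sum_congr rfl fun j _ => ?_
      have i1 : IntervalIntegrable (fun x => sideTrace u F 0 V₀ j Y *
          (p j x * Real.sin (freq L n * x))) volume 0 L := (hint (hp j).continuous).const_mul _
      have i2 : IntervalIntegrable (fun x => sideTrace u F L VL j Y *
          (p₂ j x * Real.sin (freq L n * x))) volume 0 L := (hint (hp₂ j).continuous).const_mul _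
      have a1 := hp' j n
      have a2 := hp₂' j n
      simp only [sineCoeff] at a1 a2
      rw [show (fun x => (p j x * sideTrace u F 0 V₀ j Y + p₂ j x * sideTrace u F L VL j Y) *
        Real.sin (freq L n * x)) = fun x => sideTrace u F 0 V₀ j Y *
          (p j x * Real.sin (freq L n * x)) + sideTrace u F L VL j Y *
          (p₂ j x * Real.sin (freq L n * x)) by ext x; ring,
        intervalIntegral.integral_add i1 i2, intervalIntegral.integral_const_mul,
        intervalIntegral.integral_const_mul, a1, a2, traceJump]
      ring
    have e3 := sineCoeff_tsum hL hsum n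
    rw [hsub (hg1.sub hg2) (hg3.const_mul (2 / L)), hsub hg1 hg2, e1, e2, hmul, e3]
    simp only [hr]
    field_simp
    ring

end Solution

/-- Uniform bounds for the partial derivatives of a regular family give a uniform bound for the
`W^{k,∞}` norms. -/
theorem exists_wkInftyNorm_le {ι : Type*} {L : ℝ} {k : ℕ} {f : ι → ℝ → ℝ → ℝ}
    (h : Reg L (fun _ _ => 1) k f) : ∃ C : ℝ≥0, ∀ i, wkInftyNorm L k (f i) ≤ C := by
  have hC : ∀ a b, ∃ C, a + b ≤ k → ∀ i, ∀ x ∈ Ioo 0 L, ∀ Y, 0 < Y →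
      |partialD a b (f i) x Y| ≤ C := by
    intro a b
    by_cases hab : a + b ≤ k
    · obtain ⟨C, hC⟩ := h.partialD_bound hab
      exact ⟨C, fun _ i x hx Y hY => by simpa using hC i x hx Y hY⟩
    · exact ⟨0, fun h => absurd h hab⟩
  choose C hC using hC
  refine ⟨∑ a ∈ Finset.range (k + 1), ∑ b ∈ Finset.range (k + 1), (C a b).toNNReal, fun i => ?_⟩
  refine iSup_le fun a => iSup_le fun b => iSup_le fun hab => ?_
  rw [eLpNorm_exponent_top]
  refine (eLpNormEssSup_le_of_ae_bound (C := C a b) ?_).trans ?_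
  · filter_upwards [ae_restrict_mem (isOpen_strip L).measurableSet] with q hq
    exact hC a b hab i q.1 hq.1 q.2 hq.2
  · rw [ENNReal.ofReal]
    refine ENNReal.coe_le_coe.2 ?_
    calc (C a b).toNNReal ≤ ∑ b ∈ Finset.range (k + 1), (C a b).toNNReal :=
          Finset.single_le_sum (f := fun b => (C a b).toNNReal) (fun _ _ => zero_le)
            (Finset.mem_range.2 (by omega))
      _ ≤ _ := Finset.single_le_sum
          (f := fun a => ∑ b ∈ Finset.range (k + 1), (C a b).toNNReal) (fun _ _ => zero_le)
            (Finset.mem_range.2 (by omega))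

end EulerLayer

end

/-! ### Conclusion: weighted norm bound and smoothness. -/

theorem lemma3p6
    (κ : EulerLayer.WeightKind) (L m l : ℝ) (hL : 0 < L) (hm : 0 < m) (hl : 0 < l)
    (u : ℝ → ℝ) (hu : EulerLayer.IsShearFlow u)
    (F : ℝ → ℝ → ℝ) (hF : EulerLayer.ForcingDecay κ L l F)
    (V₀ VL : ℝ → ℝ) (hV₀ : EulerLayer.SideDecay κ m V₀) (hVL : EulerLayer.SideDecay κ m VL)
    (vp : ℝ → ℝ) (hvp : ContDiff ℝ ∞ vp)
    (hcorner₀ : ∀ n : ℕ, EulerLayer.WellPreparedAt u F 0 V₀ (fun x => -vp x) n)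
    (hcornerL : ∀ n : ℕ, EulerLayer.WellPreparedAt u F L VL (fun x => -vp x) n)
    (m' : ℝ) (hm' : m' < min m l)
    (hsmall : κ = EulerLayer.WeightKind.exponential → m' * L < Real.pi)
    (k : ℕ) :
    ∃ C : ℝ≥0, ∀ v : ℝ → ℝ → ℝ, EulerLayer.IsSolution L u F V₀ VL vp v →
      ContDiffOn ℝ ∞ (Function.uncurry v) (EulerLayer.strip L) ∧
      EulerLayer.wkInftyNorm L k (fun x Y => v x Y * EulerLayer.weight κ m' Y) ≤ C := by
  -- `m'` may be negative, whereas the decay estimates need a nonnegative exponent; they are applied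
  -- to `max m' 0`, whose weight dominates that of `m'`.
  have hsmall' : κ = EulerLayer.WeightKind.exponential → max m' 0 * L < Real.pi := by
    intro h
    rcases le_total m' 0 with h0 | h0
    · rw [max_eq_right h0, zero_mul]; exact Real.pi_pos
    · rw [max_eq_left h0]; exact hsmall h
  have hreg := EulerLayer.reg_solution (m := max m' 0) hL (le_max_right _ _) hsmall' hu hF hV₀ hVL
    (max_le (hm'.le.trans (min_le_left _ _)) hm.le) (max_le (hm'.le.trans (min_le_right _ _)) hl.le)
    hvp hcorner₀ hcornerL
  have hw : EulerLayer.Reg L (fun _ _ => 1) k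
      (fun (v : {v // EulerLayer.IsSolution L u F V₀ VL vp v}) x Y =>
        v.1 x Y * EulerLayer.weight κ m' Y) := by
    refine ((hreg k).mul (EulerLayer.reg_weight m')).mono (fun _ Y hY => ?_) ⟨1, fun _ Y hY => ?_⟩
    · exact mul_nonneg (EulerLayer.decayRate_pos hY.le).le (EulerLayer.weight_pos hY.le).le
    · rw [EulerLayer.decayRate, one_mul, ← div_eq_inv_mul,
        div_le_one (EulerLayer.weight_pos hY.le)]
      exact EulerLayer.weight_le_weight (le_max_left _ _) hY.le
  obtain ⟨C, hC⟩ := EulerLayer.exists_wkInftyNorm_le hw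
  refine ⟨C, fun v hv => ⟨contDiffOn_infty.2 fun n => ?_, hC ⟨v, hv⟩⟩⟩
  -- Bounds on `n + 1` orders give `C^n`, by `Reg.contDiffOn`.
  have h1 : EulerLayer.Reg L (fun _ _ => 1) (n + 1)
      (fun (v : {v // EulerLayer.IsSolution L u F V₀ VL vp v}) x Y => v.1 x Y) :=
    (hreg (n + 1)).mono (fun _ Y hY => (EulerLayer.decayRate_pos hY.le).le) ⟨1, fun _ Y hY => by
      simpa using EulerLayer.decayRate_le_one (le_max_right _ _) hY.le⟩
  exact h1.contDiffOn ⟨v, hv⟩
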